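/- Let $d\ge 0$, $\rho\in[0,1]$, $m_1,m_2\in\mathbb R$. Write $X=(x,\xi)$, $Y=(y,\eta)$, $Z=(z,\zeta)$ for points of phase space $\mathbb R^d\times\mathbb R^d$, $\sigma(X,Y)=\xi\cdot y-x\cdot\eta$, $\langle\xi\rangle=(1+|\xi|^2)^{1/2}$, and let $(\mathcal F f)(X)=(2\pi)^{-d}\int e^{i\sigma(X,Y)}f(Y)\,dY=(\mathcal F^{-1}f)(X)$ be the symplectic Fourier transform. For $m\in\mathbb R$ let $S^m_\rho$ be the space of $f\in C^\infty(\mathbb R^{2d},\mathbb C)$ such that all seminorms $\sup_{x,\xi}\langle\xi\rangle^{-m+|\alpha|\rho}\,|\partial_x^a\partial_\xi^\alpha f(x,\xi)|$ are finite. Let $B=(B_{lj})$ be a magnetic field on $\mathbb R^d$ with components in $\mathcal{BC}^\infty$ (smooth, bounded with all derivatives) and $B=dA$, i.e. $B_{lj}=\partial_lA_j-\partial_jA_l$, for some vector potential $A$ with components in $C^\infty_{\mathrm{pol}}$ (smooth with polynomially bounded derivatives). For $\varepsilon\in(0,1]$ and $\lambda\in[0,1]$ the magnetic Weyl quantization of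 a symbol $f$ acts on Schwartz functions $\varphi$ by the oscillatory integral $$(\mathrm{Op}^A_{\varepsilon,\lambda}(f)\varphi)(x)=\frac1{(2\pi)^d}\int d\eta\int dy\;e^{-i(y-x)\cdot\eta}\,e^{-i\frac{\lambda}{\varepsilon}\int_{[\varepsilon x,\varepsilon y]}A}\,f\bigl(\tfrac\varepsilon2(x+y),\eta\bigr)\,\varphi(y).$$ The magnetic Weyl product $f\sharp^B_{\varepsilon,\lambda}g$ is the symbol $h\in\bigcup_mS^m_\rho$ with $\mathrm{Op}^A_{\varepsilon,\lambda}(f)\,\mathrm{Op}^A_{\varepsilon,\lambda}(g)=\mathrm{Op}^A_{\varepsilon,\lambda}(h)$ on Schwartz functions for every such vector potential $A$ of $B$. The ordinary Weyl product $f\sharp_\varepsilon g$ is defined in the same way with the ordinary Weyl quantization (the case $A=0$). The scaled flux is $$\gamma_\varepsilon(x,y,z)=\frac1\varepsilon\int_{T}B,$$ where $T$ is the oriented triangle with corners $x-\tfrac\varepsilon2(y+z)$, $x+\tfrac\varepsilon2(y-z)$, $x+\tfrac\varepsilon2(y+z)$. For a weight $G(x,y,z)$ denote by $$I_\varepsilon[G](X)=\frac1{(2\pi)^{2d}}\int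 dY\int dZ\;e^{i\sigma(X,Y+Z)}\,e^{i\frac\varepsilon2\sigma(Y,Z)}\,G(x,y,z)\,(\mathcal F^{-1}f)(Y)\,(\mathcal F^{-1}g)(Z)$$ the oscillatory integral, i.e. the limit $\delta\downarrow0$ of the integrals with $f,g$ replaced by $\chi(\delta\,\cdot)f$, $\chi(\delta\,\cdot)g$, existing and being the same for all Schwartz functions $\chi$ with $\chi(0)=1$. **Theorem.** Let $f\in S^{m_1}_\rho$ and $g\in S^{m_2}_\rho$. 1. For all $\varepsilon\in(0,1]$, $\lambda\in[0,1]$ the magnetic Weyl product $f\sharp^B_{\varepsilon,\lambda}g$ exists and is unique. 2. For all $\varepsilon\in(0,1]$ and $k\ge0$ the oscillatory integral $(f\sharp^Bg)_{(k)}=I_\varepsilon\bigl[\tfrac{(-i)^k}{k!}\gamma_\varepsilon^k\bigr]$ exists and belongs to $S^{m_1+m_2-2k\rho}_\rho$. 3. The zeroth-order term is the ordinary Weyl product, which exists and is unique: $(f\sharp^Bg)_{(0)}=f\sharp_\varepsilon g$. 4. For all $N\ge0$, $\varepsilon\in(0,1]$, $\lambda\in[0,1]$, $$f\sharp^B_{\varepsilon,\lambda}g-\sum_{k=0}^N\lambda^k(f\sharp^Bg)_{(k)}=I_\varepsilon\Bigl[\tfrac1{N!}(-i\lambda\gamma_\varepsilon)^{N+1}\int_0^1(1-\tau)^Ne^{-i\lambda\tau\gamma_\varepsilon}\,d\tau\Bigr]\in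 S^{m_1+m_2-2(N+1)\rho}_\rho ,$$ where the oscillatory integral exists, and each seminorm of $S^{m_1+m_2-2(N+1)\rho}_\rho$ of this remainder is at most $C\lambda^{N+1}$ with $C$ independent of $\lambda\in[0,1]$ and $\varepsilon\in(0,1]$. -/

import Mathlib

open MeasureTheory Filter Topology Set
open scoped ContDiff SchwartzMap

noncomputable section

namespace MagneticWeyl

/-- Configuration space `ℝᵈ` with its Euclidean structure. -/
abbrev Space (d : ℕ) : Type := EuclideanSpace ℝ (Fin d)

/-- Phase space `ℝᵈ × ℝᵈ`; a point is `X = (x, ξ)` (position, momentum). -/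
abbrev Phase (d : ℕ) : Type := Space d × Space d

/-- The `l`-th standard basis vector of `ℝᵈ`. -/
abbrev basisVec {d : ℕ} (l : Fin d) : Space d := EuclideanSpace.single l 1

/-- The Japanese bracket `⟨ξ⟩ = (1 + |ξ|²)^{1/2}`. -/
def bracket {d : ℕ} (ξ : Space d) : ℝ := Real.sqrt (1 + ‖ξ‖ ^ 2)

/-! ### Symbol classes -/

/-- The mixed partial derivative `∂_x^a ∂_ξ^α f`. A multi-index of order `j` is given by the list
`a : Fin j → Fin d` of the coordinates that are differentiated, so that `|a| = j`, `|α| = k`. -/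
def mixedDeriv {d j k : ℕ} (a : Fin j → Fin d) (α : Fin k → Fin d) (f : Phase d → ℂ)
    (X : Phase d) : ℂ :=
  iteratedFDeriv ℝ (j + k) f X
    (Fin.append (fun i => ((basisVec (a i), 0) : Phase d))
      (fun i => ((0, basisVec (α i)) : Phase d)))

/-- The Hörmander symbol class `S^m_ρ`: smooth functions with
`|∂_x^a ∂_ξ^α f(x, ξ)| ≤ C_{aα} ⟨ξ⟩^{m - |α| ρ}`. -/
structure IsHormanderSymbol {d : ℕ} (m ρ : ℝ) (f : Phase d → ℂ) : Prop where
  smooth : ContDiff ℝ ∞ f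
  bound : ∀ (j k : ℕ) (a : Fin j → Fin d) (α : Fin k → Fin d), ∃ C : ℝ, ∀ x ξ : Space d,
    ‖mixedDeriv a α f (x, ξ)‖ ≤ C * bracket ξ ^ (m - k * ρ)

/-! ### Magnetic fields, circulations and fluxes -/

/-- The class `BC^∞(ℝᵈ, ℝ)`: smooth functions that are bounded with all their derivatives. -/
structure IsBCInfty {d : ℕ} (b : Space d → ℝ) : Prop where
  smooth : ContDiff ℝ ∞ b
  bound : ∀ n : ℕ, ∃ C : ℝ, ∀ x, ‖iteratedFDeriv ℝ n b x‖ ≤ C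

/-- `A` is a vector potential of `B`: its components are smooth with polynomially bounded
derivatives (the class `C^∞_pol`), and `B = dA`, i.e. `B_{lj} = ∂_l A_j - ∂_j A_l`. -/
structure IsVectorPotential {d : ℕ} (B : Fin d → Fin d → Space d → ℝ)
    (A : Fin d → Space d → ℝ) : Prop where
  growth : ∀ l, (A l).HasTemperateGrowth
  represents : ∀ l j x,
    B l j x = fderiv ℝ (A j) x (basisVec l) - fderiv ℝ (A l) x (basisVec j)

/-- A magnetic field: a two-form `B = dA` on `ℝᵈ` with components of class `BC^∞` and with a
vector potential of class `C^∞_pol`. -/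
structure IsMagneticField {d : ℕ} (B : Fin d → Fin d → Space d → ℝ) : Prop where
  bounded : ∀ l j, IsBCInfty (B l j)
  exact : ∃ A, IsVectorPotential B A

/-- The circulation `Γ^A([x, y])`, the integral of `A` along the segment from `x` to `y`. -/
def circulation {d : ℕ} (A : Fin d → Space d → ℝ) (x y : Space d) : ℝ :=
  ∑ l, (y l - x l) * ∫ s in (0 : ℝ)..1, A l (x + s • (y - x))

/-- The scaled circulation `Γ^A_ε([x, y]) = ε⁻¹ Γ^A([εx, εy])`. -/
def scaledCirculation {d : ℕ} (A : Fin d → Space d → ℝ) (ε : ℝ) (x y : Space d) : ℝ :=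
  ε⁻¹ * circulation A (ε • x) (ε • y)

/-- The flux `Γ^B(⟨p, q, r⟩)`: the integral of the two-form `B = ½ ∑ B_{lj} dx_l ∧ dx_j` over the
triangle with corners `p, q, r`, parametrized by `(s, t) ↦ p + s (q - p) + t (r - p)`. -/
def flux {d : ℕ} (B : Fin d → Fin d → Space d → ℝ) (p q r : Space d) : ℝ :=
  ∑ l, ∑ j, (∫ s in (0 : ℝ)..1, ∫ t in (0 : ℝ)..(1 - s),
    B l j (p + s • (q - p) + t • (r - p))) * (q l - p l) * (r j - p j)

/-- The scaled flux `γ^B_ε(x, y, z)`, which is `ε⁻¹` times the flux through the triangle with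
corners `x - (ε/2)(y + z)`, `x + (ε/2)(y - z)`, `x + (ε/2)(y + z)`. -/
def scaledFlux {d : ℕ} (B : Fin d → Fin d → Space d → ℝ) (ε : ℝ) (x y z : Space d) : ℝ :=
  ε⁻¹ * flux B (x - (ε / 2) • (y + z)) (x + (ε / 2) • (y - z)) (x + (ε / 2) • (y + z))

/-! ### Quantization and Weyl products -/

/-- Magnetic Weyl quantization `Op^A_{ε,λ}(f)`, acting on functions on `ℝᵈ`:
`(2π)^{-d} ∫ dη ∫ dy e^{-i(y-x)·η} e^{-iλ Γ^A_ε([x,y])} f((ε/2)(x+y), η) φ(y)`.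
For symbols `f` and Schwartz functions `φ`, integrating over `y` first makes this oscillatory
integral an absolutely convergent iterated integral. -/
def magneticQuantization {d : ℕ} (A : Fin d → Space d → ℝ) (ε lam : ℝ) (f : Phase d → ℂ)
    (φ : Space d → ℂ) (x : Space d) : ℂ :=
  (((2 * Real.pi) ^ d : ℝ) : ℂ)⁻¹ * ∫ η : Space d, ∫ y : Space d,
    Complex.exp (-Complex.I * ((inner ℝ (y - x) η : ℝ) : ℂ)) *
    Complex.exp (-Complex.I * lam * (scaledCirculation A ε x y : ℂ)) *
    f ((ε / 2) • (x + y), η) * φ y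

/-- Ordinary (non-magnetic) Weyl quantization `Op_ε(f)`. -/
def weylQuantization {d : ℕ} (ε : ℝ) (f : Phase d → ℂ) (φ : Space d → ℂ) (x : Space d) : ℂ :=
  (((2 * Real.pi) ^ d : ℝ) : ℂ)⁻¹ * ∫ η : Space d, ∫ y : Space d,
    Complex.exp (-Complex.I * ((inner ℝ (y - x) η : ℝ) : ℂ)) *
    f ((ε / 2) • (x + y), η) * φ y

/-- `h` is the magnetic Weyl product of `f` and `g`: a symbol (of some order) such that
`Op^A_{ε,λ}(f) Op^A_{ε,λ}(g) = Op^A_{ε,λ}(h)` on Schwartz functions, for every vector potential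
`A` of `B`. -/
def IsMagneticWeylProduct {d : ℕ} (ρ : ℝ) (B : Fin d → Fin d → Space d → ℝ) (ε lam : ℝ)
    (f g h : Phase d → ℂ) : Prop :=
  (∃ m : ℝ, IsHormanderSymbol m ρ h) ∧
  ∀ A, IsVectorPotential B A → ∀ φ : 𝓢(Space d, ℂ),
    magneticQuantization A ε lam f (magneticQuantization A ε lam g φ) =
      magneticQuantization A ε lam h φ

/-- `h` is the ordinary Weyl product of `f` and `g`: a symbol (of some order) such that
`Op_ε(f) Op_ε(g) = Op_ε(h)` on Schwartz functions. -/
def IsWeylProduct {d : ℕ} (ρ ε : ℝ) (f g h : Phase d → ℂ) : Prop :=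
  (∃ m : ℝ, IsHormanderSymbol m ρ h) ∧
  ∀ φ : 𝓢(Space d, ℂ),
    weylQuantization ε f (weylQuantization ε g φ) = weylQuantization ε h φ

/-! ### Oscillatory integrals -/

/-- The symplectic form `σ(X, Y) = ξ · y - x · η`. -/
def symplectic {d : ℕ} (X Y : Phase d) : ℝ := inner ℝ X.2 Y.1 - inner ℝ X.1 Y.2

/-- The symplectic Fourier transform `(2π)^{-d} ∫ e^{iσ(X,Y)} f(Y) dY`, which is its own
inverse. -/
def symplecticFourier {d : ℕ} (f : Phase d → ℂ) (X : Phase d) : ℂ :=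
  (((2 * Real.pi) ^ d : ℝ) : ℂ)⁻¹ *
    ∫ Y : Phase d, Complex.exp (Complex.I * (symplectic X Y : ℂ)) * f Y

/-- `(2π)^{-2d} ∫ dY ∫ dZ e^{iσ(X,Y+Z)} e^{i(ε/2)σ(Y,Z)} G(x,y,z) (𝓕⁻¹f)(Y) (𝓕⁻¹g)(Z)` with the
symplectic Fourier transform `𝓕 = 𝓕⁻¹`; absolutely convergent for rapidly decreasing `f`, `g` and
weights `G` of polynomial growth. -/
def twistedIntegral {d : ℕ} (ε : ℝ) (G : Space d → Space d → Space d → ℂ) (f g : Phase d → ℂ)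
    (X : Phase d) : ℂ :=
  (((2 * Real.pi) ^ (2 * d) : ℝ) : ℂ)⁻¹ * ∫ Y : Phase d, ∫ Z : Phase d,
    Complex.exp (Complex.I * (symplectic X (Y + Z) : ℂ)) *
    Complex.exp (Complex.I * (ε / 2) * (symplectic Y Z : ℂ)) *
    G X.1 Y.1 Z.1 * symplecticFourier f Y * symplecticFourier g Z

/-- The integral of `twistedIntegral` exists as an oscillatory integral for every `X` and has the
value `I X`: for each Schwartz cut-off `χ` with `χ(0) = 1`, the integrals for the regularized
symbols `χ(δ ·) f` and `χ(δ ·) g` converge to `I X` as `δ ↓ 0`. -/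
def HasOscillatoryIntegral {d : ℕ} (ε : ℝ) (G : Space d → Space d → Space d → ℂ)
    (f g I : Phase d → ℂ) : Prop :=
  ∀ χ : 𝓢(Phase d, ℂ), χ 0 = 1 → ∀ X : Phase d,
    Tendsto (fun δ : ℝ =>
      twistedIntegral ε G (fun W => χ (δ • W) * f W) (fun W => χ (δ • W) * g W) X)
      (𝓝[>] 0) (𝓝 (I X))

/-- The weight `((-i)^k / k!) γ^B_ε(x,y,z)^k` of the `k`-th order term. -/
def termWeight {d : ℕ} (B : Fin d → Fin d → Space d → ℝ) (ε : ℝ) (k : ℕ) (x y z : Space d) : ℂ :=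
  (-Complex.I) ^ k / (k.factorial : ℂ) * (scaledFlux B ε x y z : ℂ) ^ k

/-- The weight
`(1/N!) (-iλγ^B_ε(x,y,z))^{N+1} ∫₀¹ (1-τ)^N e^{-iλτγ^B_ε(x,y,z)} dτ` of the `N`-th remainder. -/
def remainderWeight {d : ℕ} (B : Fin d → Fin d → Space d → ℝ) (ε lam : ℝ) (N : ℕ)
    (x y z : Space d) : ℂ :=
  (N.factorial : ℂ)⁻¹ * (-Complex.I * lam * (scaledFlux B ε x y z : ℂ)) ^ (N + 1) *
    ∫ τ in (0 : ℝ)..1, ((1 - τ : ℝ) : ℂ) ^ N *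
      Complex.exp (-Complex.I * lam * τ * (scaledFlux B ε x y z : ℂ))

end MagneticWeyl

end

/-! All the products and expansion terms are instances of one object. Fourier inversion turns
`I_ε[G]` formally into `(2π)^{-2d} ∫ e^{-i(y·η + z·ζ)} G(x,y,z) f(x - εz/2, ξ + η) g(x + εy/2, ξ +
ζ)`, which contains the symbols themselves instead of their Fourier transforms. This is `sharp ε G f
g`. It makes sense as an oscillatory integral for all symbols and all weights `G` whose derivatives
grow polynomially in `(y, z)`. Differentiating it obeys the Leibniz rule, so it belongs to
`S^{m₁+m₂}_ρ` (`symFamily_sharp`).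

The gain of order comes from integration by parts: a factor `y_l` becomes `-i∂_{ξ_l}` acting on `f`,
and a factor `z_j` becomes `-i∂_{ξ_j}` acting on `g` (`sharp_coord_mul`). Antisymmetry of `B` makes
the scaled flux a sum of terms `ε y_l z_j` times averages of `B_{lj}` over the triangle
(`scaledFlux_eq`), so every factor `γ_ε` lowers the order by `2ρ` (`symFamily_sharp_flux_pow`).
Taylor's formula for `e^{-iλγ_ε}` with integral remainder then produces the terms and the remainder.
The latter has weight `λ^{N+1} γ_ε^{N+1}` times a function of `γ_ε` with bounded derivatives,
uniformly in `λ` and `ε`.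

For operators, Stokes' theorem (`flux_eq_circulation`) says that the gauge factors satisfy a cocycle
identity with defect `e^{-iλγ_ε}`. For rapidly decreasing symbols the composition is computed with
integral kernels (`op_comp_of_rapid`); cutting off the symbols and passing to the limit gives the
general case (`op_comp`). Uniqueness (`eq_of_op_eq`) is clear from the kernel for symbols of very
negative order. A general `f` with vanishing quantization is reduced to that case through the
products of `f` with rapidly decreasing symbols, which tend to `f` as those symbols tend to `1`.

The analysis is done for families: functions depending continuously on an index, with bounds uniform
in it (`BddFamily`). The cut-off parameter `δ` is an index in `[0, 1]` like any other, so that every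
limit `δ ↓ 0` is just continuity at `δ = 0`. Convergence comes from first-order integrations by
parts with the multipliers `(1 + i⟨v, Θ⟩)⁻¹`, applied along a finite frame. -/

noncomputable section

set_option linter.unusedSectionVars false

namespace MagneticWeyl

/-! ### Uniformly bounded families of functions -/

section Families

variable {ι κ : Type*} [TopologicalSpace ι] [TopologicalSpace κ]
variable {H : Type*} [NormedAddCommGroup H] [NormedSpace ℝ H]
variable {K : Type*} [NormedAddCommGroup K] [NormedSpace ℝ K]

/-- The derivative of `a` in the direction `v`. -/
def dirDeriv (v : H) (a : H → ℂ) (x : H) : ℂ := fderiv ℝ a x v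

/-- The family `a` depends continuously on its index and its derivatives of order at most `N` are
bounded by multiples of the weight `w`, uniformly in the index. -/
def BddFamily : ℕ → (H → ℝ) → (ι → H → ℂ) → Prop
  | 0, w, a => (∃ C, ∀ t x, ‖a t x‖ ≤ C * w x) ∧ Continuous fun p : ι × H => a p.1 p.2
  | N + 1, w, a => ((∃ C, ∀ t x, ‖a t x‖ ≤ C * w x) ∧ Continuous fun p : ι × H => a p.1 p.2) ∧
      (∀ t, Differentiable ℝ (a t)) ∧ ∀ v, BddFamily N w fun t => dirDeriv v (a t)

namespace BddFamily

variable {N : ℕ} {w w' : H → ℝ} {a b : ι → H → ℂ}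

theorem bound (h : BddFamily N w a) : ∃ C, ∀ t x, ‖a t x‖ ≤ C * w x := by
  cases N with
  | zero => exact h.1
  | succ N => exact h.1.1

theorem exists_bound_pos (h : BddFamily N w a) (hw : ∀ x, 0 ≤ w x) :
    ∃ C, 0 ≤ C ∧ ∀ t x, ‖a t x‖ ≤ C * w x := by
  obtain ⟨C, hC⟩ := h.bound
  refine ⟨|C|, abs_nonneg C, fun t x => (hC t x).trans ?_⟩
  exact mul_le_mul_of_nonneg_right (le_abs_self C) (hw x)

theorem continuous (h : BddFamily N w a) : Continuous fun p : ι × H => a p.1 p.2 := by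
  cases N with
  | zero => exact h.2
  | succ N => exact h.1.2

theorem continuous_apply (h : BddFamily N w a) (t : ι) : Continuous (a t) :=
  h.continuous.comp (continuous_const.prodMk continuous_id)

theorem differentiable (h : BddFamily (N + 1) w a) (t : ι) : Differentiable ℝ (a t) := h.2.1 t

theorem zero_order (h : BddFamily N w a) : BddFamily 0 w a := ⟨h.bound, h.continuous⟩

theorem of_succ (h : BddFamily (N + 1) w a) : BddFamily N w a := by
  induction N generalizing a with
  | zero => exact h.1
  | succ N ih => exact ⟨h.1, h.2.1, fun v => ih (h.2.2 v)⟩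

theorem of_le {N' : ℕ} (hN : N' ≤ N) (h : BddFamily N w a) : BddFamily N' w a := by
  induction hN with
  | refl => exact h
  | step _ ih => exact ih h.of_succ

theorem mono (hw : ∃ C, 0 ≤ C ∧ ∀ x, w x ≤ C * w' x) (hw0 : ∀ x, 0 ≤ w x)
    (h : BddFamily N w a) : BddFamily N w' a := by
  have key : ∀ b : ι → H → ℂ, (∃ C, ∀ t x, ‖b t x‖ ≤ C * w x) →
      ∃ C, ∀ t x, ‖b t x‖ ≤ C * w' x := by
    rintro b ⟨C, hC⟩
    obtain ⟨D, -, hDw⟩ := hw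
    refine ⟨|C| * D, fun t x => (hC t x).trans ?_⟩
    calc C * w x ≤ |C| * w x := mul_le_mul_of_nonneg_right (le_abs_self C) (hw0 x)
      _ ≤ |C| * (D * w' x) := mul_le_mul_of_nonneg_left (hDw x) (abs_nonneg C)
      _ = |C| * D * w' x := by ring
  induction N generalizing a with
  | zero => exact ⟨key a h.1, h.2⟩
  | succ N ih => exact ⟨⟨key a h.1.1, h.1.2⟩, h.2.1, fun v => ih (h.2.2 v)⟩

theorem mono' (hw : ∀ x, w x ≤ w' x) (hw0 : ∀ x, 0 ≤ w x)
    (h : BddFamily N w a) : BddFamily N w' a :=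
  h.mono ⟨1, zero_le_one, fun x => by simpa using hw x⟩ hw0

theorem congr (h : BddFamily N w a) (hab : ∀ t x, a t x = b t x) : BddFamily N w b := by
  have : a = b := by ext t x; exact hab t x
  exact this ▸ h

end BddFamily

theorem dirDeriv_zero (v : H) : dirDeriv v (fun _ => 0) = fun _ => 0 := by
  ext x; simp [dirDeriv]

theorem dirDeriv_add {a b : H → ℂ} (ha : Differentiable ℝ a) (hb : Differentiable ℝ b) (v : H) :
    dirDeriv v (fun x => a x + b x) = fun x => dirDeriv v a x + dirDeriv v b x := by
  ext x; simp [dirDeriv, fderiv_fun_add (ha x) (hb x)]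

theorem dirDeriv_mul {a b : H → ℂ} (ha : Differentiable ℝ a) (hb : Differentiable ℝ b) (v : H) :
    dirDeriv v (fun x => a x * b x) = fun x => dirDeriv v a x * b x + a x * dirDeriv v b x := by
  ext x; simp [dirDeriv, fderiv_fun_mul (ha x) (hb x)]; ring

theorem dirDeriv_const_mul {a : H → ℂ} (ha : Differentiable ℝ a) (c : ℂ) (v : H) :
    dirDeriv v (fun x => c * a x) = fun x => c * dirDeriv v a x := by
  ext x; simp [dirDeriv, fderiv_const_mul (ha x)]

theorem dirDeriv_comp {a : K → ℂ} (ha : Differentiable ℝ a) (A : H →L[ℝ] K) (v : H) :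
    dirDeriv v (fun x => a (A x)) = fun x => dirDeriv (A v) a (A x) := by
  ext x
  have := (ha (A x)).hasFDerivAt.comp x A.hasFDerivAt
  simp only [dirDeriv]
  rw [show (fun x => a (A x)) = a ∘ A from rfl, this.fderiv]; rfl

theorem dirDeriv_sum_direction {σ : Type*} (s : Finset σ) (c : σ → ℝ) (v : σ → H) (a : H → ℂ)
    (x : H) : dirDeriv (∑ i ∈ s, c i • v i) a x = ∑ i ∈ s, (c i : ℂ) * dirDeriv (v i) a x := by
  simp [dirDeriv, map_sum]

namespace BddFamily

variable {N : ℕ} {w w' : H → ℝ} {a b : ι → H → ℂ}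

theorem zero : BddFamily N w (fun (_ : ι) (_ : H) => (0 : ℂ)) := by
  induction N with
  | zero => exact ⟨⟨0, by simp⟩, continuous_const⟩
  | succ N ih =>
    refine ⟨⟨⟨0, by simp⟩, continuous_const⟩, fun t => differentiable_const _, fun v => ?_⟩
    simpa only [dirDeriv_zero] using ih

theorem add (ha : BddFamily N w a) (hb : BddFamily N w b) :
    BddFamily N w fun t x => a t x + b t x := by
  have key : ∀ a b : ι → H → ℂ, BddFamily 0 w a → BddFamily 0 w b →
      BddFamily 0 w fun t x => a t x + b t x := by
    rintro a b ⟨⟨C, hC⟩, ha⟩ ⟨⟨D, hD⟩, hb⟩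
    refine ⟨⟨C + D, fun t x => ?_⟩, ha.add hb⟩
    rw [add_mul]; exact (norm_add_le _ _).trans (add_le_add (hC t x) (hD t x))
  induction N generalizing a b with
  | zero => exact key a b ha hb
  | succ N ih =>
    refine ⟨key a b ha.zero_order hb.zero_order, fun t => (ha.2.1 t).add (hb.2.1 t), fun v => ?_⟩
    simp only [dirDeriv_add (ha.2.1 _) (hb.2.1 _)]
    exact ih (ha.2.2 v) (hb.2.2 v)

theorem sum {σ : Type*} (s : Finset σ) {a : σ → ι → H → ℂ}
    (h : ∀ i ∈ s, BddFamily N w (a i)) : BddFamily N w fun t x => ∑ i ∈ s, a i t x := by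
  classical
  induction s using Finset.induction_on with
  | empty => simpa using zero
  | insert i s hi ih =>
    simp only [Finset.sum_insert hi]
    exact (h i (by simp)).add (ih fun j hj => h j (by simp [hj]))

theorem mul (ha : BddFamily N w a) (hb : BddFamily N w' b) :
    BddFamily N (fun x => w x * w' x) fun t x => a t x * b t x := by
  have key : ∀ a b : ι → H → ℂ, BddFamily 0 w a → BddFamily 0 w' b →
      BddFamily 0 (fun x => w x * w' x) fun t x => a t x * b t x := by
    rintro a b ⟨⟨C, hC⟩, ha⟩ ⟨⟨D, hD⟩, hb⟩
    refine ⟨⟨C * D, fun t x => ?_⟩, ha.mul hb⟩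
    rw [norm_mul, mul_mul_mul_comm]
    exact mul_le_mul (hC t x) (hD t x) (norm_nonneg _) ((norm_nonneg _).trans (hC t x))
  induction N generalizing a b with
  | zero => exact key a b ha hb
  | succ N ih =>
    refine ⟨key a b ha.zero_order hb.zero_order, fun t => (ha.2.1 t).mul (hb.2.1 t), fun v => ?_⟩
    simp only [dirDeriv_mul (ha.2.1 _) (hb.2.1 _)]
    exact (ih (ha.2.2 v) hb.of_succ).add (ih ha.of_succ (hb.2.2 v))

theorem const_mul {c : ι → ℂ} (hc : Continuous c) (hb : ∃ C, ∀ t, ‖c t‖ ≤ C)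
    (ha : BddFamily N w a) : BddFamily N w fun t x => c t * a t x := by
  have key : ∀ a : ι → H → ℂ, BddFamily 0 w a → BddFamily 0 w fun t x => c t * a t x := by
    rintro a ⟨⟨C, hC⟩, ha⟩
    obtain ⟨D, hD⟩ := hb
    refine ⟨⟨D * C, fun t x => ?_⟩, (hc.comp continuous_fst).mul ha⟩
    rw [norm_mul, mul_assoc]
    exact mul_le_mul (hD t) (hC t x) (norm_nonneg _) ((norm_nonneg _).trans (hD t))
  induction N generalizing a with
  | zero => exact key a ha
  | succ N ih =>
    refine ⟨key a ha.zero_order, fun t => (ha.2.1 t).const_mul _, fun v => ?_⟩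
    simp only [dirDeriv_const_mul (ha.2.1 _)]
    exact ih (ha.2.2 v)

theorem smul_const (c : ℂ) (ha : BddFamily N w a) : BddFamily N w fun t x => c * a t x :=
  ha.const_mul continuous_const ⟨‖c‖, fun _ => le_rfl⟩

theorem neg (ha : BddFamily N w a) : BddFamily N w fun t x => -a t x :=
  (ha.smul_const (-1)).congr fun t x => by ring

theorem reindex {f : κ → ι} (hf : Continuous f) (ha : BddFamily N w a) :
    BddFamily N w fun t => a (f t) := by
  induction N generalizing a with
  | zero =>
    exact ⟨let ⟨C, hC⟩ := ha.bound; ⟨C, fun t => hC (f t)⟩,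
      ha.continuous.comp ((hf.comp continuous_fst).prodMk continuous_snd)⟩
  | succ N ih =>
    exact ⟨⟨let ⟨C, hC⟩ := ha.bound; ⟨C, fun t => hC (f t)⟩,
      ha.continuous.comp ((hf.comp continuous_fst).prodMk continuous_snd)⟩,
      fun t => ha.2.1 _, fun v => ih (ha.2.2 v)⟩

theorem const {c : ι → ℂ} (hc : Continuous c) (hb : ∃ C, ∀ t, ‖c t‖ ≤ C) :
    BddFamily N (fun _ : H => 1) fun t _ => c t := by
  have key : BddFamily 0 (fun _ : H => 1) fun t _ => c t :=
    ⟨let ⟨C, hC⟩ := hb; ⟨C, fun t x => by simpa using hC t⟩, hc.comp continuous_fst⟩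
  induction N with
  | zero => exact key
  | succ N ih =>
    refine ⟨key, fun t => differentiable_const _, fun v => ?_⟩
    have : ∀ t, MagneticWeyl.dirDeriv v (fun _ : H => c t) = fun _ => 0 := fun t => by
      ext x; simp [MagneticWeyl.dirDeriv]
    simpa only [this] using zero

/-- Expansion in a fixed basis reduces a direction that varies with the index to finitely many fixed
directions with bounded continuous coefficients. The chain rule in `comp` produces such directions.
-/
theorem dirDeriv_moving [FiniteDimensional ℝ H] {v : ι → H} (hv : Continuous v)
    (hb : ∃ C, ∀ t, ‖v t‖ ≤ C) (ha : BddFamily (N + 1) w a) :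
    BddFamily N w fun t => MagneticWeyl.dirDeriv (v t) (a t) := by
  obtain ⟨C, hC⟩ := hb
  let e := Module.finBasis ℝ H
  have he : ∀ i, Continuous fun x : H => e.repr x i := fun i =>
    (LinearMap.continuous_of_finiteDimensional (e.coord i))
  refine (sum Finset.univ fun i _ => (ha.2.2 (e i)).const_mul
    (c := fun t => ((e.repr (v t) i : ℝ) : ℂ)) ?_ ?_).congr fun t x => ?_
  · exact Complex.continuous_ofReal.comp ((he i).comp hv)
  · refine ⟨‖LinearMap.toContinuousLinearMap (e.coord i)‖ * C, fun t => ?_⟩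
    have := (LinearMap.toContinuousLinearMap (e.coord i)).le_opNorm (v t)
    have h2 : ‖((e.repr (v t) i : ℝ) : ℂ)‖ = ‖LinearMap.toContinuousLinearMap (e.coord i) (v t)‖ := by
      simp
    rw [h2]
    exact this.trans (mul_le_mul_of_nonneg_left (hC t) (norm_nonneg _))
  · rw [← dirDeriv_sum_direction, e.sum_repr]

/-- Along `v` the chain rule gives the derivative of `a t` in the direction `A t v`. Since `A t` is
linear nothing else appears, so a bound on `‖A t‖` suffices for uniformity at every order. -/
theorem comp [FiniteDimensional ℝ K] {wK : K → ℝ} {a : ι → K → ℂ} {A : ι → H →L[ℝ] K}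
    (hA : Continuous fun p : ι × H => A p.1 p.2) (hb : ∃ C, ∀ t, ‖A t‖ ≤ C)
    (hw : ∃ C, 0 ≤ C ∧ ∀ t x, wK (A t x) ≤ C * w x) (hw0 : ∀ x, 0 ≤ wK x) (ha : BddFamily N wK a) :
    BddFamily N w fun t x => a t (A t x) := by
  have key : ∀ a : ι → K → ℂ, BddFamily 0 wK a → BddFamily 0 w fun t x => a t (A t x) := by
    intro a ha
    refine ⟨?_, ha.continuous.comp (continuous_fst.prodMk hA)⟩
    obtain ⟨C, hC0, hC⟩ := ha.exists_bound_pos hw0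
    obtain ⟨D, hD0, hD⟩ := hw
    exact ⟨C * D, fun t x => (hC t _).trans
      ((mul_le_mul_of_nonneg_left (hD t x) hC0).trans_eq (by ring))⟩
  induction N generalizing a with
  | zero => exact key a ha
  | succ N ih =>
    refine ⟨key a ha.zero_order, fun t => (ha.2.1 t).comp (A t).differentiable, fun v => ?_⟩
    simp only [dirDeriv_comp (ha.2.1 _)]
    refine ih (ha.dirDeriv_moving (hA.comp (continuous_id.prodMk continuous_const)) ?_)
    obtain ⟨C, hC⟩ := hb
    exact ⟨C * ‖v‖, fun t => ((A t).le_opNorm v).trans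
      (mul_le_mul_of_nonneg_right (hC t) (norm_nonneg v))⟩

theorem comp_const [FiniteDimensional ℝ K] {wK : K → ℝ} {a : ι → K → ℂ} (A : H →L[ℝ] K)
    (hw : ∃ C, 0 ≤ C ∧ ∀ x, wK (A x) ≤ C * w x) (hw0 : ∀ x, 0 ≤ wK x) (ha : BddFamily N wK a) :
    BddFamily N w fun t x => a t (A x) :=
  ha.comp (A := fun _ => A) (A.continuous.comp continuous_snd) ⟨‖A‖, fun _ => le_rfl⟩
    (let ⟨C, h0, hC⟩ := hw; ⟨C, h0, fun _ => hC⟩) hw0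

theorem contDiff [FiniteDimensional ℝ H] (ha : BddFamily N w a) (t : ι) :
    ContDiff ℝ N (a t) := by
  induction N generalizing a with
  | zero => exact contDiff_zero.2 (ha.continuous_apply t)
  | succ N ih =>
    push_cast
    exact contDiff_succ_iff_fderiv_apply.2 ⟨ha.2.1 t, fun h => by simp at h, fun v => ih (ha.2.2 v)⟩

theorem contDiff_infty [FiniteDimensional ℝ H] {W : ℕ → H → ℝ} (ha : ∀ N, BddFamily N (W N) a)
    (t : ι) : ContDiff ℝ ∞ (a t) := _root_.contDiff_infty.2 fun N => (ha N).contDiff t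

end BddFamily

theorem dirDeriv_comm {a : H → ℂ} (ha : ContDiff ℝ 2 a) (u v : H) :
    dirDeriv u (dirDeriv v a) = dirDeriv v (dirDeriv u a) := by
  ext x
  have h1 : Differentiable ℝ (fderiv ℝ a) :=
    (ha.fderiv_right (m := 1) (by norm_num)).differentiable (by norm_num)
  have h2 : ∀ u v : H, dirDeriv u (dirDeriv v a) x = fderiv ℝ (fderiv ℝ a) x u v := by
    intro u v
    have := ((h1 x).hasFDerivAt.clm_apply (hasFDerivAt_const v x)).fderiv
    simp only [dirDeriv]
    rw [show (dirDeriv v a) = fun x => fderiv ℝ a x v from rfl, this]; simp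
  rw [h2, h2]
  exact (ha.contDiffAt.isSymmSndFDerivAt (by simp)) u v

end Families

/-! ### Families whose derivatives grow polynomially. -/

section PolyFamilies

variable {ι : Type*} [TopologicalSpace ι]
variable {H : Type*} [NormedAddCommGroup H] [NormedSpace ℝ H]

/-- Families all of whose derivatives are bounded by powers of a fixed weight. -/
def PolyFamily (W : H → ℝ) (a : ι → H → ℂ) : Prop :=
  ∀ N, ∃ k : ℕ, BddFamily N (fun x => W x ^ k) a

namespace PolyFamily

variable {W : H → ℝ} {a b : ι → H → ℂ}

theorem pow_mono (hW : ∀ x, 1 ≤ W x) {N k l : ℕ} (hkl : k ≤ l)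
    (h : BddFamily N (fun x => W x ^ k) a) : BddFamily N (fun x => W x ^ l) a :=
  h.mono' (fun x => pow_le_pow_right₀ (hW x) hkl) fun x => pow_nonneg (by linarith [hW x]) _

theorem of_bdd (h : ∀ N, BddFamily N (fun _ => 1) a) : PolyFamily W a :=
  fun N => ⟨0, by simpa using h N⟩

theorem add (hW : ∀ x, 1 ≤ W x) (ha : PolyFamily W a) (hb : PolyFamily W b) :
    PolyFamily W fun t x => a t x + b t x := by
  intro N
  obtain ⟨k, hk⟩ := ha N
  obtain ⟨l, hl⟩ := hb N
  exact ⟨k + l, (pow_mono hW (by omega) hk).add (pow_mono hW (by omega) hl)⟩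

theorem mul (ha : PolyFamily W a) (hb : PolyFamily W b) :
    PolyFamily W fun t x => a t x * b t x := by
  intro N
  obtain ⟨k, hk⟩ := ha N
  obtain ⟨l, hl⟩ := hb N
  exact ⟨k + l, by simpa only [pow_add] using hk.mul hl⟩

theorem zero : PolyFamily W (fun (_ : ι) (_ : H) => (0 : ℂ)) := fun _ => ⟨0, BddFamily.zero⟩

theorem sum (hW : ∀ x, 1 ≤ W x) {σ : Type*} (s : Finset σ) {a : σ → ι → H → ℂ}
    (h : ∀ i ∈ s, PolyFamily W (a i)) : PolyFamily W fun t x => ∑ i ∈ s, a i t x := by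
  classical
  induction s using Finset.induction_on with
  | empty => simpa using zero
  | insert i s hi ih =>
    simp only [Finset.sum_insert hi]
    exact (h i (by simp)).add hW (ih fun j hj => h j (by simp [hj]))

theorem const_mul {c : ι → ℂ} (hc : Continuous c) (hb : ∃ C, ∀ t, ‖c t‖ ≤ C)
    (ha : PolyFamily W a) : PolyFamily W fun t x => c t * a t x :=
  fun N => let ⟨k, hk⟩ := ha N; ⟨k, hk.const_mul hc hb⟩

theorem dirDeriv (ha : PolyFamily W a) (v : H) :
    PolyFamily W fun t => dirDeriv v (a t) :=
  fun N => let ⟨k, hk⟩ := ha (N + 1); ⟨k, hk.2.2 v⟩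

theorem congr (h : PolyFamily W a) (hab : ∀ t x, a t x = b t x) : PolyFamily W b :=
  fun N => let ⟨k, hk⟩ := h N; ⟨k, hk.congr hab⟩

theorem one : PolyFamily W (fun (_ : ι) (_ : H) => (1 : ℂ)) :=
  of_bdd fun _ => BddFamily.const continuous_const ⟨1, by simp⟩

theorem pow (ha : PolyFamily W a) (n : ℕ) :
    PolyFamily W fun t x => a t x ^ n := by
  induction n with
  | zero => simpa using one
  | succ n ih => simpa only [pow_succ] using ih.mul ha

theorem differentiable (ha : PolyFamily W a) (t : ι) : Differentiable ℝ (a t) :=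
  let ⟨_, hk⟩ := ha 1; hk.differentiable t

theorem contDiff [FiniteDimensional ℝ H] (ha : PolyFamily W a) (t : ι) : ContDiff ℝ ∞ (a t) := by
  choose k hk using ha
  exact BddFamily.contDiff_infty hk t

/-- Composition of a family of functions of one real variable that have bounded derivatives with
a real family. -/
theorem comp_real (hW : ∀ x, 1 ≤ W x) {E : ι → ℝ → ℂ} {γ : ι → H → ℝ}
    (hE : ∀ n, BddFamily n (fun _ => 1) E) (hγ : PolyFamily W fun t x => (γ t x : ℂ)) :
    PolyFamily W fun t x => E t (γ t x) := by
  have hγd : ∀ t, Differentiable ℝ (γ t) := fun t x => by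
    have := Complex.reCLM.differentiableAt.comp x (hγ.differentiable t x)
    exact this.congr_of_eventuallyEq (Eventually.of_forall fun y => by simp)
  have hγc : Continuous fun p : ι × H => γ p.1 p.2 := by
    obtain ⟨k, hk⟩ := hγ 0
    exact (Complex.continuous_re.comp hk.continuous).congr fun p => by simp
  have key : ∀ (E : ι → ℝ → ℂ), (∀ n, BddFamily n (fun _ => 1) E) → ∀ k,
      BddFamily 0 (fun x => W x ^ k) fun t x => E t (γ t x) := by
    intro E hE k
    refine ⟨?_, (hE 0).continuous.comp (continuous_fst.prodMk hγc)⟩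
    obtain ⟨C, hC0, hC⟩ := (hE 0).exists_bound_pos (fun _ => zero_le_one)
    refine ⟨C, fun t x => (hC t _).trans ?_⟩
    exact mul_le_mul_of_nonneg_left (one_le_pow₀ (hW x)) hC0
  intro N
  induction N generalizing E with
  | zero => exact ⟨0, key E hE 0⟩
  | succ N ih =>
    -- By the chain rule the derivative is `∂_vγ` times `E' ∘ γ`, and `E'` satisfies the same
    -- hypotheses as `E`. Each order of differentiation may raise the power of `W`, which is why
    -- that power depends on `N`.
    obtain ⟨k, hk⟩ := ih (E := fun t => MagneticWeyl.dirDeriv 1 (E t)) fun n => (hE (n + 1)).2.2 1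
    obtain ⟨l, hl⟩ := hγ (N + 1)
    refine ⟨l + k, key E hE _, fun t => ((hE 1).differentiable t).comp (hγd t), fun v => ?_⟩
    have := (hl.2.2 v).mul hk
    simp only [← pow_add] at this
    refine this.congr fun t x => ?_
    have h1 := ((hE 1).differentiable t (γ t x)).hasFDerivAt.comp x (hγd t x).hasFDerivAt
    have h2 := Complex.ofRealCLM.hasFDerivAt.comp x (hγd t x).hasFDerivAt
    have e1 : MagneticWeyl.dirDeriv v (fun x => E t (γ t x)) x = _ :=
      congrArg (fun L : H →L[ℝ] ℂ => L v) h1.fderiv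
    have e2 : MagneticWeyl.dirDeriv v (fun x => (γ t x : ℂ)) x = _ :=
      congrArg (fun L : H →L[ℝ] ℂ => L v) h2.fderiv
    rw [e1, e2]
    simp only [MagneticWeyl.dirDeriv, ContinuousLinearMap.comp_apply, Complex.ofRealCLM_apply]
    rw [← Complex.real_smul, ← ContinuousLinearMap.map_smul]; simp

end PolyFamily

end PolyFamilies

/-! ### Differentiation and bounds under the integral sign. -/

section Integrals

theorem BddFamily.norm_fderiv_le {ι : Type*} [TopologicalSpace ι] {H : Type*}
    [NormedAddCommGroup H] [NormedSpace ℝ H] [FiniteDimensional ℝ H] {N : ℕ} {w : H → ℝ} (hw : ∀ x, 0 ≤ w x) {a : ι → H → ℂ}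
    (ha : BddFamily (N + 1) w a) : ∃ C, 0 ≤ C ∧ ∀ t x, ‖fderiv ℝ (a t) x‖ ≤ C * w x := by
  let e := Module.finBasis ℝ H
  choose C hC0 hC using fun i => (ha.2.2 (e i)).exists_bound_pos hw
  have hS : 0 ≤ ∑ i, C i := Finset.sum_nonneg fun i _ => hC0 i
  refine ⟨Fintype.card (Fin (Module.finrank ℝ H)) * ‖(e.equivFunL : H →L[ℝ] Fin (Module.finrank ℝ H) → ℝ)‖ * ∑ i, C i,
    mul_nonneg (mul_nonneg (Nat.cast_nonneg _) (norm_nonneg _)) hS, fun t x => ?_⟩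
  refine (e.opNorm_le (M := (∑ i, C i) * w x) (mul_nonneg hS (hw x)) fun i => ?_).trans_eq ?_
  · refine (hC i t x).trans (mul_le_mul_of_nonneg_right ?_ (hw x))
    exact Finset.single_le_sum (f := C) (fun i _ => hC0 i) (Finset.mem_univ i)
  · simp [nsmul_eq_mul, mul_assoc]

variable {ι S : Type*} [TopologicalSpace ι] [TopologicalSpace S]
  [MeasurableSpace S] [OpensMeasurableSpace S] {μ : Measure S}
variable {H : Type*} [NormedAddCommGroup H] [NormedSpace ℝ H] [FiniteDimensional ℝ H]

theorem BddFamily.hasFDerivAt_integral {N : ℕ} {w : H → ℝ} (hw : Continuous w)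
    (hw0 : ∀ x, 0 ≤ w x) {g : S → ℂ} (hg : Integrable g μ) {a : S × ι → H → ℂ}
    (ha : BddFamily (N + 1) w a) (t : ι) (x : H) :
    Integrable (fun s => g s • fderiv ℝ (a (s, t)) x) μ ∧
    HasFDerivAt (fun x => ∫ s, g s * a (s, t) x ∂μ) (∫ s, g s • fderiv ℝ (a (s, t)) x ∂μ) x := by
  obtain ⟨C, hC0, hC⟩ := ha.norm_fderiv_le hw0
  obtain ⟨D, hD0, hD⟩ := ha.exists_bound_pos hw0
  have hmeas : ∀ y, AEStronglyMeasurable (fun s => g s * a (s, t) y) μ := fun y =>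
    hg.1.mul (ha.continuous.comp (by fun_prop :
      Continuous fun s : S => ((s, t), y))).aestronglyMeasurable
  have hmeas' : AEStronglyMeasurable (fun s => g s • fderiv ℝ (a (s, t)) x) μ := by
    refine hg.1.smul (Continuous.aestronglyMeasurable (continuous_clm_apply.2 fun v => ?_))
    exact (ha.2.2 v).continuous.comp (by fun_prop : Continuous fun s : S => ((s, t), x))
  -- On this neighbourhood the weight is at most `w x + 1`, so a constant times `‖g‖` dominates the
  -- derivatives locally.
  have hnhds : {y | w y < w x + 1} ∈ 𝓝 x := (isOpen_lt hw continuous_const).mem_nhds (by simp)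
  refine ⟨(hg.norm.mul_const (C * w x)).mono' hmeas' (Eventually.of_forall fun s => ?_), ?_⟩
  · rw [norm_smul]; exact mul_le_mul_of_nonneg_left (hC _ _) (norm_nonneg _)
  refine hasFDerivAt_integral_of_dominated_of_fderiv_le
    (F' := fun y s => g s • fderiv ℝ (a (s, t)) y)
    (bound := fun s => ‖g s‖ * (C * (w x + 1))) hnhds (Eventually.of_forall hmeas) ?_ hmeas' ?_
    (hg.norm.mul_const _) ?_
  · refine (hg.norm.mul_const (D * w x)).mono' (hmeas x) (Eventually.of_forall fun s => ?_)
    rw [norm_mul]; exact mul_le_mul_of_nonneg_left (hD _ _) (norm_nonneg _)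
  · refine Eventually.of_forall fun s y hy => ?_
    rw [norm_smul]
    refine mul_le_mul_of_nonneg_left ((hC _ _).trans ?_) (norm_nonneg _)
    exact mul_le_mul_of_nonneg_left (le_of_lt hy) hC0
  · exact Eventually.of_forall fun s y _ => (ha.2.1 (s, t) y).hasFDerivAt.const_mul (g s)

theorem BddFamily.dirDeriv_integral {N : ℕ} {w : H → ℝ} (hw : Continuous w)
    (hw0 : ∀ x, 0 ≤ w x) {g : S → ℂ} (hg : Integrable g μ) {a : S × ι → H → ℂ}
    (ha : BddFamily (N + 1) w a) (t : ι) (v : H) :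
    MagneticWeyl.dirDeriv v (fun x => ∫ s, g s * a (s, t) x ∂μ) =
      fun x => ∫ s, g s * MagneticWeyl.dirDeriv v (a (s, t)) x ∂μ := by
  ext x
  obtain ⟨h1, h2⟩ := ha.hasFDerivAt_integral hw hw0 hg t x
  simp only [MagneticWeyl.dirDeriv]
  rw [h2.fderiv, ContinuousLinearMap.integral_apply h1]
  simp

/-- Part of the index is integrated out against an integrable density without loss of orders or
weight. The integrated variable will be a Taylor parameter, a triangle parameter, or the phase
variables themselves. -/
theorem BddFamily.integral [FirstCountableTopology ι] {N : ℕ} {w : H → ℝ} (hw : Continuous w)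
    (hw0 : ∀ x, 0 ≤ w x) {g : S → ℂ} (hg : Integrable g μ) {a : S × ι → H → ℂ}
    (ha : BddFamily N w a) : BddFamily N w fun t x => ∫ s, g s * a (s, t) x ∂μ := by
  have key : ∀ a : S × ι → H → ℂ, BddFamily 0 w a →
      BddFamily 0 w fun t x => ∫ s, g s * a (s, t) x ∂μ := by
    intro a ha
    obtain ⟨D, hD0, hD⟩ := ha.exists_bound_pos hw0
    have hn : ∀ t x s, ‖g s * a (s, t) x‖ ≤ ‖g s‖ * (D * w x) := fun t x s => by
      rw [norm_mul]; exact mul_le_mul_of_nonneg_left (hD _ _) (norm_nonneg _)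
    refine ⟨⟨(∫ s, ‖g s‖ ∂μ) * D, fun t x => ?_⟩, continuous_iff_continuousAt.2 fun p => ?_⟩
    · rw [mul_assoc, ← integral_mul_const]
      exact norm_integral_le_of_norm_le (hg.norm.mul_const _) (Eventually.of_forall (hn t x))
    · refine continuousAt_of_dominated (bound := fun s => ‖g s‖ * (D * (w p.2 + 1))) ?_ ?_
        (hg.norm.mul_const _) ?_
      · exact Eventually.of_forall fun q => hg.1.mul (ha.continuous.comp (by fun_prop :
          Continuous fun s : S => ((s, q.1), q.2))).aestronglyMeasurable
      · have : {q : ι × H | w q.2 < w p.2 + 1} ∈ 𝓝 p :=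
          (isOpen_lt (hw.comp continuous_snd) continuous_const).mem_nhds (by simp)
        filter_upwards [this] with q hq
        refine Eventually.of_forall fun s => (hn _ _ _).trans ?_
        exact mul_le_mul_of_nonneg_left (mul_le_mul_of_nonneg_left (le_of_lt hq) hD0) (norm_nonneg _)
      · refine Eventually.of_forall fun s => (Continuous.continuousAt ?_)
        exact continuous_const.mul (ha.continuous.comp (by fun_prop :
          Continuous fun q : ι × H => ((s, q.1), q.2)))
  induction N generalizing a with
  | zero => exact key a ha
  | succ N ih =>
    refine ⟨key a ha.zero_order, fun t x =>
      (ha.hasFDerivAt_integral hw hw0 hg t x).2.differentiableAt, fun v => ?_⟩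
    simp only [ha.dirDeriv_integral hw hw0 hg]
    exact ih (ha.2.2 v)

end Integrals

/-! ### Paired spaces -/

/-- The weight `1 + ‖x‖`. -/
def wt {E : Type*} [NormedAddCommGroup E] (x : E) : ℝ := 1 + ‖x‖

section Weight

variable {E : Type*} [NormedAddCommGroup E]

theorem one_le_wt (x : E) : 1 ≤ wt x := by simp [wt]

theorem wt_pos (x : E) : 0 < wt x := by linarith [one_le_wt x]

theorem wt_nonneg (x : E) : 0 ≤ wt x := (wt_pos x).le

theorem continuous_wt : Continuous (wt : E → ℝ) := by unfold wt; fun_prop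

theorem continuous_wt_pow_inv (n : ℕ) : Continuous fun x : E => (wt x ^ n)⁻¹ :=
  (continuous_wt.pow n).inv₀ fun x => (pow_pos (wt_pos x) n).ne'

theorem wt_add_le (x y : E) : wt (x + y) ≤ wt x * wt y := by
  have := norm_add_le x y
  simp only [wt]; nlinarith [norm_nonneg x, norm_nonneg y]

theorem wt_neg (x : E) : wt (-x) = wt x := by simp [wt]

theorem wt_sub_le (x y : E) : wt (x - y) ≤ wt x * wt y := by
  rw [sub_eq_add_neg, ← wt_neg y]; exact wt_add_le _ _

theorem integrable_wt_pow_inv [NormedSpace ℝ E] [FiniteDimensional ℝ E] [MeasurableSpace E]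
    [BorelSpace E] (μ : Measure E) [μ.IsAddHaarMeasure] {n : ℕ} (hn : Module.finrank ℝ E + 1 ≤ n) :
    Integrable (fun x : E => (wt x ^ n)⁻¹) μ := by
  have h : (Module.finrank ℝ E : ℝ) < (n : ℝ) := by exact_mod_cast hn
  refine (integrable_one_add_norm (μ := μ) h).congr (Eventually.of_forall fun x => ?_)
  simp only [wt]
  rw [Real.rpow_neg (by positivity), Real.rpow_natCast]

end Weight

/-- A space with a symmetric pairing and a finite family of vectors that detects growth. -/
class PairedSpace (E : Type*) [NormedAddCommGroup E] [NormedSpace ℝ E] where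
  pairing : E →L[ℝ] E →L[ℝ] ℝ
  symm : ∀ v w, pairing v w = pairing w v
  frame : List E
  growth : ∃ C, 0 ≤ C ∧ ∀ x : E, wt x ≤ C * (frame.map fun v => 1 + |pairing v x|).prod

open PairedSpace

theorem one_add_sum_le_prod {σ : Type*} (l : List σ) (f : σ → ℝ) (hf : ∀ i, 0 ≤ f i) :
    1 + (l.map f).sum ≤ (l.map fun i => 1 + f i).prod := by
  induction l with
  | nil => simp
  | cons i l ih =>
    have h0 : 0 ≤ (l.map f).sum := List.sum_nonneg (by simp only [List.mem_map]; rintro _ ⟨j, -, rfl⟩; exact hf j)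
    simp only [List.map_cons, List.sum_cons, List.prod_cons]
    nlinarith [hf i]

instance (d : ℕ) : PairedSpace (Space d) where
  pairing := innerSL ℝ
  symm v w := real_inner_comm w v
  frame := Finset.univ.toList.map fun l : Fin d => basisVec l
  growth := by
    refine ⟨1, zero_le_one, fun x => ?_⟩
    rw [List.map_map, one_mul]
    have h1 : ‖x‖ ≤ ∑ l, |x l| := by
      have hx : x = ∑ l, x l • basisVec l := by
        ext j
        simp [Finset.sum_apply, Pi.single_apply]
      conv_lhs => rw [hx]
      refine (norm_sum_le _ _).trans_eq (Finset.sum_congr rfl fun l _ => ?_)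
      rw [norm_smul]; simp
    have h2 := one_add_sum_le_prod (Finset.univ.toList : List (Fin d)) (fun l => |x l|) fun l => abs_nonneg _
    rw [Finset.sum_map_toList] at h2
    refine (add_le_add_right h1 1).trans (h2.trans_eq ?_)
    congr 1
    refine List.map_congr_left fun l _ => ?_
    change 1 + |x l| = 1 + |inner ℝ (basisVec l) x|
    simp [EuclideanSpace.inner_single_left]

instance (E F : Type*) [NormedAddCommGroup E] [NormedSpace ℝ E] [NormedAddCommGroup F]
    [NormedSpace ℝ F] [PairedSpace E] [PairedSpace F] : PairedSpace (E × F) where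
  pairing :=
    (pairing.bilinearComp (ContinuousLinearMap.fst ℝ E F) (ContinuousLinearMap.fst ℝ E F)) +
      (pairing.bilinearComp (ContinuousLinearMap.snd ℝ E F) (ContinuousLinearMap.snd ℝ E F))
  symm v w := by simp [PairedSpace.symm v.1, PairedSpace.symm v.2]
  frame := (frame.map fun v => (v, 0)) ++ (frame.map fun v => (0, v))
  growth := by
    obtain ⟨C, hC0, hC⟩ := growth (E := E)
    obtain ⟨D, hD0, hD⟩ := growth (E := F)
    refine ⟨C * D, mul_nonneg hC0 hD0, fun x => ?_⟩
    rw [List.map_append, List.prod_append, List.map_map, List.map_map]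
    have h : wt x ≤ wt x.1 * wt x.2 := by
      simp only [wt, Prod.norm_def]
      rcases max_cases ‖x.1‖ ‖x.2‖ with h | h <;>
        nlinarith [norm_nonneg x.1, norm_nonneg x.2, mul_nonneg (norm_nonneg x.1) (norm_nonneg x.2)]
    refine h.trans ((mul_le_mul (hC x.1) (hD x.2) (wt_nonneg _)
      ((wt_nonneg _).trans (hC x.1))).trans_eq ?_)
    simp only [Function.comp_def]
    simp
    ring

theorem pairing_space {d : ℕ} (v w : Space d) : pairing v w = inner ℝ v w := rfl

theorem pairing_prod {E F : Type*} [NormedAddCommGroup E] [NormedSpace ℝ E] [NormedAddCommGroup F]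
    [NormedSpace ℝ F] [PairedSpace E] [PairedSpace F] (v w : E × F) :
    pairing v w = pairing v.1 w.1 + pairing v.2 w.2 := rfl

/-! ### The multipliers `(1 + i⟨v, x⟩)⁻¹`. -/

section Coef

variable {E : Type*} [NormedAddCommGroup E] [NormedSpace ℝ E] [PairedSpace E]

/-- The factor `(1 + i ⟨v, x⟩)⁻¹`. -/
def coef (v x : E) : ℂ := (1 + Complex.I * (pairing v x : ℝ))⁻¹

/-- The size of `coef v x`. -/
def coefWt (v x : E) : ℝ := (1 + |pairing v x|)⁻¹

theorem coefWt_nonneg (v x : E) : 0 ≤ coefWt v x := by unfold coefWt; positivity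

theorem one_add_I_mul_ne_zero (r : ℝ) : 1 + Complex.I * (r : ℂ) ≠ 0 := by
  intro h; simpa using congrArg Complex.re h

theorem mul_coef (v x : E) : (1 + Complex.I * (pairing v x : ℝ)) * coef v x = 1 :=
  mul_inv_cancel₀ (one_add_I_mul_ne_zero _)

theorem norm_coef_le (v x : E) : ‖coef v x‖ ≤ 2 * coefWt v x := by
  have h1 : |pairing v x| ≤ ‖1 + Complex.I * (pairing v x : ℝ)‖ := by
    simpa using Complex.abs_im_le_norm (1 + Complex.I * (pairing v x : ℝ))
  have h2 : 1 ≤ ‖1 + Complex.I * (pairing v x : ℝ)‖ := by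
    simpa using Complex.abs_re_le_norm (1 + Complex.I * (pairing v x : ℝ))
  rw [coef, coefWt, norm_inv]
  rw [show (2 : ℝ) * (1 + |pairing v x|)⁻¹ = ((1 + |pairing v x|) / 2)⁻¹ by rw [inv_div]; ring]
  exact inv_anti₀ (by positivity) (by linarith)

theorem hasFDerivAt_coef (v x : E) : HasFDerivAt (coef v)
    ((-Complex.I * coef v x * coef v x) • Complex.ofRealCLM.comp (pairing v)) x := by
  have h := ((Complex.ofRealCLM.comp (pairing v)).hasFDerivAt (x := x)).const_mul Complex.I
  have h2 := (hasDerivAt_inv (one_add_I_mul_ne_zero (pairing v x))).comp_hasFDerivAt_of_eq x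
    (h.const_add 1) (by simp)
  refine (h2.congr_fderiv ?_)
  ext u
  simp [coef, pow_two]
  ring

theorem continuous_coef (v : E) : Continuous (coef v) :=
  continuous_iff_continuousAt.2 fun x => (hasFDerivAt_coef v x).continuousAt

theorem contDiff_coef (v : E) : ContDiff ℝ ∞ (coef v) := by
  unfold coef
  refine ContDiff.inv ?_ fun x => one_add_I_mul_ne_zero _
  exact contDiff_const.add (contDiff_const.mul
    (Complex.ofRealCLM.contDiff.comp (pairing v).contDiff))

/-- A derivative of `coef v` is a constant times its square, so all derivatives are polynomials in
`coef v` without constant term and retain its decay. -/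
theorem bddFamily_coef {ι : Type*} [TopologicalSpace ι] (v : E) (N : ℕ) :
    BddFamily N (coefWt v) (fun _ : ι => coef v) := by
  have h0 : BddFamily 0 (coefWt v) (fun _ : ι => coef v) :=
    ⟨⟨2, fun _ x => norm_coef_le v x⟩, (continuous_coef v).comp continuous_snd⟩
  have key : ∀ N, BddFamily N (fun _ => 1) (fun _ : ι => coef v) →
      BddFamily N (coefWt v) (fun _ : ι => coef v) →
      BddFamily (N + 1) (coefWt v) (fun _ : ι => coef v) := by
    intro N h1 h2
    refine ⟨h0, fun _ x => (hasFDerivAt_coef v x).differentiableAt, fun u => ?_⟩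
    refine ((((h1.mul h2).smul_const (-Complex.I * (pairing v u : ℝ)))).mono' (w' := coefWt v)
      (fun x => by simp) fun x => by simpa using coefWt_nonneg v x).congr fun t x => ?_
    simp [dirDeriv, (hasFDerivAt_coef v x).fderiv]
    ring
  have h1 : ∀ x : E, coefWt v x ≤ 1 := fun x => inv_le_one_of_one_le₀ (by simp)
  induction N with
  | zero => exact h0
  | succ N ih => exact key N (ih.mono' h1 (coefWt_nonneg v)) ih

/-- One integration by parts along every frame vector gains a full power of `(wt x)⁻¹`. This is why
the frame is required to control the weight through a product of linear forms. -/
theorem exists_prod_coefWt_le : ∃ C, 0 ≤ C ∧ ∀ x : E,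
    (frame.map fun v : E => coefWt v x).prod ≤ C * (wt x)⁻¹ := by
  obtain ⟨C, hC0, hC⟩ := growth (E := E)
  refine ⟨C, hC0, fun x => ?_⟩
  have h1 : (frame.map fun v : E => coefWt v x).prod =
      ((frame.map fun v : E => 1 + |pairing v x|).prod)⁻¹ := by
    induction (frame : List E) with
    | nil => simp
    | cons v l ih => simp only [List.map_cons, List.prod_cons, ih, mul_inv]; rfl
  have h2 := hC x
  rw [h1]
  have h3 : 0 < (frame.map fun v : E => 1 + |pairing v x|).prod :=
    List.prod_pos (by simp only [List.mem_map]; rintro _ ⟨v, -, rfl⟩; positivity)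
  rw [← div_eq_mul_inv, le_div_iff₀ (wt_pos x), inv_mul_le_iff₀ h3, mul_comm]
  exact h2

end Coef

/-! ### Oscillatory integrals with a quadratic phase -/

theorem ContDiff.dirDeriv {H : Type*} [NormedAddCommGroup H] [NormedSpace ℝ H] {a : H → ℂ}
    (ha : ContDiff ℝ ∞ a) (v : H) : ContDiff ℝ ∞ (dirDeriv v a) := by
  have h := ha.fderiv_right (m := ∞) (by simp)
  exact h.clm_apply contDiff_const

/-! ### The operators of integration by parts. -/

section Steps

variable {ι : Type*} [TopologicalSpace ι]
variable {Q : Type*} [NormedAddCommGroup Q] [NormedSpace ℝ Q]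
variable {E : Type*} [NormedAddCommGroup E] [NormedSpace ℝ E] [PairedSpace E]

/-- One integration by parts in the first variable of the phase. -/
def stepFst (v : E) (a : Q × E × E → ℂ) (h : Q × E × E) : ℂ :=
  coef v h.2.2 * (a h + dirDeriv (0, v, 0) a h)

/-- One integration by parts in the second variable of the phase. -/
def stepSnd (u : E) (a : Q × E × E → ℂ) (h : Q × E × E) : ℂ :=
  coef u h.2.1 * (a h + dirDeriv (0, 0, u) a h)

def stepsFst (l : List E) (a : Q × E × E → ℂ) : Q × E × E → ℂ := l.foldr stepFst a

/-- A left fold, so the head of the list acts first: `stepsSnd (u :: l) a` is by definition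
`stepsSnd l (stepSnd u a)`. The proof of `Amp.oscInt_stepSnd` rests on this. -/
def stepsSnd (l : List E) (a : Q × E × E → ℂ) : Q × E × E → ℂ := l.foldl (fun b u => stepSnd u b) a

/-- A smooth cut-off function. -/
def cutoff {E : Type*} [NormedAddCommGroup E] [NormedSpace ℝ E] [FiniteDimensional ℝ E] (x : E) : ℂ :=
  ((default : ContDiffBump (0 : E)) x : ℝ)

theorem contDiff_coef_fst (v : E) : ContDiff ℝ ∞ fun h : Q × E × E => coef v h.2.1 :=
  (contDiff_coef v).comp (contDiff_fst.comp contDiff_snd)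

theorem contDiff_coef_snd (v : E) : ContDiff ℝ ∞ fun h : Q × E × E => coef v h.2.2 :=
  (contDiff_coef v).comp (contDiff_snd.comp contDiff_snd)

theorem contDiff_stepFst {a : Q × E × E → ℂ} (ha : ContDiff ℝ ∞ a) (v : E) :
    ContDiff ℝ ∞ (stepFst v a) :=
  (contDiff_coef_snd v).mul (ha.add (ContDiff.dirDeriv ha _))

theorem contDiff_stepSnd {a : Q × E × E → ℂ} (ha : ContDiff ℝ ∞ a) (v : E) :
    ContDiff ℝ ∞ (stepSnd v a) :=
  (contDiff_coef_fst v).mul (ha.add (ContDiff.dirDeriv ha _))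

theorem contDiff_stepsFst {a : Q × E × E → ℂ} (ha : ContDiff ℝ ∞ a) (l : List E) :
    ContDiff ℝ ∞ (stepsFst l a) := by
  induction l with
  | nil => exact ha
  | cons v l ih => exact contDiff_stepFst ih v

theorem contDiff_stepsSnd {a : Q × E × E → ℂ} (ha : ContDiff ℝ ∞ a) (l : List E) :
    ContDiff ℝ ∞ (stepsSnd l a) := by
  induction l generalizing a with
  | nil => exact ha
  | cons v l ih => exact ih (contDiff_stepSnd ha v)

theorem dirDeriv_coef_fst (v : E) (q : Q) (w : E) :
    dirDeriv (q, 0, w) (fun h : Q × E × E => coef v h.2.1) = fun _ => 0 := by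
  ext h
  have := (hasFDerivAt_coef v h.2.1).comp h
    ((ContinuousLinearMap.fst ℝ E E).comp (ContinuousLinearMap.snd ℝ Q (E × E))).hasFDerivAt
  refine (congrArg (fun L : Q × E × E →L[ℝ] ℂ => L _) this.fderiv).trans ?_
  simp

theorem dirDeriv_coef_snd (v : E) (q : Q) (w : E) :
    dirDeriv (q, w, 0) (fun h : Q × E × E => coef v h.2.2) = fun _ => 0 := by
  ext h
  have := (hasFDerivAt_coef v h.2.2).comp h
    ((ContinuousLinearMap.snd ℝ E E).comp (ContinuousLinearMap.snd ℝ Q (E × E))).hasFDerivAt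
  refine (congrArg (fun L : Q × E × E →L[ℝ] ℂ => L _) this.fderiv).trans ?_
  simp

/-- The multiplier depends on the second phase variable only, hence is constant along `(q, w, 0)`.
In particular parameter derivatives pass through all integrations by parts. -/
theorem dirDeriv_stepFst {a : Q × E × E → ℂ} (ha : ContDiff ℝ ∞ a) (v w : E) (q : Q) :
    dirDeriv (q, w, 0) (stepFst v a) = stepFst v (dirDeriv (q, w, 0) a) := by
  have hd : ∀ {b : Q × E × E → ℂ}, ContDiff ℝ ∞ b → Differentiable ℝ b := fun hb =>
    hb.differentiable (by simp)
  have h1 := dirDeriv_mul (hd (contDiff_coef_snd (Q := Q) v))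
    (hd (ha.add (ContDiff.dirDeriv ha (0, v, 0)))) (q, w, 0)
  have h2 := dirDeriv_add (hd ha) (hd (ContDiff.dirDeriv ha (0, v, 0))) (q, w, 0)
  unfold stepFst
  rw [h1, dirDeriv_coef_snd, h2, dirDeriv_comm (by simpa using contDiff_infty.1 ha 2) (0, v, 0)]
  simp

theorem dirDeriv_stepSnd {a : Q × E × E → ℂ} (ha : ContDiff ℝ ∞ a) (v w : E) (q : Q) :
    dirDeriv (q, 0, w) (stepSnd v a) = stepSnd v (dirDeriv (q, 0, w) a) := by
  have hd : ∀ {b : Q × E × E → ℂ}, ContDiff ℝ ∞ b → Differentiable ℝ b := fun hb =>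
    hb.differentiable (by simp)
  have h1 := dirDeriv_mul (hd (contDiff_coef_fst (Q := Q) v))
    (hd (ha.add (ContDiff.dirDeriv ha (0, 0, v)))) (q, 0, w)
  have h2 := dirDeriv_add (hd ha) (hd (ContDiff.dirDeriv ha (0, 0, v))) (q, 0, w)
  unfold stepSnd
  rw [h1, dirDeriv_coef_fst, h2, dirDeriv_comm (by simpa using contDiff_infty.1 ha 2) (0, 0, v)]
  simp

theorem dirDeriv_stepsFst {a : Q × E × E → ℂ} (ha : ContDiff ℝ ∞ a) (l : List E) (q : Q) :
    dirDeriv (q, 0, 0) (stepsFst l a) = stepsFst l (dirDeriv (q, 0, 0) a) := by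
  induction l with
  | nil => rfl
  | cons v l ih =>
    exact (dirDeriv_stepFst (contDiff_stepsFst ha l) v 0 q).trans (congrArg (stepFst v) ih)

theorem dirDeriv_stepsSnd {a : Q × E × E → ℂ} (ha : ContDiff ℝ ∞ a) (l : List E) (q : Q) :
    dirDeriv (q, 0, 0) (stepsSnd l a) = stepsSnd l (dirDeriv (q, 0, 0) a) := by
  induction l generalizing a with
  | nil => rfl
  | cons v l ih =>
    refine (ih (contDiff_stepSnd ha v)).trans ?_
    rw [dirDeriv_stepSnd ha]; rfl

theorem BddFamily.stepFst [FiniteDimensional ℝ E] {N : ℕ} {w : Q × E × E → ℝ}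
    {a : ι → Q × E × E → ℂ} (ha : BddFamily (N + 1) w a) (v : E) :
    BddFamily N (fun h => coefWt v h.2.2 * w h) fun t => stepFst v (a t) :=
  ((bddFamily_coef v N).comp_const
    ((ContinuousLinearMap.snd ℝ E E).comp (ContinuousLinearMap.snd ℝ Q (E × E)))
    ⟨1, zero_le_one, fun _ => (one_mul _).ge⟩ (coefWt_nonneg v)).mul (ha.of_succ.add (ha.2.2 _))

/-- Every step spends one order of differentiability and gains one factor `coefWt v`. -/
theorem BddFamily.stepsFst [FiniteDimensional ℝ E] {N : ℕ} {w : Q × E × E → ℝ}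
    {a : ι → Q × E × E → ℂ} (l : List E) (ha : BddFamily (N + l.length) w a) :
    BddFamily N (fun h => (l.map fun v => coefWt v h.2.2).prod * w h) fun t => stepsFst l (a t) := by
  induction l generalizing N with
  | nil => simpa [MagneticWeyl.stepsFst] using ha
  | cons v l ih =>
    have := (ih (N := N + 1) (by simpa [Nat.add_assoc, Nat.add_comm 1] using ha)).stepFst v
    simp only [List.map_cons, List.prod_cons, mul_assoc]
    exact this

end Steps

/-! ### Cut-off functions and their dilations. -/

section Cutoff

variable {E : Type*} [NormedAddCommGroup E] [NormedSpace ℝ E] [FiniteDimensional ℝ E]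

theorem cutoff_zero : cutoff (0 : E) = 1 := by
  have := (default : ContDiffBump (0 : E)).one_of_mem_closedBall (x := 0)
    (Metric.mem_closedBall_self (default : ContDiffBump (0 : E)).rIn_pos.le)
  simp [cutoff, this]

theorem contDiff_cutoff : ContDiff ℝ ∞ (cutoff : E → ℂ) :=
  Complex.ofRealCLM.contDiff.comp (default : ContDiffBump (0 : E)).contDiff

theorem hasCompactSupport_cutoff : HasCompactSupport (cutoff : E → ℂ) :=
  (default : ContDiffBump (0 : E)).hasCompactSupport.comp_left (g := fun r : ℝ => (r : ℂ)) (by simp)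

theorem bddFamily_of_hasCompactSupport {ι : Type*} [TopologicalSpace ι] {F : E → ℂ}
    (hF : ContDiff ℝ ∞ F) (hc : HasCompactSupport F) (N : ℕ) :
    BddFamily N (fun _ => 1) (fun _ : ι => F) := by
  have key : ∀ F : E → ℂ, ContDiff ℝ ∞ F → HasCompactSupport F →
      BddFamily 0 (fun _ => 1) (fun _ : ι => F) := by
    intro F hF hc
    obtain ⟨C, hC⟩ := hc.exists_bound_of_continuous hF.continuous
    exact ⟨⟨C, fun _ x => by simpa using hC x⟩, hF.continuous.comp continuous_snd⟩
  induction N generalizing F with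
  | zero => exact key F hF hc
  | succ N ih =>
    exact ⟨key F hF hc, fun _ => hF.differentiable (by simp), fun v =>
      ih (ContDiff.dirDeriv hF v) (hc.fderiv_apply ℝ v)⟩

/-- For `δ ∈ [0, 1]` the map `δA` is no larger than `A`, so derivatives stay bounded. The value `δ =
0` belongs to the index set, which later turns limits of regularizations into continuity. -/
theorem bddFamily_dilation {K : Type*} [NormedAddCommGroup K] [NormedSpace ℝ K] {F : E → ℂ} {N : ℕ}
    (A : K →L[ℝ] E) (hF : BddFamily N (fun _ => 1) (fun _ : unitInterval => F)) :
    BddFamily N (fun _ => 1) (fun (δ : unitInterval) x => F ((δ : ℝ) • A x)) := by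
  refine BddFamily.comp (a := fun _ : unitInterval => F) (wK := fun _ => 1)
    (A := fun δ : unitInterval => (δ : ℝ) • A) (by simp only [_root_.smul_apply]; fun_prop)
    ⟨‖A‖, fun δ => ?_⟩ ⟨1, zero_le_one, fun _ _ => (one_mul _).ge⟩ (fun _ => zero_le_one) hF
  rw [norm_smul, Real.norm_of_nonneg δ.2.1]
  exact mul_le_of_le_one_left (norm_nonneg _) δ.2.2

end Cutoff

/-! ### The oscillating factor and integration by parts. -/

section Phase

variable {E : Type*} [NormedAddCommGroup E] [NormedSpace ℝ E] [PairedSpace E]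

/-- The oscillating factor `e^{-i⟨W, Θ⟩}`. -/
def phase (z : E × E) : ℂ := Complex.exp (-Complex.I * (pairing z.1 z.2 : ℝ))

theorem norm_phase (z : E × E) : ‖phase z‖ = 1 := by
  rw [phase, show -Complex.I * ((pairing z.1 z.2 : ℝ) : ℂ) = ((-(pairing z.1 z.2) : ℝ) : ℂ) * Complex.I by
    push_cast; ring, Complex.norm_exp_ofReal_mul_I]

theorem hasFDerivAt_pairing (z : E × E) : HasFDerivAt (fun z : E × E => pairing z.1 z.2)
    ((pairing z.1).comp (ContinuousLinearMap.snd ℝ E E) +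
      (pairing.flip z.2).comp (ContinuousLinearMap.fst ℝ E E)) z := by
  have := (pairing : E →L[ℝ] E →L[ℝ] ℝ).isBoundedBilinearMap.hasFDerivAt z
  refine this.congr_fderiv ?_
  ext v <;> simp

theorem hasFDerivAt_phase (z : E × E) : HasFDerivAt phase
    ((-Complex.I * phase z) • Complex.ofRealCLM.comp ((pairing z.1).comp (ContinuousLinearMap.snd ℝ E E) +
      (pairing.flip z.2).comp (ContinuousLinearMap.fst ℝ E E))) z := by
  have h := (Complex.ofRealCLM.hasFDerivAt.comp z (hasFDerivAt_pairing z)).const_mul (-Complex.I)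
  refine h.cexp.congr_fderiv ?_
  ext v <;> simp [phase, mul_assoc] <;> ring

theorem differentiable_phase : Differentiable ℝ (phase : E × E → ℂ) := fun z =>
  (hasFDerivAt_phase z).differentiableAt

theorem continuous_phase : Continuous (phase : E × E → ℂ) := differentiable_phase.continuous

variable [FiniteDimensional ℝ E] [MeasureSpace E] [BorelSpace E]
  [(volume : Measure E).IsAddHaarMeasure]

instance : (volume : Measure (E × E)).IsAddHaarMeasure :=
  inferInstanceAs ((volume : Measure E).prod (volume : Measure E)).IsAddHaarMeasure

/-- Compact support removes boundary terms, and the derivative of the phase along `v` is `-i(⟨v₁, Θ⟩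
+ ⟨W, v₂⟩)` times the phase. -/
theorem integral_phase_mul_dirDeriv {F : E × E → ℂ} (hF : ContDiff ℝ ∞ F)
    (hc : HasCompactSupport F) (v : E × E) :
    ∫ z, phase z * dirDeriv v F z =
      ∫ z, phase z * (Complex.I * (pairing v.1 z.2 + pairing z.1 v.2 : ℝ) * F z) := by
  have hd : ContDiff ℝ ∞ (fun z => phase z * F z) := by
    refine ContDiff.mul ?_ hF
    unfold phase
    refine Complex.contDiff_exp.comp (contDiff_const.mul (Complex.ofRealCLM.contDiff.comp ?_))
    exact (pairing : E →L[ℝ] E →L[ℝ] ℝ).isBoundedBilinearMap.contDiff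
  have hphase : ∀ z, fderiv ℝ phase z v =
      -(phase z * (Complex.I * (pairing v.1 z.2 + pairing z.1 v.2 : ℝ))) := fun z => by
    rw [(hasFDerivAt_phase z).fderiv]; simp; ring
  have hFi : ∀ {G : E × E → ℂ}, Continuous G → Integrable fun z => G z * F z := fun hG =>
    (hG.mul hF.continuous).integrable_of_hasCompactSupport hc.mul_left
  have hp : Continuous fun z : E × E => fderiv ℝ phase z v := by
    simp only [hphase]
    have := (pairing : E →L[ℝ] E →L[ℝ] ℝ).continuous
    exact (continuous_phase.mul (continuous_const.mul (Complex.continuous_ofReal.comp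
      (by fun_prop)))).neg
  have h := integral_mul_fderiv_eq_neg_fderiv_mul_of_integrable (μ := (volume : Measure (E × E)))
    (f := phase) (g := F) (v := v) (hFi hp)
    ((continuous_phase.mul (ContDiff.dirDeriv hF v).continuous).integrable_of_hasCompactSupport
      ((hc.fderiv_apply ℝ v).mul_left)) (hFi continuous_phase)
    (fun z _ => differentiable_phase z) fun z _ => hF.differentiable (by simp) z
  simp only [dirDeriv]
  rw [h, ← integral_neg]
  refine integral_congr_ae (Eventually.of_forall fun z => ?_)
  simp only [hphase]; ring

end Phase

/-! ### Turning a variable into an index. -/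

section Slices

variable {ι : Type*} [TopologicalSpace ι]
variable {Q : Type*} [NormedAddCommGroup Q] [NormedSpace ℝ Q]
variable {Z : Type*} [NormedAddCommGroup Z] [NormedSpace ℝ Z]

theorem dirDeriv_slice_snd {a : Q × Z → ℂ} (ha : Differentiable ℝ a) (q : Q) (v z : Z) :
    dirDeriv v (fun z => a (q, z)) z = dirDeriv (0, v) a (q, z) := by
  have h1 : HasFDerivAt (fun z : Z => (q, z)) (ContinuousLinearMap.inr ℝ Q Z) z :=
    hasFDerivAt_prodMk_right q z
  exact (congrArg (fun L : Z →L[ℝ] ℂ => L v) ((ha (q, z)).hasFDerivAt.comp z h1).fderiv).trans rfl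

theorem dirDeriv_slice_fst {a : Q × Z → ℂ} (ha : Differentiable ℝ a) (v q : Q) (z : Z) :
    dirDeriv v (fun q => a (q, z)) q = dirDeriv (v, 0) a (q, z) := by
  have h1 : HasFDerivAt (fun q : Q => (q, z)) (ContinuousLinearMap.inl ℝ Q Z) q :=
    hasFDerivAt_prodMk_left q z
  exact (congrArg (fun L : Q →L[ℝ] ℂ => L v) ((ha (q, z)).hasFDerivAt.comp q h1).fderiv).trans rfl

/-- Dividing by `ρ z` makes the bound uniform in `z`, so `z` may be treated as an index. Integration
against the density `ρ` then restores the factor. -/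
theorem BddFamily.slice {N : ℕ} {om : Q → ℝ} {ρ : Z → ℝ} (hρ : Continuous ρ) (hρ0 : ∀ z, 0 < ρ z)
    {R : ι → Q × Z → ℂ} (h : BddFamily N (fun h => om h.1 * ρ h.2) R) :
    BddFamily N om fun (p : Z × ι) q => ((ρ p.1)⁻¹ : ℝ) * R p.2 (q, p.1) := by
  have hc : Continuous fun p : (Z × ι) × Q => (((ρ p.1.1)⁻¹ : ℝ) : ℂ) :=
    Complex.continuous_ofReal.comp ((hρ.comp (by fun_prop)).inv₀ fun p => (hρ0 _).ne')
  have key : ∀ R : ι → Q × Z → ℂ, BddFamily 0 (fun h => om h.1 * ρ h.2) R →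
      BddFamily 0 om fun (p : Z × ι) q => ((ρ p.1)⁻¹ : ℝ) * R p.2 (q, p.1) := by
    intro R h
    refine ⟨?_, hc.mul (h.continuous.comp (by fun_prop :
      Continuous fun p : (Z × ι) × Q => (p.1.2, (p.2, p.1.1))))⟩
    obtain ⟨C, hC⟩ := h.bound
    refine ⟨C, fun p q => ?_⟩
    have h1 := hρ0 p.1
    rw [norm_mul, Complex.norm_real, Real.norm_of_nonneg (inv_nonneg.2 h1.le),
      inv_mul_le_iff₀ h1]
    exact (hC p.2 (q, p.1)).trans_eq (by ring)
  induction N generalizing R with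
  | zero => exact key R h
  | succ N ih =>
    have hd : ∀ p : Z × ι, Differentiable ℝ fun q => R p.2 (q, p.1) := fun p =>
      (h.2.1 p.2).comp (differentiable_id.prodMk (differentiable_const _))
    refine ⟨key R h.zero_order, fun p => (hd p).const_mul _, fun v => ?_⟩
    refine (ih (h.2.2 (v, 0))).congr fun p q => ?_
    rw [dirDeriv_const_mul (hd p)]
    exact congrArg _ (dirDeriv_slice_fst (h.2.1 p.2) v q p.1).symm

end Slices

/-! ### Convergence of oscillatory integrals. -/

section OscInt

variable {ι : Type*} [TopologicalSpace ι]
variable {Q : Type*} [NormedAddCommGroup Q] [NormedSpace ℝ Q]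
variable {E : Type*} [NormedAddCommGroup E] [NormedSpace ℝ E] [PairedSpace E]
  [FiniteDimensional ℝ E]

/-- The amplitude `a` cut off at scale `δ⁻¹`. -/
def regularize (δ : ℝ) (a : Q × E × E → ℂ) (h : Q × E × E) : ℂ :=
  cutoff (δ • h.2.1) * cutoff (δ • h.2.2) * a h

theorem regularize_zero (a : Q × E × E → ℂ) : regularize 0 a = a := by
  ext h; simp [regularize, cutoff_zero]

theorem contDiff_regularize {a : Q × E × E → ℂ} (ha : ContDiff ℝ ∞ a) (δ : ℝ) :
    ContDiff ℝ ∞ (regularize δ a) :=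
  ((contDiff_cutoff.comp (contDiff_const.smul (contDiff_fst.comp contDiff_snd))).mul
    (contDiff_cutoff.comp (contDiff_const.smul (contDiff_snd.comp contDiff_snd)))).mul ha

theorem hasCompactSupport_regularize {δ : ℝ} (hδ : 0 < δ) (a : Q × E × E → ℂ) (q : Q) :
    HasCompactSupport fun z => regularize δ a (q, z) := by
  have hs := hasCompactSupport_cutoff (E := E)
  obtain ⟨r, hr⟩ := hs.isCompact.isBounded.subset_closedBall (0 : E)
  have hb : ∀ x : E, r / δ < ‖x‖ → cutoff (δ • x) = 0 := by
    intro x hx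
    by_contra h
    have := hr (subset_tsupport _ h)
    rw [mem_closedBall_zero_iff, norm_smul, Real.norm_of_nonneg hδ.le] at this
    rw [div_lt_iff₀ hδ] at hx
    linarith
  refine HasCompactSupport.intro (isCompact_closedBall (0 : E × E) (r / δ)) fun z hz => ?_
  rw [mem_closedBall_zero_iff, not_le, Prod.norm_def, lt_max_iff] at hz
  rcases hz with hz | hz <;> simp [regularize, hb _ hz]

/-- The weight used for absolutely convergent integrals over `E × E`. -/
def decay (z : E × E) : ℝ :=
  (wt z.1 ^ (Module.finrank ℝ E + 1))⁻¹ * (wt z.2 ^ (Module.finrank ℝ E + 1))⁻¹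

theorem decay_pos (z : E × E) : 0 < decay z :=
  mul_pos (inv_pos.2 (pow_pos (wt_pos _) _)) (inv_pos.2 (pow_pos (wt_pos _) _))

theorem continuous_decay : Continuous (decay : E × E → ℝ) :=
  ((continuous_wt_pow_inv _).comp continuous_fst).mul
    ((continuous_wt_pow_inv _).comp continuous_snd)

variable (E) in
/-- `n` copies of the frame of `E`. -/
def frames (n : ℕ) : List E := (List.replicate n frame).flatten

theorem exists_prod_frames_le (n : ℕ) : ∃ C, 0 ≤ C ∧ ∀ x : E,
    ((frames E n).map fun v => coefWt v x).prod ≤ C * (wt x ^ n)⁻¹ := by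
  obtain ⟨C, hC0, hC⟩ := exists_prod_coefWt_le (E := E)
  refine ⟨C ^ n, pow_nonneg hC0 n, fun x => ?_⟩
  have h : ((frames E n).map fun v => coefWt v x).prod =
      (frame.map fun v : E => coefWt v x).prod ^ n := by
    induction n with
    | zero => simp [frames]
    | succ n ih =>
      rw [pow_succ', ← ih]; simp [frames, List.replicate_succ]
  have h0 : 0 ≤ (frame.map fun v : E => coefWt v x).prod :=
    List.prod_nonneg (by simp only [List.mem_map]; rintro _ ⟨v, -, rfl⟩; exact coefWt_nonneg v x)
  rw [h, ← inv_pow, ← mul_pow]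
  exact pow_le_pow_left₀ h0 (hC x) n

/-- Of the `n` powers of decay that `n` rounds of the frame provide, `M` pay for the growth of the
amplitude and `dim E + 1` make the rest integrable. -/
theorem exists_stepsFst_weight_le (M : ℕ) {n : ℕ} (hn : M + (Module.finrank ℝ E + 1) ≤ n) :
    ∃ C, 0 ≤ C ∧ ∀ x : E, ((frames E n).map fun v => coefWt v x).prod * wt x ^ M ≤
      C * (wt x ^ (Module.finrank ℝ E + 1))⁻¹ := by
  obtain ⟨C, hC0, hC⟩ := exists_prod_frames_le (E := E) n
  refine ⟨C, hC0, fun x => ?_⟩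
  have h0 := wt_pos x
  have h1 : (wt x ^ n)⁻¹ ≤ (wt x ^ (M + (Module.finrank ℝ E + 1)))⁻¹ :=
    inv_anti₀ (pow_pos h0 _) (pow_le_pow_right₀ (one_le_wt x) hn)
  calc _ ≤ C * (wt x ^ n)⁻¹ * wt x ^ M := mul_le_mul_of_nonneg_right (hC x) (pow_nonneg h0.le _)
    _ ≤ C * (wt x ^ (M + (Module.finrank ℝ E + 1)))⁻¹ * wt x ^ M := by gcongr
    _ = _ := by rw [pow_add]; field_simp

variable [MeasureSpace E] [BorelSpace E] [(volume : Measure E).IsAddHaarMeasure]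

theorem integrable_decay : Integrable (decay : E × E → ℝ) :=
  (integrable_wt_pow_inv (volume : Measure E) le_rfl).mul_prod
    (integrable_wt_pow_inv (volume : Measure E) le_rfl)

theorem integrable_phase_mul_decay : Integrable fun z : E × E => phase z * (decay z : ℂ) :=
  integrable_decay.ofReal.bdd_mul continuous_phase.aestronglyMeasurable
    (c := 1) (Eventually.of_forall fun z => (norm_phase z).le)

theorem phase_decay_cancel (z : E × E) (c : ℂ) :
    phase z * (decay z : ℂ) * (((decay z)⁻¹ : ℝ) * c) = phase z * c := by
  have : (decay z : ℂ) ≠ 0 := by exact_mod_cast (decay_pos z).ne'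
  push_cast; field_simp

/-- The factor `decay z` is split off as integrable density; what remains after division by it is a
family indexed by `z`, to which `BddFamily.integral` applies. -/
theorem BddFamily.integral_phase [FirstCountableTopology ι] [FiniteDimensional ℝ Q] {N : ℕ}
    {om : Q → ℝ} (hom : Continuous om) (hom0 : ∀ q, 0 ≤ om q) {R : ι → Q × E × E → ℂ}
    (h : BddFamily N (fun h => om h.1 * decay h.2) R) :
    BddFamily N om fun t q => ∫ z, phase z * R t (q, z) := by
  have := (h.slice continuous_decay decay_pos).integral hom hom0 integrable_phase_mul_decay
  simpa only [phase_decay_cancel] using this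

theorem BddFamily.dirDeriv_integral_phase [FiniteDimensional ℝ Q] {N : ℕ}
    {om : Q → ℝ} (hom : Continuous om) (hom0 : ∀ q, 0 ≤ om q) {R : ι → Q × E × E → ℂ}
    (h : BddFamily (N + 1) (fun h => om h.1 * decay h.2) R) (t : ι) (v : Q) :
    MagneticWeyl.dirDeriv v (fun q => ∫ z, phase z * R t (q, z)) =
      fun q => ∫ z, phase z * MagneticWeyl.dirDeriv (v, 0) (R t) (q, z) := by
  have hd : ∀ z, Differentiable ℝ fun q => R t (q, z) := fun z =>
    (h.2.1 t).comp (differentiable_id.prodMk (differentiable_const _))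
  have := (h.slice continuous_decay decay_pos).dirDeriv_integral hom hom0 integrable_phase_mul_decay t v
  simpa only [phase_decay_cancel, dirDeriv_const_mul (hd _), dirDeriv_slice_fst (h.2.1 t)] using this

theorem hasCompactSupport_dirDeriv_slice {a : Q × E × E → ℂ} (ha : ContDiff ℝ ∞ a) {q : Q}
    (hc : HasCompactSupport fun z => a (q, z)) (v : E × E) :
    HasCompactSupport fun z => dirDeriv (0, v) a (q, z) := by
  have : (fun z => dirDeriv (0, v) a (q, z)) = dirDeriv v fun z => a (q, z) :=
    funext fun z => (dirDeriv_slice_snd (ha.differentiable (by simp)) q v z).symm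
  rw [this]
  exact hc.fderiv_apply ℝ v

theorem hasCompactSupport_stepFst {a : Q × E × E → ℂ} (ha : ContDiff ℝ ∞ a) {q : Q}
    (hc : HasCompactSupport fun z => a (q, z)) (v : E) :
    HasCompactSupport fun z => stepFst v a (q, z) :=
  (hc.add (hasCompactSupport_dirDeriv_slice ha hc _)).mul_left

theorem hasCompactSupport_stepSnd {a : Q × E × E → ℂ} (ha : ContDiff ℝ ∞ a) {q : Q}
    (hc : HasCompactSupport fun z => a (q, z)) (v : E) :
    HasCompactSupport fun z => stepSnd v a (q, z) :=
  (hc.add (hasCompactSupport_dirDeriv_slice ha hc _)).mul_left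

theorem integral_phase_step {F : E × E → ℂ} (hF : ContDiff ℝ ∞ F) (hc : HasCompactSupport F)
    (v : E × E) : ∫ z, phase z * (F z + dirDeriv v F z) =
      ∫ z, phase z * ((1 + Complex.I * (pairing v.1 z.2 + pairing z.1 v.2 : ℝ)) * F z) := by
  have hp : Continuous fun z : E × E => Complex.I * (pairing v.1 z.2 + pairing z.1 v.2 : ℝ) := by
    have := (pairing : E →L[ℝ] E →L[ℝ] ℝ).continuous
    exact continuous_const.mul (Complex.continuous_ofReal.comp (by fun_prop))
  have h1 : Integrable fun z => phase z * F z :=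
    (continuous_phase.mul hF.continuous).integrable_of_hasCompactSupport hc.mul_left
  have h2 : Integrable fun z => phase z * dirDeriv v F z :=
    (continuous_phase.mul (ContDiff.dirDeriv hF v).continuous).integrable_of_hasCompactSupport
      (hc.fderiv_apply ℝ v).mul_left
  have h3 : Integrable fun z => phase z *
      (Complex.I * (pairing v.1 z.2 + pairing z.1 v.2 : ℝ) * F z) :=
    (continuous_phase.mul (hp.mul hF.continuous)).integrable_of_hasCompactSupport hc.mul_left.mul_left
  simp only [mul_add, add_mul, one_mul]
  rw [integral_add h1 h2, integral_phase_mul_dirDeriv hF hc, ← integral_add h1 h3]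

/-- For `F = coef v Θ · a` the sum `F + ∂_v F` is the step, because the multiplier is constant in
`W`. Integration by parts replaces this sum by `(1 + i⟨v, Θ⟩) F`, which is `a`. -/
theorem integral_phase_stepFst {a : Q × E × E → ℂ} (ha : ContDiff ℝ ∞ a) {q : Q}
    (hc : HasCompactSupport fun z => a (q, z)) (v : E) :
    ∫ z, phase z * stepFst v a (q, z) = ∫ z, phase z * a (q, z) := by
  have hb : ContDiff ℝ ∞ fun h : Q × E × E => coef v h.2.2 * a h := (contDiff_coef_snd v).mul ha
  have hF := hb.comp (contDiff_const.prodMk contDiff_id : ContDiff ℝ ∞ fun z : E × E => (q, z))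
  have h := integral_phase_step hF hc.mul_left (v, 0)
  have hd : ∀ {b : Q × E × E → ℂ}, ContDiff ℝ ∞ b → Differentiable ℝ b := fun hb =>
    hb.differentiable (by simp)
  have hs : ∀ z, dirDeriv (v, 0) (fun z => coef v z.2 * a (q, z)) z =
      coef v z.2 * dirDeriv (0, v, 0) a (q, z) := fun z => by
    refine (dirDeriv_slice_snd (hd hb) q (v, 0) z).trans ?_
    rw [dirDeriv_mul (hd (contDiff_coef_snd v)) (hd ha), dirDeriv_coef_snd]; simp
  refine (integral_congr_ae (Eventually.of_forall fun z => ?_)).trans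
    (h.trans (integral_congr_ae (Eventually.of_forall fun z => ?_)))
  · have := hs z
    simp only [Function.comp_def, stepFst] at this ⊢
    rw [this]; ring
  · have := mul_coef v z.2
    simp only [Function.comp_def, map_zero, add_zero] at this ⊢
    rw [← mul_assoc _ (coef v z.2), this, one_mul]

theorem integral_phase_stepSnd {a : Q × E × E → ℂ} (ha : ContDiff ℝ ∞ a) {q : Q}
    (hc : HasCompactSupport fun z => a (q, z)) (v : E) :
    ∫ z, phase z * stepSnd v a (q, z) = ∫ z, phase z * a (q, z) := by
  have hb : ContDiff ℝ ∞ fun h : Q × E × E => coef v h.2.1 * a h := (contDiff_coef_fst v).mul ha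
  have hF := hb.comp (contDiff_const.prodMk contDiff_id : ContDiff ℝ ∞ fun z : E × E => (q, z))
  have h := integral_phase_step hF hc.mul_left (0, v)
  have hd : ∀ {b : Q × E × E → ℂ}, ContDiff ℝ ∞ b → Differentiable ℝ b := fun hb =>
    hb.differentiable (by simp)
  have hs : ∀ z, dirDeriv (0, v) (fun z => coef v z.1 * a (q, z)) z =
      coef v z.1 * dirDeriv (0, 0, v) a (q, z) := fun z => by
    refine (dirDeriv_slice_snd (hd hb) q (0, v) z).trans ?_
    rw [dirDeriv_mul (hd (contDiff_coef_fst v)) (hd ha), dirDeriv_coef_fst]; simp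
  refine (integral_congr_ae (Eventually.of_forall fun z => ?_)).trans
    (h.trans (integral_congr_ae (Eventually.of_forall fun z => ?_)))
  · have := hs z
    simp only [Function.comp_def, stepSnd] at this ⊢
    rw [this]; ring
  · have := mul_coef v z.1
    simp only [Function.comp_def, map_zero, zero_add, _root_.zero_apply] at this ⊢
    rw [PairedSpace.symm z.1 v, ← mul_assoc _ (coef v z.1), this, one_mul]

theorem integral_phase_stepsFst {a : Q × E × E → ℂ} (ha : ContDiff ℝ ∞ a) {q : Q}
    (hc : HasCompactSupport fun z => a (q, z)) (l : List E) :
    ∫ z, phase z * stepsFst l a (q, z) = ∫ z, phase z * a (q, z) := by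
  have : (HasCompactSupport fun z => stepsFst l a (q, z)) ∧
      ∫ z, phase z * stepsFst l a (q, z) = ∫ z, phase z * a (q, z) := by
    induction l with
    | nil => exact ⟨hc, rfl⟩
    | cons v l ih =>
      have hl := contDiff_stepsFst ha l
      exact ⟨hasCompactSupport_stepFst hl ih.1 v, (integral_phase_stepFst hl ih.1 v).trans ih.2⟩
  exact this.2

theorem integral_phase_stepsSnd {a : Q × E × E → ℂ} (ha : ContDiff ℝ ∞ a) {q : Q}
    (hc : HasCompactSupport fun z => a (q, z)) (l : List E) :
    (HasCompactSupport fun z => stepsSnd l a (q, z)) ∧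
      ∫ z, phase z * stepsSnd l a (q, z) = ∫ z, phase z * a (q, z) := by
  induction l generalizing a with
  | nil => exact ⟨hc, rfl⟩
  | cons v l ih =>
    have := ih (contDiff_stepSnd ha v) (hasCompactSupport_stepSnd ha hc v)
    exact ⟨this.1, this.2.trans (integral_phase_stepSnd ha hc v)⟩

/-- `c` is the value of the oscillatory integral `∫ e^{-i⟨W, Θ⟩} F(W, Θ) dW dΘ`. -/
def HasOscInt (F : E × E → ℂ) (c : ℂ) : Prop :=
  Tendsto (fun δ : ℝ => ∫ z, phase z * (cutoff (δ • z.1) * cutoff (δ • z.2) * F z)) (𝓝[>] 0) (𝓝 c)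

/-- The oscillatory integral `∫ e^{-i⟨W, Θ⟩} F(W, Θ) dW dΘ`. -/
def oscInt (F : E × E → ℂ) : ℂ :=
  limUnder (𝓝[>] 0) fun δ : ℝ => ∫ z, phase z * (cutoff (δ • z.1) * cutoff (δ • z.2) * F z)

theorem HasOscInt.oscInt_eq {F : E × E → ℂ} {c : ℂ} (h : HasOscInt F c) : oscInt F = c :=
  h.limUnder_eq

/-- The representation of oscillatory integrals by absolutely convergent integrals. -/
theorem oscInt_representation [FirstCountableTopology ι] [FiniteDimensional ℝ Q] {N M n : ℕ}
    (hn : M + (Module.finrank ℝ E + 1) ≤ n) {om : Q → ℝ} (hom : Continuous om) (hom0 : ∀ q, 0 ≤ om q)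
    {a : ι → Q × E × E → ℂ} (ha : ∀ t, ContDiff ℝ ∞ (a t)) {l : List E}
    (hS : BddFamily (N + (frames E n).length)
      (fun h => om h.1 * (wt h.2.1 ^ (Module.finrank ℝ E + 1))⁻¹ * wt h.2.2 ^ M)
      fun p : unitInterval × ι => stepsSnd l (regularize p.1 (a p.2))) :
    (∀ t q, HasOscInt (fun z => a t (q, z))
      (∫ z, phase z * stepsFst (frames E n) (stepsSnd l (a t)) (q, z))) ∧
    BddFamily N (fun h => om h.1 * decay h.2)
      fun t => stepsFst (frames E n) (stepsSnd l (a t)) := by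
  -- Here `δ` is part of the index, so the bounds are uniform down to and including `δ = 0`.
  have hR : BddFamily N (fun h => om h.1 * decay h.2) fun p : unitInterval × ι =>
      stepsFst (frames E n) (stepsSnd l (regularize p.1 (a p.2))) := by
    refine (hS.stepsFst (frames E n)).mono ?_ fun h => ?_
    · obtain ⟨C, hC0, hC⟩ := exists_stepsFst_weight_le (E := E) M hn
      refine ⟨C, hC0, fun h => ?_⟩
      have h1 : 0 ≤ om h.1 * (wt h.2.1 ^ (Module.finrank ℝ E + 1))⁻¹ :=
        mul_nonneg (hom0 _) (inv_nonneg.2 (pow_nonneg (wt_nonneg _) _))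
      calc _ = om h.1 * (wt h.2.1 ^ (Module.finrank ℝ E + 1))⁻¹ *
            (((frames E n).map fun v => coefWt v h.2.2).prod * wt h.2.2 ^ M) := by ring
        _ ≤ _ := mul_le_mul_of_nonneg_left (hC h.2.2) h1
        _ = _ := by rw [decay]; ring
    · refine mul_nonneg (List.prod_nonneg ?_) (mul_nonneg (mul_nonneg (hom0 _)
        (inv_nonneg.2 (pow_nonneg (wt_nonneg _) _))) (pow_nonneg (wt_nonneg _) _))
      simp only [List.mem_map]; rintro _ ⟨v, -, rfl⟩; exact coefWt_nonneg v _
  have hI := hR.integral_phase hom hom0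
  refine ⟨fun t q => ?_, ?_⟩
  -- Clamping `δ` to `[0, 1]` gives a continuous function on the whole line, whose value at `0` is
  -- the required limit.
  · have hcont : Continuous fun δ : ℝ => ∫ z, phase z * stepsFst (frames E n)
        (stepsSnd l (regularize (Set.projIcc (0 : ℝ) 1 zero_le_one δ : unitInterval) (a t))) (q, z) := by
      have hc : Continuous fun δ : ℝ =>
          (((Set.projIcc (0 : ℝ) 1 zero_le_one δ, t) : unitInterval × ι), q) :=
        (continuous_projIcc.prodMk continuous_const).prodMk continuous_const
      have := hI.continuous.comp hc
      simpa only [Function.comp_def] using this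
    have h0 := (hcont.tendsto 0).mono_left (nhdsWithin_le_nhds (s := Ioi (0 : ℝ)))
    simp only [Set.projIcc_left, regularize_zero] at h0
    refine h0.congr' ?_
    filter_upwards [Ioc_mem_nhdsGT (zero_lt_one (α := ℝ))] with δ hδ
    rw [Set.projIcc_of_mem zero_le_one ⟨hδ.1.le, hδ.2⟩]
    have h1 := contDiff_regularize (ha t) δ
    -- For `δ > 0` the integrand has compact support, so all integrations by parts can be undone
    -- exactly.
    have h2 := integral_phase_stepsSnd h1 (hasCompactSupport_regularize hδ.1 (a t) q) l
    exact (integral_phase_stepsFst (contDiff_stepsSnd h1 l) h2.1 _).trans h2.2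
  · have := hR.reindex (f := fun t : ι => ((0 : unitInterval), t)) (by fun_prop)
    simpa [regularize_zero] using this

end OscInt

/-! ### Amplitudes and the calculus of their oscillatory integrals. -/

section Amplitudes

variable {ι κ : Type*} [TopologicalSpace ι] [TopologicalSpace κ]
variable {Q : Type*} [NormedAddCommGroup Q] [NormedSpace ℝ Q]
variable {E : Type*} [NormedAddCommGroup E] [NormedSpace ℝ E]

/-- Iterated derivatives in the second variable of the phase. -/
def dirDerivs (l : List E) (a : Q × E × E → ℂ) : Q × E × E → ℂ :=
  l.foldl (fun b u => dirDeriv (0, 0, u) b) a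

theorem ContDiff.diff {H : Type*} [NormedAddCommGroup H] [NormedSpace ℝ H] {a : H → ℂ}
    (ha : ContDiff ℝ ∞ a) : Differentiable ℝ a := ha.differentiable (by simp)

/-- Bounds of derivatives up to order `N` that are not affected by derivatives in the second
variable of the phase. -/
def AmpBound (N : ℕ) (w : Q × E × E → ℝ) (a : ι → Q × E × E → ℂ) : Prop :=
  ∀ l : List E, BddFamily N w fun t => dirDerivs l (a t)

namespace AmpBound

variable {N : ℕ} {w w' : Q × E × E → ℝ} {a b : ι → Q × E × E → ℂ}

theorem bddFamily (h : AmpBound N w a) : BddFamily N w a := h []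

theorem mono (hw : ∃ C, 0 ≤ C ∧ ∀ x, w x ≤ C * w' x) (hw0 : ∀ x, 0 ≤ w x) (h : AmpBound N w a) :
    AmpBound N w' a := fun l => (h l).mono hw hw0

theorem reindex {f : κ → ι} (hf : Continuous f) (h : AmpBound N w a) :
    AmpBound N w fun t => a (f t) := fun l =>
  BddFamily.reindex (a := fun t => dirDerivs l (a t)) hf (h l)

theorem of_forall (h : ∀ N, BddFamily N w a) (N : ℕ) : AmpBound N w a := by
  intro l
  induction l generalizing a with
  | nil => exact h N
  | cons u l ih => exact ih fun N => (h (N + 1)).2.2 _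

theorem dirDerivs_zero (l : List E) : dirDerivs l (fun _ : Q × E × E => 0) = fun _ => 0 := by
  induction l with
  | nil => rfl
  | cons u l ih =>
    change dirDerivs l (dirDeriv _ _) = _
    rw [dirDeriv_zero, ih]

/-- A function that does not depend on the second phase variable has no further derivatives in it,
so bounds of the single order `N` are enough. This admits weights whose growth exponent depends on
`N`. -/
theorem of_indep (h : BddFamily N w a) (h0 : ∀ t u, dirDeriv (0, 0, u) (a t) = fun _ => 0) :
    AmpBound N w a := by
  intro l
  cases l with
  | nil => exact h
  | cons u l =>
    change BddFamily N w fun t => dirDerivs l (dirDeriv (0, 0, u) (a t))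
    simp only [h0, dirDerivs_zero]
    exact BddFamily.zero

theorem dirDerivs_snd (h : AmpBound N w a) (u : E) :
    AmpBound N w fun t => dirDeriv (0, 0, u) (a t) := fun l => h (u :: l)

theorem add (hac : ∀ t, ContDiff ℝ ∞ (a t)) (hbc : ∀ t, ContDiff ℝ ∞ (b t)) (ha : AmpBound N w a)
    (hb : AmpBound N w b) : AmpBound N w fun t h => a t h + b t h := by
  intro l
  induction l generalizing a b with
  | nil => exact ha.bddFamily.add hb.bddFamily
  | cons u l ih =>
    refine (ih (fun t => ContDiff.dirDeriv (hac t) _) (fun t => ContDiff.dirDeriv (hbc t) _)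
      (ha.dirDerivs_snd u) (hb.dirDerivs_snd u)).congr fun t x => ?_
    change _ = dirDerivs l (dirDeriv _ _) x
    rw [dirDeriv_add (ContDiff.diff (hac t)) (ContDiff.diff (hbc t))]

theorem mul (hac : ∀ t, ContDiff ℝ ∞ (a t)) (hbc : ∀ t, ContDiff ℝ ∞ (b t)) (ha : AmpBound N w a)
    (hb : AmpBound N w' b) : AmpBound N (fun h => w h * w' h) fun t h => a t h * b t h := by
  have hadd : ∀ (l : List E) (a b : Q × E × E → ℂ), ContDiff ℝ ∞ a → ContDiff ℝ ∞ b →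
      dirDerivs l (fun h => a h + b h) = fun h => dirDerivs l a h + dirDerivs l b h := by
    intro l
    induction l with
    | nil => exact fun _ _ _ _ => rfl
    | cons u l ih =>
      intro a b ha hb
      change dirDerivs l (dirDeriv _ _) = _
      rw [dirDeriv_add (ContDiff.diff ha) (ContDiff.diff hb),
        ih _ _ (ContDiff.dirDeriv ha _) (ContDiff.dirDeriv hb _)]
      rfl
  intro l
  induction l generalizing a b with
  | nil => exact ha.bddFamily.mul hb.bddFamily
  | cons u l ih =>
    have h1 := ih (fun t => ContDiff.dirDeriv (hac t) (0, 0, u)) hbc (ha.dirDerivs_snd u) hb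
    have h2 := ih hac (fun t => ContDiff.dirDeriv (hbc t) (0, 0, u)) ha (hb.dirDerivs_snd u)
    refine (h1.add h2).congr fun t x => ?_
    change _ = dirDerivs l (dirDeriv _ _) x
    rw [dirDeriv_mul (ContDiff.diff (hac t)) (ContDiff.diff (hbc t)), hadd]
    · exact (ContDiff.dirDeriv (hac t) _).mul (hbc t)
    · exact (hac t).mul (ContDiff.dirDeriv (hbc t) _)

theorem dirDerivs_comm {a : Q × E × E → ℂ} (ha : ContDiff ℝ ∞ a) (l : List E) (v : Q × E × E) :
    dirDerivs l (dirDeriv v a) = dirDeriv v (dirDerivs l a) := by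
  induction l generalizing a with
  | nil => rfl
  | cons u l ih =>
    change dirDerivs l (dirDeriv _ _) = dirDeriv v (dirDerivs l (dirDeriv _ _))
    rw [dirDeriv_comm (by simpa using contDiff_infty.1 ha 2), ih (ContDiff.dirDeriv ha _)]

theorem dirDeriv (hac : ∀ t, ContDiff ℝ ∞ (a t)) (ha : AmpBound (N + 1) w a) (v : Q × E × E) :
    AmpBound N w fun t => dirDeriv v (a t) := fun l =>
  ((ha l).2.2 v).congr fun t x => by rw [dirDerivs_comm (hac t)]

variable [PairedSpace E] [FiniteDimensional ℝ E]

/-- The derivative in this step is taken in the second phase variable, which `AmpBound` allows for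
free. No order is lost, in contrast to `BddFamily.stepFst`. -/
theorem stepSnd (hac : ∀ t, ContDiff ℝ ∞ (a t)) (ha : AmpBound N w a) (u : E) :
    AmpBound N (fun h => coefWt u h.2.1 * w h) fun t => stepSnd u (a t) := by
  refine mul (fun _ => contDiff_coef_fst u) (fun t => (hac t).add (ContDiff.dirDeriv (hac t) _))
    (of_indep ?_ fun t v => dirDeriv_coef_fst u 0 v) (add hac
      (fun t => ContDiff.dirDeriv (hac t) _) ha (ha.dirDerivs_snd u))
  exact (bddFamily_coef u N).comp_const
    ((ContinuousLinearMap.fst ℝ E E).comp (ContinuousLinearMap.snd ℝ Q (E × E)))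
    ⟨1, zero_le_one, fun _ => (one_mul _).ge⟩ (coefWt_nonneg u)

theorem stepsSnd (hac : ∀ t, ContDiff ℝ ∞ (a t)) (ha : AmpBound N w a) (l : List E) :
    AmpBound N (fun h => (l.map fun u => coefWt u h.2.1).prod * w h) fun t => stepsSnd l (a t) := by
  induction l generalizing a w with
  | nil => simpa [MagneticWeyl.stepsSnd] using ha
  | cons u l ih =>
    have := ih (fun t => contDiff_stepSnd (hac t) u) (ha.stepSnd hac u)
    simp only [List.map_cons, List.prod_cons]
    have e : (fun h : Q × E × E => coefWt u h.2.1 * (l.map fun u => coefWt u h.2.1).prod * w h) =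
        fun h => (l.map fun u => coefWt u h.2.1).prod * (coefWt u h.2.1 * w h) :=
      funext fun h => by ring
    rw [e]
    exact this

end AmpBound

/-- Amplitudes of polynomial growth, for which oscillatory integrals exist. -/
structure Amp (om : Q → ℝ) (M : ℕ) (a : ι → Q × E × E → ℂ) : Prop where
  smooth : ∀ t, ContDiff ℝ ∞ (a t)
  bound : ∀ N, ∃ k : ℕ, AmpBound N (fun h => om h.1 * wt h.2.1 ^ k * wt h.2.2 ^ M) a

theorem coefWt_le_one [PairedSpace E] (v x : E) : coefWt v x ≤ 1 :=
  inv_le_one_of_one_le₀ (by simp)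

theorem prod_coefWt_mem [PairedSpace E] (l : List E) (x : E) :
    0 ≤ (l.map fun v => coefWt v x).prod ∧ (l.map fun v => coefWt v x).prod ≤ 1 := by
  induction l with
  | nil => simp
  | cons v l ih =>
    simp only [List.map_cons, List.prod_cons]
    exact ⟨mul_nonneg (coefWt_nonneg v x) ih.1, mul_le_one₀ (coefWt_le_one v x) ih.1 ih.2⟩

namespace Amp

variable {om : Q → ℝ} {M : ℕ} {a b : ι → Q × E × E → ℂ}

theorem weight_nonneg (hom : ∀ q, 0 ≤ om q) (k M : ℕ) (h : Q × E × E) :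
    0 ≤ om h.1 * wt h.2.1 ^ k * wt h.2.2 ^ M :=
  mul_nonneg (mul_nonneg (hom _) (pow_nonneg (wt_nonneg _) _)) (pow_nonneg (wt_nonneg _) _)

theorem weight_mono (hom : ∀ q, 0 ≤ om q) {k l M M' : ℕ} (hk : k ≤ l) (hM : M ≤ M')
    (h : Q × E × E) :
    om h.1 * wt h.2.1 ^ k * wt h.2.2 ^ M ≤ om h.1 * wt h.2.1 ^ l * wt h.2.2 ^ M' := by
  have h1 := pow_le_pow_right₀ (one_le_wt h.2.1) hk
  have h2 := pow_le_pow_right₀ (one_le_wt h.2.2) hM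
  exact mul_le_mul (mul_le_mul_of_nonneg_left h1 (hom _)) h2 (pow_nonneg (wt_nonneg _) _)
    (mul_nonneg (hom _) (pow_nonneg (wt_nonneg _) _))

theorem add (hom : ∀ q, 0 ≤ om q) (ha : Amp om M a) (hb : Amp om M b) :
    Amp om M fun t h => a t h + b t h := by
  refine ⟨fun t => (ha.smooth t).add (hb.smooth t), fun N => ?_⟩
  obtain ⟨k, hk⟩ := ha.bound N
  obtain ⟨l, hl⟩ := hb.bound N
  refine ⟨k + l, AmpBound.add ha.smooth hb.smooth (hk.mono ?_ (weight_nonneg hom k M))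
    (hl.mono ?_ (weight_nonneg hom l M))⟩
  · exact ⟨1, zero_le_one, fun h => by simpa using weight_mono hom (by omega) le_rfl h⟩
  · exact ⟨1, zero_le_one, fun h => by simpa using weight_mono hom (by omega) le_rfl h⟩

theorem dirDeriv (ha : Amp om M a) (v : Q × E × E) : Amp om M fun t => dirDeriv v (a t) :=
  ⟨fun t => ContDiff.dirDeriv (ha.smooth t) v, fun N => let ⟨k, hk⟩ := ha.bound (N + 1)
    ⟨k, hk.dirDeriv ha.smooth v⟩⟩

variable [PairedSpace E] [FiniteDimensional ℝ E]

theorem stepSnd (hom : ∀ q, 0 ≤ om q) (ha : Amp om M a) (u : E) :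
    Amp om M fun t => stepSnd u (a t) := by
  refine ⟨fun t => contDiff_stepSnd (ha.smooth t) u, fun N => ?_⟩
  obtain ⟨k, hk⟩ := ha.bound N
  refine ⟨k, (hk.stepSnd ha.smooth u).mono ⟨1, zero_le_one, fun h => ?_⟩ fun h =>
    mul_nonneg (coefWt_nonneg _ _) (weight_nonneg hom k M h)⟩
  rw [one_mul]
  exact mul_le_of_le_one_left (weight_nonneg hom k M h) (coefWt_le_one _ _)

theorem pairing_mul (hom : ∀ q, 0 ≤ om q) (ha : Amp om M a) (u : E) :
    Amp om M fun t h => (pairing u h.2.1 : ℝ) * a t h := by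
  let A : Q × E × E →L[ℝ] ℝ := (pairing u).comp
    ((ContinuousLinearMap.fst ℝ E E).comp (ContinuousLinearMap.snd ℝ Q (E × E)))
  have hs : ContDiff ℝ ∞ fun h : Q × E × E => ((A h : ℝ) : ℂ) :=
    Complex.ofRealCLM.contDiff.comp A.contDiff
  have hd : ∀ v : Q × E × E, MagneticWeyl.dirDeriv v (fun h => ((A h : ℝ) : ℂ)) =
      fun _ => (A v : ℂ) := fun v => by
    ext h
    exact congrArg (fun L : Q × E × E →L[ℝ] ℂ => L v)
      ((Complex.ofRealCLM.comp A).hasFDerivAt (x := h)).fderiv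
  have hb : ∀ N, BddFamily N (fun h : Q × E × E => wt h.2.1) fun (_ : ι) h => ((A h : ℝ) : ℂ) := by
    have h0 : BddFamily 0 (fun h : Q × E × E => wt h.2.1) fun (_ : ι) h => ((A h : ℝ) : ℂ) := by
      refine ⟨⟨‖(pairing u : E →L[ℝ] ℝ)‖, fun _ h => ?_⟩, hs.continuous.comp continuous_snd⟩
      rw [Complex.norm_real]
      refine ((pairing u).le_opNorm _).trans (mul_le_mul_of_nonneg_left ?_ (norm_nonneg _))
      simp [wt]
    intro N
    cases N with
    | zero => exact h0
    | succ N =>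
      refine ⟨h0, fun _ => ContDiff.diff hs, fun v => ?_⟩
      simp only [hd]
      exact (BddFamily.const continuous_const ⟨_, fun _ => le_rfl⟩).mono'
        (fun h => one_le_wt _) fun _ => zero_le_one
  refine ⟨fun t => hs.mul (ha.smooth t), fun N => ?_⟩
  obtain ⟨k, hk⟩ := ha.bound N
  refine ⟨k + 1, ((AmpBound.of_indep (hb N) fun _ v => ?_).mul (fun _ => hs) ha.smooth hk).mono
    ⟨1, zero_le_one, fun h => le_of_eq ?_⟩ fun h =>
      mul_nonneg (wt_nonneg _) (weight_nonneg hom k M h)⟩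
  · rw [hd]; ext h; simp [A]
  · ring

theorem bddFamily_cutoffs (N : ℕ) : BddFamily N (fun _ => 1)
    fun (δ : unitInterval) (h : Q × E × E) =>
      cutoff ((δ : ℝ) • h.2.1) * cutoff ((δ : ℝ) • h.2.2) := by
  have hc := bddFamily_of_hasCompactSupport (ι := unitInterval) (contDiff_cutoff (E := E))
    hasCompactSupport_cutoff N
  simpa using (bddFamily_dilation
    ((ContinuousLinearMap.fst ℝ E E).comp (ContinuousLinearMap.snd ℝ Q (E × E))) hc).mul
    (bddFamily_dilation
      ((ContinuousLinearMap.snd ℝ E E).comp (ContinuousLinearMap.snd ℝ Q (E × E))) hc)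

theorem regularize (hom : ∀ q, 0 ≤ om q) (ha : Amp om M a) :
    Amp om M fun p : unitInterval × ι => regularize p.1 (a p.2) := by
  refine ⟨fun p => contDiff_regularize (ha.smooth _) _, fun N => ?_⟩
  obtain ⟨k, hk⟩ := ha.bound N
  refine ⟨k, ((AmpBound.of_forall (fun N => (bddFamily_cutoffs (Q := Q) (E := E) N).reindex
    (f := fun p : unitInterval × ι => p.1) continuous_fst) N).mul (fun p => ?_)
    (fun p => ha.smooth p.2) (AmpBound.reindex (a := a) (f := fun p : unitInterval × ι => p.2)
      continuous_snd hk)).mono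
    ⟨1, zero_le_one, fun h => le_of_eq (by ring)⟩ fun h => ?_⟩
  · exact (contDiff_cutoff.comp (contDiff_const.smul (contDiff_fst.comp contDiff_snd))).mul
      (contDiff_cutoff.comp (contDiff_const.smul (contDiff_snd.comp contDiff_snd)))
  · rw [one_mul]; exact weight_nonneg hom k M h

/-- The growth exponent `k` is fixed by `N` alone, and only then is the number `n` of rounds chosen.
Without `AmpBound` this would be circular: more rounds would need more derivatives, hence possibly a
larger `k`, hence more rounds. -/
theorem exists_stepsSnd (hom : ∀ q, 0 ≤ om q) (ha : Amp om M a) (pre : List E) (N : ℕ) :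
    ∃ n₀, ∀ n ≥ n₀, BddFamily N
      (fun h => om h.1 * (wt h.2.1 ^ (Module.finrank ℝ E + 1))⁻¹ * wt h.2.2 ^ M)
      fun t => stepsSnd (pre ++ frames E n) (a t) := by
  obtain ⟨k, hk⟩ := ha.bound N
  refine ⟨k + (Module.finrank ℝ E + 1), fun n hn => ?_⟩
  obtain ⟨C, hC0, hC⟩ := exists_stepsFst_weight_le (E := E) k hn
  refine (hk.stepsSnd ha.smooth (pre ++ frames E n)).bddFamily.mono ⟨C, hC0, fun h => ?_⟩
    fun h => mul_nonneg (prod_coefWt_mem _ _).1 (weight_nonneg hom k M h)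
  rw [List.map_append, List.prod_append]
  have h1 := prod_coefWt_mem pre h.2.1
  have h2 := prod_coefWt_mem (frames E n) h.2.1
  have h3 : 0 ≤ om h.1 * wt h.2.2 ^ M := mul_nonneg (hom _) (pow_nonneg (wt_nonneg _) _)
  have h4 : 0 ≤ ((frames E n).map fun u => coefWt u h.2.1).prod * wt h.2.1 ^ k :=
    mul_nonneg h2.1 (pow_nonneg (wt_nonneg _) _)
  calc _ = (pre.map fun u => coefWt u h.2.1).prod *
        (((frames E n).map fun u => coefWt u h.2.1).prod * wt h.2.1 ^ k) *
        (om h.1 * wt h.2.2 ^ M) := by ring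
    _ ≤ 1 * (C * (wt h.2.1 ^ (Module.finrank ℝ E + 1))⁻¹) * (om h.1 * wt h.2.2 ^ M) :=
        mul_le_mul_of_nonneg_right (mul_le_mul h1.2 (hC _) h4 zero_le_one) h3
    _ = _ := by ring

variable [MeasureSpace E] [BorelSpace E] [(volume : Measure E).IsAddHaarMeasure]
variable [FirstCountableTopology ι] [FiniteDimensional ℝ Q]

/-- All large `n` are allowed, so that two amplitudes can be represented by the same list of steps.
The prefix `pre` leaves room for an extra first step. -/
theorem exists_representation (homc : Continuous om) (hom : ∀ q, 0 ≤ om q) (ha : Amp om M a)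
    (pre : List E) (N : ℕ) : ∃ n₀, ∀ n ≥ n₀,
    (∀ t q, HasOscInt (fun z => a t (q, z))
      (∫ z, phase z * stepsFst (frames E (M + (Module.finrank ℝ E + 1)))
        (stepsSnd (pre ++ frames E n) (a t)) (q, z))) ∧
    BddFamily N (fun h => om h.1 * decay h.2) fun t =>
      stepsFst (frames E (M + (Module.finrank ℝ E + 1))) (stepsSnd (pre ++ frames E n) (a t)) := by
  obtain ⟨n₀, h⟩ := (ha.regularize hom).exists_stepsSnd hom pre
    (N + (frames E (M + (Module.finrank ℝ E + 1))).length)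
  exact ⟨n₀, fun n hn => oscInt_representation le_rfl homc hom ha.smooth (h n hn)⟩

theorem hasOscInt (homc : Continuous om) (hom : ∀ q, 0 ≤ om q) (ha : Amp om M a) (t : ι) (q : Q) :
    HasOscInt (fun z => a t (q, z)) (oscInt fun z => a t (q, z)) := by
  obtain ⟨n, h⟩ := ha.exists_representation homc hom [] 0
  have := (h n le_rfl).1 t q
  exact this.oscInt_eq.symm ▸ this

theorem bddFamily_oscInt (homc : Continuous om) (hom : ∀ q, 0 ≤ om q) (ha : Amp om M a) (N : ℕ) :
    BddFamily N om fun t q => oscInt fun z => a t (q, z) := by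
  obtain ⟨n, h⟩ := ha.exists_representation homc hom [] N
  obtain ⟨h1, h2⟩ := h n le_rfl
  exact (h2.integral_phase homc hom).congr fun t q => (h1 t q).oscInt_eq.symm

/-- The amplitude and its parameter derivative are represented with the same steps. These commute
with parameter derivatives, so one only differentiates an absolutely convergent integral. -/
theorem dirDeriv_oscInt (homc : Continuous om) (hom : ∀ q, 0 ≤ om q) (ha : Amp om M a) (t : ι)
    (v : Q) : MagneticWeyl.dirDeriv v (fun q => oscInt fun z => a t (q, z)) =
      fun q => oscInt fun z => MagneticWeyl.dirDeriv (v, 0) (a t) (q, z) := by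
  obtain ⟨n₁, h₁⟩ := ha.exists_representation homc hom [] 1
  obtain ⟨n₂, h₂⟩ := (ha.dirDeriv (v, 0)).exists_representation homc hom [] 1
  obtain ⟨h1, h2⟩ := h₁ (max n₁ n₂) (le_max_left _ _)
  obtain ⟨h3, -⟩ := h₂ (max n₁ n₂) (le_max_right _ _)
  simp only [(h1 t _).oscInt_eq, (h3 t _).oscInt_eq]
  rw [h2.dirDeriv_integral_phase homc hom t v]
  have e : ((v, 0) : Q × E × E) = (v, 0, 0) := rfl
  rw [e, dirDeriv_stepsFst (contDiff_stepsSnd (ha.smooth t) _), dirDeriv_stepsSnd (ha.smooth t)]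

theorem oscInt_add (homc : Continuous om) (hom : ∀ q, 0 ≤ om q) (ha : Amp om M a)
    (hb : Amp om M b) (t : ι) (q : Q) : oscInt (fun z => a t (q, z) + b t (q, z)) =
      oscInt (fun z => a t (q, z)) + oscInt fun z => b t (q, z) := by
  obtain ⟨n₁, h₁⟩ := ha.exists_representation homc hom [] 0
  refine HasOscInt.oscInt_eq (((ha.hasOscInt homc hom t q).add (hb.hasOscInt homc hom t q)).congr' ?_)
  filter_upwards [self_mem_nhdsWithin] with δ hδ
  have hi : ∀ {a : ι → Q × E × E → ℂ}, Amp om M a → Integrable fun z =>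
      phase z * (cutoff (δ • z.1) * cutoff (δ • z.2) * a t (q, z)) := fun {a} ha =>
    (continuous_phase.mul ((contDiff_regularize (ha.smooth t) δ).continuous.comp
      (continuous_const.prodMk continuous_id))).integrable_of_hasCompactSupport
      (hasCompactSupport_regularize hδ (a t) q).mul_left
  rw [← integral_add (hi ha) (hi hb)]
  refine integral_congr_ae (Eventually.of_forall fun z => ?_)
  simp only; ring

/-- A step followed by `n` rounds is the list `[u] ++ frames E n` applied to the original amplitude.
Both sides are therefore represented by the same absolutely convergent integral. -/
theorem oscInt_stepSnd (homc : Continuous om) (hom : ∀ q, 0 ≤ om q) (ha : Amp om M a) (u : E)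
    (t : ι) (q : Q) : oscInt (fun z => MagneticWeyl.stepSnd u (a t) (q, z)) =
      oscInt fun z => a t (q, z) := by
  obtain ⟨n₁, h₁⟩ := ha.exists_representation homc hom [u] 0
  obtain ⟨n₂, h₂⟩ := (ha.stepSnd hom u).exists_representation homc hom [] 0
  have h1 := (h₁ (max n₁ n₂) (le_max_left _ _)).1 t q
  have h3 := (h₂ (max n₁ n₂) (le_max_right _ _)).1 t q
  exact h3.oscInt_eq.trans h1.oscInt_eq.symm

end Amp

theorem HasOscInt.const_mul [PairedSpace E] [FiniteDimensional ℝ E] [MeasureSpace E]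
    {F : E × E → ℂ} {c : ℂ} (h : HasOscInt F c) (r : ℂ) : HasOscInt (fun z => r * F z) (r * c) := by
  refine (Tendsto.const_mul r h).congr fun δ => ?_
  rw [← integral_const_mul]
  refine integral_congr_ae (Eventually.of_forall fun z => ?_)
  simp only; ring

namespace Amp

variable {om : Q → ℝ} {M : ℕ} {a b : ι → Q × E × E → ℂ}
variable [PairedSpace E] [FiniteDimensional ℝ E]
variable [MeasureSpace E] [BorelSpace E] [(volume : Measure E).IsAddHaarMeasure]
variable [FirstCountableTopology ι] [FiniteDimensional ℝ Q]

theorem const_mul (ha : Amp om M a) (r : ℂ) : Amp om M fun t h => r * a t h := by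
  refine ⟨fun t => contDiff_const.mul (ha.smooth t), fun N => ?_⟩
  obtain ⟨k, hk⟩ := ha.bound N
  refine ⟨k, ?_⟩
  have := (AmpBound.of_forall (fun N => BddFamily.const (ι := ι) (H := Q × E × E)
    (c := fun _ => r) continuous_const ⟨‖r‖, fun _ => le_rfl⟩) N).mul (fun _ => contDiff_const)
    ha.smooth hk
  simpa only [one_mul] using this

theorem oscInt_const_mul (homc : Continuous om) (hom : ∀ q, 0 ≤ om q) (ha : Amp om M a) (r : ℂ)
    (t : ι) (q : Q) : oscInt (fun z => r * a t (q, z)) = r * oscInt fun z => a t (q, z) :=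
  ((ha.hasOscInt homc hom t q).const_mul r).oscInt_eq

/-- Integration by parts: a factor `W_u` becomes a derivative in `Θ`. -/
theorem oscInt_pairing_mul (homc : Continuous om) (hom : ∀ q, 0 ≤ om q) (ha : Amp om M a) (u : E)
    (t : ι) (q : Q) : oscInt (fun z => (pairing u z.1 : ℝ) * a t (q, z)) =
      -Complex.I * oscInt fun z => MagneticWeyl.dirDeriv (0, 0, u) (a t) (q, z) := by
  have hp := ha.pairing_mul hom u
  have hip := hp.const_mul Complex.I
  have hd := ha.dirDeriv (0, 0, u)
  have hs := ha.add hom hip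
  have h1 := hs.oscInt_stepSnd homc hom u t q
  -- On `(1 + i⟨u, W⟩) a` the multiplier cancels and the step yields `a + ∂_Θ a`. Since a step does
  -- not change the integral, comparing the two sums shows that `i⟨u, W⟩ a` and `∂_Θ a` have the
  -- same integral.
  have h2 : ∀ z, MagneticWeyl.stepSnd u (fun h : Q × E × E => a t h + Complex.I *
      ((pairing u h.2.1 : ℝ) * a t h)) (q, z) =
      a t (q, z) + MagneticWeyl.dirDeriv (0, 0, u) (a t) (q, z) := by
    intro z
    have hc := mul_coef u z.1
    have hp' : ContDiff ℝ ∞ fun h : Q × E × E => (1 + Complex.I * ((pairing u h.2.1 : ℝ) : ℂ)) := by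
      refine contDiff_const.add (contDiff_const.mul (Complex.ofRealCLM.contDiff.comp ?_))
      exact (pairing u : E →L[ℝ] ℝ).contDiff.comp (contDiff_fst.comp contDiff_snd)
    have h0 : MagneticWeyl.dirDeriv (0, 0, u)
        (fun h : Q × E × E => (1 + Complex.I * ((pairing u h.2.1 : ℝ) : ℂ))) = fun _ => 0 := by
      ext h
      let A : Q × E × E →L[ℝ] ℝ := (pairing u).comp
        ((ContinuousLinearMap.fst ℝ E E).comp (ContinuousLinearMap.snd ℝ Q (E × E)))
      refine (congrArg (fun L : Q × E × E →L[ℝ] ℂ => L (0, 0, u)) ((((Complex.ofRealCLM.comp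
        A).hasFDerivAt (x := h)).const_mul Complex.I).const_add 1).fderiv).trans ?_
      simp [A]
    have e : (fun h : Q × E × E => a t h + Complex.I * ((pairing u h.2.1 : ℝ) * a t h)) =
        fun h => (1 + Complex.I * ((pairing u h.2.1 : ℝ) : ℂ)) * a t h := by
      ext h; ring
    rw [e, MagneticWeyl.stepSnd, dirDeriv_mul (ContDiff.diff hp') (ContDiff.diff (ha.smooth t)), h0]
    simp only [zero_mul, zero_add]
    rw [← mul_add, ← mul_assoc, mul_comm (coef _ _), hc, one_mul]
  simp only [h2] at h1
  rw [oscInt_add homc hom ha hd, oscInt_add homc hom ha hip,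
    oscInt_const_mul homc hom hp, add_right_inj] at h1
  rw [h1, ← mul_assoc]; simp

end Amp

theorem norm_cutoff_le [FiniteDimensional ℝ E] (x : E) : ‖(cutoff x : ℂ)‖ ≤ 1 := by
  rw [cutoff, Complex.norm_real, Real.norm_of_nonneg (ContDiffBump.nonneg _)]
  exact ContDiffBump.le_one _

/-- Dominated convergence, as the cut-offs are bounded by `1` and tend to `1`. This is the passage
from oscillatory to ordinary integrals. -/
theorem HasOscInt.of_integrable [PairedSpace E] [FiniteDimensional ℝ E] [MeasureSpace E]
    [BorelSpace E] {F : E × E → ℂ} (hi : Integrable F) :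
    HasOscInt F (∫ z, phase z * F z) := by
  have hcut : Continuous (cutoff : E → ℂ) := contDiff_cutoff.continuous
  refine tendsto_integral_filter_of_dominated_convergence (fun z => ‖F z‖) ?_ ?_ hi.norm ?_
  · refine Eventually.of_forall fun δ => continuous_phase.aestronglyMeasurable.mul
      (Continuous.aestronglyMeasurable ?_ |>.mul hi.1)
    fun_prop
  · refine Eventually.of_forall fun δ => Eventually.of_forall fun z => ?_
    rw [norm_mul, norm_phase, one_mul, norm_mul, norm_mul]
    exact mul_le_of_le_one_left (norm_nonneg _)
      (mul_le_one₀ (norm_cutoff_le _) (norm_nonneg _) (norm_cutoff_le _))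
  · refine Eventually.of_forall fun z => ?_
    have h : Continuous fun δ : ℝ => phase z * (cutoff (δ • z.1) * cutoff (δ • z.2) * F z) := by
      fun_prop
    simpa [cutoff_zero] using (h.tendsto 0).mono_left (nhdsWithin_le_nhds (s := Ioi (0 : ℝ)))

end Amplitudes

/-! ### Symbol families -/

section Bracket

variable {d : ℕ}

theorem one_le_bracket (ξ : Space d) : 1 ≤ bracket ξ :=
  Real.one_le_sqrt.2 (by nlinarith [sq_nonneg ‖ξ‖])

theorem bracket_pos (ξ : Space d) : 0 < bracket ξ := by linarith [one_le_bracket ξ]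

theorem continuous_bracket : Continuous (bracket : Space d → ℝ) := by
  unfold bracket; fun_prop

theorem bracket_le_wt (ξ : Space d) : bracket ξ ≤ wt ξ :=
  Real.sqrt_le_iff.2 ⟨wt_nonneg ξ, by simp only [wt]; nlinarith [norm_nonneg ξ]⟩

theorem wt_le_bracket (ξ : Space d) : wt ξ ≤ 2 * bracket ξ := by
  have h : ‖ξ‖ ≤ bracket ξ := Real.le_sqrt_of_sq_le (by linarith)
  simp only [wt]; linarith [one_le_bracket ξ]

theorem bracket_add_le (ξ η : Space d) : bracket (ξ + η) ≤ 2 * wt η * bracket ξ :=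
  calc bracket (ξ + η) ≤ wt (ξ + η) := bracket_le_wt _
    _ ≤ wt ξ * wt η := wt_add_le _ _
    _ ≤ 2 * bracket ξ * wt η := mul_le_mul_of_nonneg_right (wt_le_bracket ξ) (wt_nonneg η)
    _ = _ := by ring

/-- Peetre's inequality. For negative `m` the roles are exchanged by writing `ξ = (ξ + η) - η`; the
exponent is rounded up so that it can serve as the natural number `M` of an amplitude. -/
theorem bracket_add_rpow_le (m : ℝ) : ∃ C, 0 ≤ C ∧ ∀ ξ η : Space d,
    bracket (ξ + η) ^ m ≤ C * (bracket ξ ^ m * wt η ^ ⌈|m|⌉₊) := by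
  refine ⟨2 ^ ⌈|m|⌉₊, by positivity, fun ξ η => ?_⟩
  have h1 := bracket_pos ξ
  have h2 := bracket_pos (ξ + η)
  have hw : 1 ≤ 2 * wt η := by linarith [one_le_wt η]
  have key : bracket (ξ + η) ^ m ≤ (2 * wt η) ^ |m| * bracket ξ ^ m := by
    rcases le_total 0 m with hm | hm
    · rw [abs_of_nonneg hm, ← Real.mul_rpow (by linarith) h1.le]
      exact Real.rpow_le_rpow h2.le (bracket_add_le ξ η) hm
    · have h3 : bracket ξ ≤ 2 * wt η * bracket (ξ + η) := by
        simpa [wt_neg] using bracket_add_le (ξ + η) (-η)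
      have h4 := Real.rpow_le_rpow_of_nonpos h1 h3 hm
      rw [Real.mul_rpow (by linarith) h2.le] at h4
      rw [abs_of_nonpos hm, Real.rpow_neg (by linarith)]
      have h5 : 0 < (2 * wt η) ^ m := Real.rpow_pos_of_pos (by linarith) m
      rw [← div_eq_inv_mul, le_div_iff₀ h5, mul_comm]
      exact h4
  refine key.trans ?_
  have h6 : (2 * wt η) ^ |m| ≤ (2 * wt η) ^ ⌈|m|⌉₊ := by
    rw [← Real.rpow_natCast]
    exact Real.rpow_le_rpow_of_exponent_le hw (Nat.le_ceil _)
  calc _ ≤ (2 * wt η) ^ ⌈|m|⌉₊ * bracket ξ ^ m :=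
        mul_le_mul_of_nonneg_right h6 (Real.rpow_nonneg h1.le m)
    _ = _ := by rw [mul_pow]; ring

/-- The weight `⟨ξ⟩^m` on phase space. -/
def symWt (m : ℝ) (X : Phase d) : ℝ := bracket X.2 ^ m

theorem symWt_pos (m : ℝ) (X : Phase d) : 0 < symWt m X := Real.rpow_pos_of_pos (bracket_pos _) m

theorem symWt_nonneg (m : ℝ) (X : Phase d) : 0 ≤ symWt m X := (symWt_pos m X).le

theorem continuous_symWt (m : ℝ) : Continuous (symWt m : Phase d → ℝ) :=
  (continuous_bracket.comp continuous_snd).rpow_const fun X => Or.inl (bracket_pos X.2).ne'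

theorem symWt_mono {m m' : ℝ} (h : m ≤ m') (X : Phase d) : symWt m X ≤ symWt m' X :=
  Real.rpow_le_rpow_of_exponent_le (one_le_bracket _) h

theorem symWt_mul (m m' : ℝ) (X : Phase d) : symWt m X * symWt m' X = symWt (m + m') X :=
  (Real.rpow_add (bracket_pos _) m m').symm

end Bracket

/-! ### Families bounded in Hörmander classes. -/

section SymFamily

variable {ι κ : Type*} [TopologicalSpace ι] [TopologicalSpace κ] {d : ℕ}

/-- The `l`-th position direction. -/
def posDir (l : Fin d) : Phase d := (basisVec l, 0)

/-- The `l`-th momentum direction. -/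
def momDir (l : Fin d) : Phase d := (0, basisVec l)

theorem space_eq_sum (x : Space d) : x = ∑ l, x l • basisVec l := by
  ext j; simp [Finset.sum_apply, Pi.single_apply]

theorem dirDeriv_phase (v : Phase d) (f : Phase d → ℂ) (X : Phase d) : dirDeriv v f X =
    ∑ l, (v.1 l : ℂ) * dirDeriv (posDir l) f X + ∑ l, (v.2 l : ℂ) * dirDeriv (momDir l) f X := by
  have h : v = ∑ l, v.1 l • posDir l + ∑ l, v.2 l • momDir l := by
    refine Prod.ext ?_ ?_
    · simp only [posDir, momDir, Prod.fst_add, Prod.fst_sum, Prod.smul_fst, smul_zero,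
        Finset.sum_const_zero, add_zero]
      exact space_eq_sum v.1
    · simp only [posDir, momDir, Prod.snd_add, Prod.snd_sum, Prod.smul_snd, smul_zero,
        Finset.sum_const_zero, zero_add]
      exact space_eq_sum v.2
  rw [← dirDeriv_sum_direction, ← dirDeriv_sum_direction]
  conv_lhs => rw [h]
  exact (fderiv ℝ f X).map_add _ _

/-- Families that are bounded in the symbol class `S^m_ρ`, up to `N` derivatives. -/
def SymFamily (ρ : ℝ) : ℕ → ℝ → (ι → Phase d → ℂ) → Prop
  | 0, m, f => BddFamily 0 (symWt m) f
  | N + 1, m, f => BddFamily 0 (symWt m) f ∧ (∀ t, Differentiable ℝ (f t)) ∧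
      ∀ l, SymFamily ρ N m (fun t => dirDeriv (posDir l) (f t)) ∧
        SymFamily ρ N (m - ρ) (fun t => dirDeriv (momDir l) (f t))

namespace SymFamily

variable {ρ m m' : ℝ} {N : ℕ} {f g : ι → Phase d → ℂ}

theorem zero_order (h : SymFamily ρ N m f) : BddFamily 0 (symWt m) f := by
  cases N with
  | zero => exact h
  | succ N => exact h.1

theorem mono (hm : m ≤ m') (h : SymFamily ρ N m f) : SymFamily ρ N m' f := by
  induction N generalizing m m' f with
  | zero => exact BddFamily.mono' (symWt_mono hm) (symWt_nonneg m) h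
  | succ N ih =>
    exact ⟨h.1.mono' (symWt_mono hm) (symWt_nonneg m), h.2.1, fun l =>
      ⟨ih hm (h.2.2 l).1, ih (by linarith) (h.2.2 l).2⟩⟩

theorem bddFamily (hρ : 0 ≤ ρ) (h : SymFamily ρ N m f) : BddFamily N (symWt m) f := by
  induction N generalizing m f with
  | zero => exact h
  | succ N ih =>
    refine ⟨h.1, h.2.1, fun v => ?_⟩
    refine ((BddFamily.sum Finset.univ fun l _ => (ih (h.2.2 l).1).smul_const (v.1 l : ℂ)).add
      (BddFamily.sum Finset.univ fun l _ => (ih ((h.2.2 l).2.mono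
        (by linarith : m - ρ ≤ m))).smul_const (v.2 l : ℂ))).congr fun t X => ?_
    exact (dirDeriv_phase v (f t) X).symm

theorem congr (h : SymFamily ρ N m f) (hfg : ∀ t X, f t X = g t X) : SymFamily ρ N m g := by
  have : f = g := by ext t X; exact hfg t X
  exact this ▸ h

theorem add (hf : SymFamily ρ N m f) (hg : SymFamily ρ N m g) :
    SymFamily ρ N m fun t X => f t X + g t X := by
  induction N generalizing m f g with
  | zero => exact BddFamily.add hf hg
  | succ N ih =>
    refine ⟨hf.1.add hg.1, fun t => (hf.2.1 t).add (hg.2.1 t), fun l => ?_⟩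
    simp only [dirDeriv_add (hf.2.1 _) (hg.2.1 _)]
    exact ⟨ih (hf.2.2 l).1 (hg.2.2 l).1, ih (hf.2.2 l).2 (hg.2.2 l).2⟩

theorem zero : SymFamily ρ N m (fun (_ : ι) (_ : Phase d) => (0 : ℂ)) := by
  induction N generalizing m with
  | zero => exact BddFamily.zero
  | succ N ih =>
    refine ⟨BddFamily.zero, fun _ => differentiable_const _, fun l => ?_⟩
    simp only [dirDeriv_zero]
    exact ⟨ih, ih⟩

theorem sum {σ : Type*} (s : Finset σ) {f : σ → ι → Phase d → ℂ}
    (h : ∀ i ∈ s, SymFamily ρ N m (f i)) : SymFamily ρ N m fun t x => ∑ i ∈ s, f i t x := by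
  classical
  induction s using Finset.induction_on with
  | empty => simpa using zero
  | insert i s hi ih =>
    simp only [Finset.sum_insert hi]
    exact (h i (by simp)).add (ih fun j hj => h j (by simp [hj]))

theorem const_mul {c : ι → ℂ} (hc : Continuous c) (hb : ∃ C, ∀ t, ‖c t‖ ≤ C)
    (hf : SymFamily ρ N m f) : SymFamily ρ N m fun t X => c t * f t X := by
  induction N generalizing m f with
  | zero => exact BddFamily.const_mul hc hb hf
  | succ N ih =>
    refine ⟨hf.1.const_mul hc hb, fun t => (hf.2.1 t).const_mul _, fun l => ?_⟩
    simp only [dirDeriv_const_mul (hf.2.1 _)]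
    exact ⟨ih (hf.2.2 l).1, ih (hf.2.2 l).2⟩

end SymFamily

theorem iteratedFDeriv_succ_dirDeriv {H : Type*} [NormedAddCommGroup H] [NormedSpace ℝ H]
    {f : H → ℂ} (hf : ContDiff ℝ ∞ f) {n : ℕ} (X : H) (v : Fin (n + 1) → H) :
    iteratedFDeriv ℝ (n + 1) f X v =
      iteratedFDeriv ℝ n (dirDeriv (v (Fin.last n)) f) X (Fin.init v) := by
  have h := hf.fderiv_right (m := ∞) (by simp)
  rw [iteratedFDeriv_succ_apply_right]
  exact (iteratedFDeriv_clm_apply_const_apply (h.of_le (by exact_mod_cast le_top)) le_rfl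
    (x := X) (u := v (Fin.last n)) (m := Fin.init v)).symm

theorem mixedDeriv_succ_right {j k : ℕ} {f : Phase d → ℂ} (hf : ContDiff ℝ ∞ f) (a : Fin j → Fin d)
    (α : Fin (k + 1) → Fin d) (X : Phase d) : mixedDeriv a α f X =
      mixedDeriv a (Fin.init α) (dirDeriv (momDir (α (Fin.last k))) f) X := by
  refine (iteratedFDeriv_succ_dirDeriv (n := j + k) hf X _).trans (congrArg₂
    (fun v u => iteratedFDeriv ℝ (j + k) (dirDeriv v f) X u) (Fin.append_right _ _ (Fin.last k)) ?_)
  funext i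
  refine Fin.addCases (fun i => ?_) (fun i => ?_) i
  · exact (Fin.append_left _ _ i).trans (Fin.append_left
      (fun i => ((basisVec (a i), 0) : Phase d))
      (fun i => ((0, basisVec (Fin.init α i)) : Phase d)) i).symm
  · exact (Fin.append_right _ _ i.castSucc).trans (Fin.append_right
      (fun i => ((basisVec (a i), 0) : Phase d))
      (fun i => ((0, basisVec (Fin.init α i)) : Phase d)) i).symm

/-- Restricted to empty `α` because momentum vectors come last in the list of directions: a position
vector is the last one only if no momentum vector follows. -/
theorem mixedDeriv_succ_left {j : ℕ} {f : Phase d → ℂ} (hf : ContDiff ℝ ∞ f)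
    (a : Fin (j + 1) → Fin d) (α : Fin 0 → Fin d) (X : Phase d) : mixedDeriv a α f X =
      mixedDeriv (Fin.init a) α (dirDeriv (posDir (a (Fin.last j))) f) X := by
  refine (iteratedFDeriv_succ_dirDeriv (n := j) hf X _).trans (congrArg₂
    (fun v u => iteratedFDeriv ℝ j (dirDeriv v f) X u) (Fin.append_left _ _ (Fin.last j)) ?_)
  funext i
  exact (Fin.append_left _ _ i.castSucc).trans
    (Fin.append_left (n := 0) (fun i => ((basisVec (Fin.init a i), 0) : Phase d)) _ i).symm

theorem mixedDeriv_dirDeriv_posDir {j k : ℕ} {f : Phase d → ℂ} (hf : ContDiff ℝ ∞ f)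
    (a : Fin j → Fin d) (α : Fin k → Fin d) (l : Fin d) (X : Phase d) :
    mixedDeriv a α (dirDeriv (posDir l) f) X = mixedDeriv (Fin.snoc a l : Fin (j + 1) → Fin d) α f X := by
  induction k generalizing f with
  | zero => rw [mixedDeriv_succ_left hf]; simp
  | succ k ih =>
    rw [mixedDeriv_succ_right hf, mixedDeriv_succ_right (ContDiff.dirDeriv hf _),
      dirDeriv_comm (by simpa using contDiff_infty.1 hf 2), ih (ContDiff.dirDeriv hf _)]

theorem IsHormanderSymbol.posDir {m ρ : ℝ} {f : Phase d → ℂ} (hf : IsHormanderSymbol m ρ f)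
    (l : Fin d) : IsHormanderSymbol m ρ (dirDeriv (posDir l) f) :=
  ⟨ContDiff.dirDeriv hf.smooth _, fun j k a α => by
    simp only [mixedDeriv_dirDeriv_posDir hf.smooth]
    exact hf.bound (j + 1) k _ α⟩

theorem IsHormanderSymbol.momDir {m ρ : ℝ} {f : Phase d → ℂ} (hf : IsHormanderSymbol m ρ f)
    (l : Fin d) : IsHormanderSymbol (m - ρ) ρ (dirDeriv (momDir l) f) :=
  ⟨ContDiff.dirDeriv hf.smooth _, fun j k a α => by
    obtain ⟨C, hC⟩ := hf.bound j (k + 1) a (Fin.snoc α l)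
    refine ⟨C, fun x ξ => ?_⟩
    have := hC x ξ
    rw [mixedDeriv_succ_right hf.smooth] at this
    simp only [Fin.init_snoc, Fin.snoc_last] at this
    refine this.trans_eq ?_
    congr 2
    push_cast; ring⟩

theorem IsHormanderSymbol.symFamily {m ρ : ℝ} {f : Phase d → ℂ} (hf : IsHormanderSymbol m ρ f)
    (N : ℕ) : SymFamily ρ N m fun _ : ι => f := by
  have h0 : ∀ {m : ℝ} {f : Phase d → ℂ}, IsHormanderSymbol m ρ f →
      BddFamily 0 (symWt m) fun _ : ι => f := by
    intro m f hf
    obtain ⟨C, hC⟩ := hf.bound 0 0 Fin.elim0 Fin.elim0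
    refine ⟨⟨C, fun _ X => ?_⟩, hf.smooth.continuous.comp continuous_snd⟩
    simpa [mixedDeriv, symWt] using hC X.1 X.2
  induction N generalizing m f with
  | zero => exact h0 hf
  | succ N ih =>
    exact ⟨h0 hf, fun _ => ContDiff.diff hf.smooth, fun l => ⟨ih (hf.posDir l), ih (hf.momDir l)⟩⟩

/-- Directions are removed from the end of the list, momentum derivatives first; each of these
lowers the order by `ρ`, and the position derivatives that remain leave it unchanged. -/
theorem SymFamily.mixedDeriv_bound {m ρ : ℝ} {f : ι → Phase d → ℂ} (hs : ∀ t, ContDiff ℝ ∞ (f t))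
    (hf : ∀ N, SymFamily ρ N m f) {j k : ℕ} (a : Fin j → Fin d) (α : Fin k → Fin d) :
    ∃ C, 0 ≤ C ∧ ∀ t x ξ, ‖mixedDeriv a α (f t) (x, ξ)‖ ≤ C * bracket ξ ^ (m - k * ρ) := by
  induction k generalizing m f with
  | zero =>
    induction j generalizing f with
    | zero =>
      obtain ⟨C, hC0, hC⟩ := (hf 0).zero_order.exists_bound_pos (symWt_nonneg m)
      refine ⟨C, hC0, fun t x ξ => ?_⟩
      simpa [mixedDeriv, symWt] using hC t (x, ξ)
    | succ j ih =>
      simp only [mixedDeriv_succ_left (hs _)]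
      exact ih (f := fun t => dirDeriv (MagneticWeyl.posDir (a (Fin.last j))) (f t))
        (Fin.init a) (fun t => ContDiff.dirDeriv (hs t) _) fun N => ((hf (N + 1)).2.2 _).1
  | succ k ih =>
    simp only [mixedDeriv_succ_right (hs _)]
    obtain ⟨C, hC0, hC⟩ := ih (f := fun t => dirDeriv (MagneticWeyl.momDir (α (Fin.last k))) (f t))
      (fun t => ContDiff.dirDeriv (hs t) _)
      (fun N => ((hf (N + 1)).2.2 _).2) (Fin.init α)
    refine ⟨C, hC0, fun t x ξ => (hC t x ξ).trans_eq ?_⟩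
    congr 2
    push_cast; ring

theorem SymFamily.isHormanderSymbol {m ρ : ℝ} (hρ : 0 ≤ ρ) {f : ι → Phase d → ℂ}
    (hf : ∀ N, SymFamily ρ N m f) (t : ι) : IsHormanderSymbol m ρ (f t) := by
  have hs : ∀ t, ContDiff ℝ ∞ (f t) :=
    BddFamily.contDiff_infty fun N => (hf N).bddFamily hρ
  exact ⟨hs t, fun j k a α => let ⟨C, _, hC⟩ := SymFamily.mixedDeriv_bound hs hf a α; ⟨C, hC t⟩⟩

end SymFamily

/-! ### The twisted product as an oscillatory integral -/

section Sharp

variable {ι : Type*} [TopologicalSpace ι] [FirstCountableTopology ι] {d : ℕ}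

/-- The growth of weights in the second and third variable. -/
def cfgWt (c : Space d × Space d × Space d) : ℝ := wt c.2

theorem one_le_cfgWt (c : Space d × Space d × Space d) : 1 ≤ cfgWt c := one_le_wt _

/-- `(X, (y, z), (η, ζ)) ↦ (x, y, z)`. -/
def cfgMap : Phase d × Phase d × Phase d →L[ℝ] Space d × Space d × Space d :=
  ((ContinuousLinearMap.fst ℝ _ _).comp (ContinuousLinearMap.fst ℝ _ _)).prod
    ((ContinuousLinearMap.fst ℝ _ _).comp (ContinuousLinearMap.snd ℝ _ _))

/-- `(X, (y, z), (η, ζ)) ↦ (x - (ε/2) z, ξ + η)`. -/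
def leftMap (ε : ℝ) : Phase d × Phase d × Phase d →L[ℝ] Phase d :=
  (ContinuousLinearMap.fst ℝ _ _ + (0 : _ →L[ℝ] Space d).prod ((ContinuousLinearMap.fst ℝ _ _).comp
    ((ContinuousLinearMap.snd ℝ _ _).comp (ContinuousLinearMap.snd ℝ _ _)))) +
    ε • (((-1 / 2 : ℝ) • ((ContinuousLinearMap.snd ℝ _ _).comp ((ContinuousLinearMap.fst ℝ _ _).comp
      (ContinuousLinearMap.snd ℝ _ _)))).prod (0 : _ →L[ℝ] Space d))

/-- `(X, (y, z), (η, ζ)) ↦ (x + (ε/2) y, ξ + ζ)`. -/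
def rightMap (ε : ℝ) : Phase d × Phase d × Phase d →L[ℝ] Phase d :=
  (ContinuousLinearMap.fst ℝ _ _ + (0 : _ →L[ℝ] Space d).prod ((ContinuousLinearMap.snd ℝ _ _).comp
    ((ContinuousLinearMap.snd ℝ _ _).comp (ContinuousLinearMap.snd ℝ _ _)))) +
    ε • (((1 / 2 : ℝ) • ((ContinuousLinearMap.fst ℝ _ _).comp ((ContinuousLinearMap.fst ℝ _ _).comp
      (ContinuousLinearMap.snd ℝ _ _)))).prod (0 : _ →L[ℝ] Space d))

theorem cfgMap_apply (h : Phase d × Phase d × Phase d) : cfgMap h = (h.1.1, h.2.1) := rfl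

theorem leftMap_apply (ε : ℝ) (h : Phase d × Phase d × Phase d) :
    leftMap ε h = (h.1.1 - (ε / 2) • h.2.1.2, h.1.2 + h.2.2.1) := by
  ext i <;> simp [leftMap]; ring

theorem rightMap_apply (ε : ℝ) (h : Phase d × Phase d × Phase d) :
    rightMap ε h = (h.1.1 + (ε / 2) • h.2.1.1, h.1.2 + h.2.2.2) := by
  ext i <;> simp [rightMap]; ring

/-- The amplitude of the twisted product. -/
def sharpAmp (ε : ℝ) (G : Space d × Space d × Space d → ℂ) (f g : Phase d → ℂ)
    (h : Phase d × Phase d × Phase d) : ℂ :=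
  G (cfgMap h) * (f (leftMap ε h) * g (rightMap ε h))

/-- The twisted product of `f` and `g` with weight `G`. -/
def sharp (ε : ℝ) (G : Space d × Space d × Space d → ℂ) (f g : Phase d → ℂ) (X : Phase d) : ℂ :=
  (((2 * Real.pi) ^ (2 * d) : ℝ) : ℂ)⁻¹ * oscInt fun z => sharpAmp ε G f g (X, z)

/-- The weight ignores the shift in position, the only place where `ε` enters, so Peetre's
inequality for `ξ + η` gives a constant independent of `ε`. -/
theorem symWt_leftMap_le (m : ℝ) : ∃ C, 0 ≤ C ∧ ∀ (ε : ℝ) (h : Phase d × Phase d × Phase d),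
    symWt m (leftMap ε h) ≤ C * (symWt m h.1 * wt h.2.2 ^ ⌈|m|⌉₊) := by
  obtain ⟨C, hC0, hC⟩ := bracket_add_rpow_le (d := d) m
  refine ⟨C, hC0, fun ε h => ?_⟩
  rw [leftMap_apply]
  refine (hC h.1.2 h.2.2.1).trans (mul_le_mul_of_nonneg_left (mul_le_mul_of_nonneg_left ?_
    (symWt_nonneg m h.1)) hC0)
  exact pow_le_pow_left₀ (wt_nonneg _) (add_le_add le_rfl (norm_fst_le h.2.2)) _

theorem symWt_rightMap_le (m : ℝ) : ∃ C, 0 ≤ C ∧ ∀ (ε : ℝ) (h : Phase d × Phase d × Phase d),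
    symWt m (rightMap ε h) ≤ C * (symWt m h.1 * wt h.2.2 ^ ⌈|m|⌉₊) := by
  obtain ⟨C, hC0, hC⟩ := bracket_add_rpow_le (d := d) m
  refine ⟨C, hC0, fun ε h => ?_⟩
  rw [rightMap_apply]
  refine (hC h.1.2 h.2.2.2).trans (mul_le_mul_of_nonneg_left (mul_le_mul_of_nonneg_left ?_
    (symWt_nonneg m h.1)) hC0)
  exact pow_le_pow_left₀ (wt_nonneg _) (add_le_add le_rfl (norm_snd_le h.2.2)) _

theorem exists_norm_add_smul_le {H K : Type*} [NormedAddCommGroup H] [NormedSpace ℝ H]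
    [NormedAddCommGroup K] [NormedSpace ℝ K] (L L' : H →L[ℝ] K) :
    ∃ C, ∀ ε : ℝ, |ε| ≤ 1 → ‖L + ε • L'‖ ≤ C := by
  refine ⟨‖L‖ + ‖L'‖, fun ε hε => (norm_add_le _ _).trans (add_le_add le_rfl ?_)⟩
  rw [norm_smul]
  exact mul_le_of_le_one_left (norm_nonneg _) hε

theorem exists_norm_leftMap_le (d : ℕ) : ∃ C, ∀ ε : ℝ, |ε| ≤ 1 →
    ‖(leftMap ε : Phase d × Phase d × Phase d →L[ℝ] Phase d)‖ ≤ C :=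
  exists_norm_add_smul_le _ _

theorem exists_norm_rightMap_le (d : ℕ) : ∃ C, ∀ ε : ℝ, |ε| ≤ 1 →
    ‖(rightMap ε : Phase d × Phase d × Phase d →L[ℝ] Phase d)‖ ≤ C :=
  exists_norm_add_smul_le _ _

variable {ε : ι → ℝ} {G G' : ι → Space d × Space d × Space d → ℂ} {f g : ι → Phase d → ℂ}
  {m₁ m₂ : ℝ}

theorem BddFamily.comp_leftMap (hεc : Continuous ε) (hε : ∀ t, |ε t| ≤ 1) {N : ℕ}
    (hf : BddFamily N (symWt m₁) f) :
    BddFamily N (fun h => symWt m₁ h.1 * wt h.2.2 ^ ⌈|m₁|⌉₊) fun t h => f t (leftMap (ε t) h) := by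
  obtain ⟨C, hC⟩ := exists_norm_leftMap_le d
  obtain ⟨D, hD0, hD⟩ := symWt_leftMap_le (d := d) m₁
  refine hf.comp (A := fun t => leftMap (ε t)) ?_ ⟨C, fun t => hC _ (hε t)⟩
    ⟨D, hD0, fun t h => hD _ h⟩ (symWt_nonneg m₁)
  simp only [leftMap_apply]
  fun_prop

theorem BddFamily.comp_rightMap (hεc : Continuous ε) (hε : ∀ t, |ε t| ≤ 1) {N : ℕ}
    (hg : BddFamily N (symWt m₂) g) :
    BddFamily N (fun h => symWt m₂ h.1 * wt h.2.2 ^ ⌈|m₂|⌉₊) fun t h => g t (rightMap (ε t) h) := by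
  obtain ⟨C, hC⟩ := exists_norm_rightMap_le d
  obtain ⟨D, hD0, hD⟩ := symWt_rightMap_le (d := d) m₂
  refine hg.comp (A := fun t => rightMap (ε t)) ?_ ⟨C, fun t => hC _ (hε t)⟩
    ⟨D, hD0, fun t h => hD _ h⟩ (symWt_nonneg m₂)
  simp only [rightMap_apply]
  fun_prop

/-- The weight `G` is independent of `(η, ζ)` and may have a growth exponent depending on `N`. The
symbols do depend on these variables, but all their derivatives obey one weight. These are the two
ways of satisfying `AmpBound`. -/
theorem amp_sharpAmp (hεc : Continuous ε) (hε : ∀ t, |ε t| ≤ 1) (hG : PolyFamily cfgWt G)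
    (hf : ∀ N, BddFamily N (symWt m₁) f) (hg : ∀ N, BddFamily N (symWt m₂) g) :
    Amp (symWt (m₁ + m₂)) (⌈|m₁|⌉₊ + ⌈|m₂|⌉₊) fun t => sharpAmp (ε t) (G t) (f t) (g t) := by
  have hfs : ∀ t, ContDiff ℝ ∞ (f t) := BddFamily.contDiff_infty hf
  have hgs : ∀ t, ContDiff ℝ ∞ (g t) := BddFamily.contDiff_infty hg
  have s1 : ∀ t, ContDiff ℝ ∞ fun h => G t (cfgMap h) := fun t =>
    (hG.contDiff t).comp cfgMap.contDiff
  have s2 : ∀ t, ContDiff ℝ ∞ fun h => f t (leftMap (ε t) h) := fun t =>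
    (hfs t).comp (leftMap (ε t)).contDiff
  have s3 : ∀ t, ContDiff ℝ ∞ fun h => g t (rightMap (ε t) h) := fun t =>
    (hgs t).comp (rightMap (ε t)).contDiff
  refine ⟨fun t => (s1 t).mul ((s2 t).mul (s3 t)), fun N => ?_⟩
  obtain ⟨k, hk⟩ := hG N
  have h1 : AmpBound N (fun h : Phase d × Phase d × Phase d => wt h.2.1 ^ k)
      fun t h => G t (cfgMap h) := by
    refine AmpBound.of_indep (hk.comp_const cfgMap ⟨1, zero_le_one, fun h => (one_mul _).ge⟩
      fun c => pow_nonneg (wt_nonneg _) _) fun t u => ?_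
    rw [dirDeriv_comp (ContDiff.diff (hG.contDiff t))]
    ext h
    have : cfgMap ((0, 0, u) : Phase d × Phase d × Phase d) = 0 := rfl
    simp [dirDeriv, this]
  have h2 := AmpBound.of_forall (fun N => (hf N).comp_leftMap hεc hε) N
  have h3 := AmpBound.of_forall (fun N => (hg N).comp_rightMap hεc hε) N
  refine ⟨k, (h1.mul s1 (fun t => (s2 t).mul (s3 t)) (h2.mul s2 s3 h3)).mono
    ⟨1, zero_le_one, fun h => le_of_eq ?_⟩ fun h => ?_⟩
  · rw [one_mul, ← symWt_mul, pow_add]; ring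
  · have := symWt_nonneg m₁ h.1
    have := symWt_nonneg m₂ h.1
    have := wt_nonneg h.2.1
    have := wt_nonneg h.2.2
    positivity

theorem dirDeriv_zero_direction {H : Type*} [NormedAddCommGroup H] [NormedSpace ℝ H] (a : H → ℂ) :
    dirDeriv 0 a = fun _ => 0 := by ext x; simp [dirDeriv]

theorem dirDeriv_sharpAmp {ε : ℝ} {G : Space d × Space d × Space d → ℂ} {f g : Phase d → ℂ}
    (hG : Differentiable ℝ G) (hf : Differentiable ℝ f) (hg : Differentiable ℝ g)
    (v : Phase d × Phase d × Phase d) : dirDeriv v (sharpAmp ε G f g) = fun h =>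
      sharpAmp ε (dirDeriv (cfgMap v) G) f g h + (sharpAmp ε G (dirDeriv (leftMap ε v) f) g h +
        sharpAmp ε G f (dirDeriv (rightMap ε v) g) h) := by
  have s1 : Differentiable ℝ fun h => G (cfgMap h) := hG.comp (cfgMap (d := d)).differentiable
  have s2 : Differentiable ℝ fun h => f (leftMap ε h) := hf.comp (leftMap (d := d) ε).differentiable
  have s3 : Differentiable ℝ fun h => g (rightMap ε h) :=
    hg.comp (rightMap (d := d) ε).differentiable
  have s4 : Differentiable ℝ fun h => f (leftMap ε h) * g (rightMap ε h) := s2.mul s3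
  unfold sharpAmp
  rw [dirDeriv_mul s1 s4]
  ext h
  have e1 := congrFun (dirDeriv_comp hG cfgMap v) h
  have e2 := congrFun (dirDeriv_comp hf (leftMap ε) v) h
  have e3 := congrFun (dirDeriv_comp hg (rightMap ε) v) h
  have e4 := congrFun (dirDeriv_mul s2 s3 v) h
  rw [e1, e4, e2, e3]; ring

theorem sharpAmp_zero_weight (ε : ℝ) (f g : Phase d → ℂ) :
    sharpAmp ε (fun _ => 0) f g = fun _ => 0 := by ext; simp [sharpAmp]

theorem sharpAmp_zero_left (ε : ℝ) (G : Space d × Space d × Space d → ℂ) (g : Phase d → ℂ) :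
    sharpAmp ε G (fun _ => 0) g = fun _ => 0 := by ext; simp [sharpAmp]

theorem sharpAmp_zero_right (ε : ℝ) (G : Space d × Space d × Space d → ℂ) (f : Phase d → ℂ) :
    sharpAmp ε G f (fun _ => 0) = fun _ => 0 := by ext; simp [sharpAmp]

theorem bddFamily_sharp (hεc : Continuous ε) (hε : ∀ t, |ε t| ≤ 1) (hG : PolyFamily cfgWt G)
    (hf : ∀ N, BddFamily N (symWt m₁) f) (hg : ∀ N, BddFamily N (symWt m₂) g) (N : ℕ) :
    BddFamily N (symWt (m₁ + m₂)) fun t => sharp (ε t) (G t) (f t) (g t) :=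
  ((amp_sharpAmp hεc hε hG hf hg).bddFamily_oscInt (continuous_symWt _) (symWt_nonneg _) N).smul_const _

/-- A Leibniz rule: the base point `X` enters both arguments by translation, so a direction `v` acts
as `v` on `f` and on `g`, whereas `G` only feels its position part. -/
theorem dirDeriv_sharp (hεc : Continuous ε) (hε : ∀ t, |ε t| ≤ 1) (hG : PolyFamily cfgWt G)
    (hf : ∀ N, BddFamily N (symWt m₁) f) (hg : ∀ N, BddFamily N (symWt m₂) g) (t : ι) (v : Phase d) :
    dirDeriv v (sharp (ε t) (G t) (f t) (g t)) = fun X =>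
      sharp (ε t) (dirDeriv (v.1, 0) (G t)) (f t) (g t) X +
        (sharp (ε t) (G t) (dirDeriv v (f t)) (g t) X +
          sharp (ε t) (G t) (f t) (dirDeriv v (g t)) X) := by
  have hw := continuous_symWt (d := d) (m₁ + m₂)
  have hw0 := symWt_nonneg (d := d) (m₁ + m₂)
  have hA := amp_sharpAmp hεc hε hG hf hg
  have h1 := amp_sharpAmp hεc hε (hG.dirDeriv (v.1, 0)) hf hg
  have h2 := amp_sharpAmp hεc hε hG (fun N => (hf (N + 1)).2.2 v) hg
  have h3 := amp_sharpAmp hεc hε hG hf (fun N => (hg (N + 1)).2.2 v)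
  have hd : Differentiable ℝ fun X => oscInt fun z => sharpAmp (ε t) (G t) (f t) (g t) (X, z) :=
    (hA.bddFamily_oscInt hw hw0 1).differentiable t
  have el : leftMap (ε t) (v, 0) = v := by rw [leftMap_apply]; simp
  have er : rightMap (ε t) (v, 0) = v := by rw [rightMap_apply]; simp
  have ec : cfgMap ((v, 0) : Phase d × Phase d × Phase d) = (v.1, 0) := rfl
  unfold sharp
  rw [dirDeriv_const_mul hd, hA.dirDeriv_oscInt hw hw0]
  ext X
  simp only [dirDeriv_sharpAmp (hG.differentiable t) ((hf 1).differentiable t)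
    ((hg 1).differentiable t), el, er, ec]
  rw [h1.oscInt_add hw hw0 (h2.add hw0 h3), h2.oscInt_add hw hw0 h3]
  ring

theorem sharp_zero_weight (ε : ℝ) (f g : Phase d → ℂ) (X : Phase d) :
    sharp ε (fun _ => 0) f g X = 0 := by
  have h : HasOscInt (fun _ : Phase d × Phase d => (0 : ℂ)) _ :=
    HasOscInt.of_integrable (integrable_zero _ _ _)
  simp only [sharp, sharpAmp_zero_weight]
  rw [h.oscInt_eq]; simp

/-- Induction through the Leibniz rule. A momentum derivative does not reach `G`, so in each
surviving term it falls on one symbol and lowers the order by `ρ`. Weight, symbols and orders all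
change, hence are general in the induction. -/
theorem symFamily_sharp {ρ : ℝ} (hρ : 0 ≤ ρ) (hεc : Continuous ε) (hε : ∀ t, |ε t| ≤ 1)
    (hG : PolyFamily cfgWt G) (hf : ∀ N, SymFamily ρ N m₁ f) (hg : ∀ N, SymFamily ρ N m₂ g)
    (N : ℕ) : SymFamily ρ N (m₁ + m₂) fun t => sharp (ε t) (G t) (f t) (g t) := by
  induction N generalizing G f g m₁ m₂ with
  | zero => 
    exact bddFamily_sharp hεc hε hG (fun N => (hf N).bddFamily hρ)
      (fun N => (hg N).bddFamily hρ) 0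
  | succ N ih =>
    have hf' := fun N => (hf N).bddFamily hρ
    have hg' := fun N => (hg N).bddFamily hρ
    have h1 := bddFamily_sharp hεc hε hG hf' hg' 1
    refine ⟨h1.zero_order, fun t => h1.differentiable t, fun l => ⟨?_, ?_⟩⟩
    · simp only [dirDeriv_sharp hεc hε hG hf' hg']
      exact (ih (hG.dirDeriv _) hf hg).add ((ih hG (fun N => ((hf (N + 1)).2.2 l).1) hg).add
        (ih hG hf fun N => ((hg (N + 1)).2.2 l).1))
    · have h2 := (ih hG (fun N => ((hf (N + 1)).2.2 l).2) hg).add ((ih hG hf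
        fun N => ((hg (N + 1)).2.2 l).2).mono (m' := m₁ - ρ + m₂) (by linarith))
      have e : m₁ - ρ + m₂ = m₁ + m₂ - ρ := by ring
      rw [e] at h2
      refine h2.congr fun t X => ?_
      rw [dirDeriv_sharp hεc hε hG hf' hg']
      have : (((momDir l).1, 0) : Space d × Space d × Space d) = 0 := rfl
      rw [this, dirDeriv_zero_direction]
      simp only [sharp_zero_weight, zero_add]

theorem sharp_add_weight (hεc : Continuous ε) (hε : ∀ t, |ε t| ≤ 1) (hG : PolyFamily cfgWt G)
    (hG' : PolyFamily cfgWt G') (hf : ∀ N, BddFamily N (symWt m₁) f)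
    (hg : ∀ N, BddFamily N (symWt m₂) g) (t : ι) (X : Phase d) :
    sharp (ε t) (fun c => G t c + G' t c) (f t) (g t) X =
      sharp (ε t) (G t) (f t) (g t) X + sharp (ε t) (G' t) (f t) (g t) X := by
  have h := (amp_sharpAmp hεc hε hG hf hg).oscInt_add (continuous_symWt _) (symWt_nonneg _)
    (amp_sharpAmp hεc hε hG' hf hg) t X
  simp only [sharp]
  rw [← mul_add, ← h]
  simp only [sharpAmp, add_mul]

theorem sharp_const_mul_weight (hεc : Continuous ε) (hε : ∀ t, |ε t| ≤ 1) (hG : PolyFamily cfgWt G)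
    (hf : ∀ N, BddFamily N (symWt m₁) f)
    (hg : ∀ N, BddFamily N (symWt m₂) g) (c : ℂ) (t : ι) (X : Phase d) :
    sharp (ε t) (fun p => c * G t p) (f t) (g t) X = c * sharp (ε t) (G t) (f t) (g t) X := by
  have h := (amp_sharpAmp hεc hε hG hf hg).oscInt_const_mul (continuous_symWt _) (symWt_nonneg _)
    c t X
  simp only [sharp]
  rw [mul_left_comm, ← h]
  simp only [sharpAmp, mul_assoc]

theorem sharp_sum_weight {σ : Type*} (s : Finset σ) {G : σ → ι → Space d × Space d × Space d → ℂ}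
    (hεc : Continuous ε) (hε : ∀ t, |ε t| ≤ 1) (hG : ∀ i, PolyFamily cfgWt (G i))
    (hf : ∀ N, BddFamily N (symWt m₁) f) (hg : ∀ N, BddFamily N (symWt m₂) g) (t : ι)
    (X : Phase d) : sharp (ε t) (fun c => ∑ i ∈ s, G i t c) (f t) (g t) X =
      ∑ i ∈ s, sharp (ε t) (G i t) (f t) (g t) X := by
  classical
  induction s using Finset.induction_on with
  | empty => simpa using sharp_zero_weight (ε t) (f t) (g t) X
  | insert i s hi ih =>
    simp only [Finset.sum_insert hi]
    rw [← ih]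
    exact sharp_add_weight hεc hε (hG i) (G' := fun t c => ∑ i ∈ s, G i t c)
      (PolyFamily.sum one_le_cfgWt s fun i _ => hG i) hf hg t X

theorem polyFamily_linear {K : Type*} [NormedAddCommGroup K] [NormedSpace ℝ K] {W : K → ℝ}
    (hW : ∀ x, 1 ≤ W x) (L : K →L[ℝ] ℝ) (hL : ∀ x, |L x| ≤ W x) :
    PolyFamily W fun (_ : ι) x => (L x : ℂ) := by
  have hd : Differentiable ℝ fun x => (L x : ℂ) := Complex.ofRealCLM.differentiable.comp L.differentiable
  have h0 : BddFamily 0 (fun x => W x ^ 1) fun (_ : ι) x => (L x : ℂ) := by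
    refine ⟨⟨1, fun t x => ?_⟩, hd.continuous.comp continuous_snd⟩
    simpa using hL x
  intro N
  cases N with
  | zero => exact ⟨1, h0⟩
  | succ N =>
    refine ⟨1, h0, fun t => hd, fun v => ?_⟩
    have e : dirDeriv v (fun x => (L x : ℂ)) = fun _ => (L v : ℂ) := by
      ext x
      have : HasFDerivAt (fun x => (L x : ℂ)) (Complex.ofRealCLM.comp L) x :=
        (Complex.ofRealCLM.comp L).hasFDerivAt
      rw [dirDeriv, this.fderiv]; rfl
    simp only [e]
    exact (BddFamily.const (c := fun _ => (L v : ℂ)) continuous_const ⟨_, fun _ => le_rfl⟩).mono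
      ⟨1, zero_le_one, fun x => by simpa using hW x⟩ fun x => by
        have := hW x; positivity

theorem polyFamily_coordLeft (l : Fin d) :
    PolyFamily cfgWt fun (_ : ι) (c : Space d × Space d × Space d) => (c.2.1 l : ℂ) := by
  refine polyFamily_linear one_le_cfgWt ((EuclideanSpace.proj l).comp
    ((ContinuousLinearMap.fst ℝ _ _).comp (ContinuousLinearMap.snd ℝ _ _))) fun c => ?_
  refine ((PiLp.norm_apply_le c.2.1 l).trans (norm_fst_le c.2)).trans ?_
  simp [cfgWt, wt]

theorem polyFamily_coordRight (j : Fin d) :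
    PolyFamily cfgWt fun (_ : ι) (c : Space d × Space d × Space d) => (c.2.2 j : ℂ) := by
  refine polyFamily_linear one_le_cfgWt ((EuclideanSpace.proj j).comp
    ((ContinuousLinearMap.snd ℝ _ _).comp (ContinuousLinearMap.snd ℝ _ _))) fun c => ?_
  refine ((PiLp.norm_apply_le c.2.2 j).trans (norm_snd_le c.2)).trans ?_
  simp [cfgWt, wt]

/-- In the phase `y_l` is paired with `η_l`, and the amplitude contains `η` only through `f(·, ξ +
η)`. Integration by parts therefore yields `∂_{ξ_l} f`. -/
theorem sharp_coordLeft_mul (hεc : Continuous ε) (hε : ∀ t, |ε t| ≤ 1) (hG : PolyFamily cfgWt G)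
    (hf : ∀ N, BddFamily N (symWt m₁) f) (hg : ∀ N, BddFamily N (symWt m₂) g) (l : Fin d)
    (t : ι) (X : Phase d) :
    sharp (ε t) (fun c => (c.2.1 l : ℂ) * G t c) (f t) (g t) X =
      -Complex.I * sharp (ε t) (G t) (dirDeriv (momDir l) (f t)) (g t) X := by
  have hA := amp_sharpAmp hεc hε hG hf hg
  have pl : ∀ w : Phase d, pairing (basisVec l, (0 : Space d)) w = w.1 l := by
    intro w
    rw [pairing_prod, pairing_space]
    simp [EuclideanSpace.inner_single_left]
  have h := hA.oscInt_pairing_mul (continuous_symWt _) (symWt_nonneg _) (basisVec l, (0 : Space d)) t X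
  have e1 : cfgMap ((0, 0, (basisVec l, 0)) : Phase d × Phase d × Phase d) = 0 := rfl
  have e2 : leftMap (ε t) ((0, 0, (basisVec l, 0)) : Phase d × Phase d × Phase d) = momDir l := by
    rw [leftMap_apply]; ext <;> simp [momDir]
  have e3 : rightMap (ε t) ((0, 0, (basisVec l, 0)) : Phase d × Phase d × Phase d) = 0 := by
    rw [rightMap_apply]; ext <;> simp
  rw [dirDeriv_sharpAmp (hG.differentiable t) ((hf 1).differentiable t)
    ((hg 1).differentiable t), e1, e2, e3, dirDeriv_zero_direction, dirDeriv_zero_direction,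
    sharpAmp_zero_weight, sharpAmp_zero_right] at h
  simp only [zero_add, add_zero, pl] at h
  simp only [sharp]
  rw [mul_left_comm, ← h]
  simp only [sharpAmp, mul_assoc, cfgMap_apply]

theorem sharp_coordRight_mul (hεc : Continuous ε) (hε : ∀ t, |ε t| ≤ 1) (hG : PolyFamily cfgWt G)
    (hf : ∀ N, BddFamily N (symWt m₁) f) (hg : ∀ N, BddFamily N (symWt m₂) g) (j : Fin d)
    (t : ι) (X : Phase d) :
    sharp (ε t) (fun c => (c.2.2 j : ℂ) * G t c) (f t) (g t) X =
      -Complex.I * sharp (ε t) (G t) (f t) (dirDeriv (momDir j) (g t)) X := by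
  have hA := amp_sharpAmp hεc hε hG hf hg
  have pr : ∀ w : Phase d, pairing ((0 : Space d), basisVec j) w = w.2 j := by
    intro w
    rw [pairing_prod]
    simp [pairing_space, EuclideanSpace.inner_single_left]
  have h := hA.oscInt_pairing_mul (continuous_symWt _) (symWt_nonneg _) ((0 : Space d), basisVec j) t X
  have e1 : cfgMap ((0, 0, (0, basisVec j)) : Phase d × Phase d × Phase d) = 0 := rfl
  have e2 : leftMap (ε t) ((0, 0, (0, basisVec j)) : Phase d × Phase d × Phase d) = 0 := by
    rw [leftMap_apply]; ext <;> simp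
  have e3 : rightMap (ε t) ((0, 0, (0, basisVec j)) : Phase d × Phase d × Phase d) = momDir j := by
    rw [rightMap_apply]; ext <;> simp [momDir]
  rw [dirDeriv_sharpAmp (hG.differentiable t) ((hf 1).differentiable t)
    ((hg 1).differentiable t), e1, e2, e3, dirDeriv_zero_direction, dirDeriv_zero_direction,
    sharpAmp_zero_weight, sharpAmp_zero_left] at h
  simp only [zero_add, pr] at h
  simp only [sharp]
  rw [mul_left_comm, ← h]
  simp only [sharpAmp, mul_assoc, cfgMap_apply]

/-- The gain of two orders of decay by a factor `y_l z_j`. -/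
theorem sharp_coord_mul (hεc : Continuous ε) (hε : ∀ t, |ε t| ≤ 1) (hG : PolyFamily cfgWt G)
    (hf : ∀ N, BddFamily N (symWt m₁) f) (hg : ∀ N, BddFamily N (symWt m₂) g) (l j : Fin d)
    (t : ι) (X : Phase d) :
    sharp (ε t) (fun c => (c.2.1 l : ℂ) * ((c.2.2 j : ℂ) * G t c)) (f t) (g t) X =
      -sharp (ε t) (G t) (dirDeriv (momDir l) (f t)) (dirDeriv (momDir j) (g t)) X := by
  rw [sharp_coordLeft_mul hεc hε (G := fun t c => (c.2.2 j : ℂ) * G t c)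
    ((polyFamily_coordRight j).mul hG) hf hg, sharp_coordRight_mul hεc hε hG
    (f := fun t => dirDeriv (momDir l) (f t)) (fun N => (hf (N + 1)).2.2 _) hg, ← mul_assoc]
  simp

end Sharp

/-! ### Weights: the scaled flux and its exponentials -/

section Sources

variable {ι : Type*} [TopologicalSpace ι] {H : Type*} [NormedAddCommGroup H] [NormedSpace ℝ H]

theorem bddFamily_of_iteratedFDeriv {w : H → ℝ} {f : H → ℂ} (hf : ContDiff ℝ ∞ f) {N : ℕ}
    (h : ∀ n ≤ N, ∃ C, ∀ x, ‖iteratedFDeriv ℝ n f x‖ ≤ C * w x) :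
    BddFamily N w fun _ : ι => f := by
  have h0 : BddFamily 0 w fun _ : ι => f := by
    obtain ⟨C, hC⟩ := h 0 (Nat.zero_le _)
    exact ⟨⟨C, fun _ x => by simpa using hC x⟩, hf.continuous.comp continuous_snd⟩
  induction N generalizing f with
  | zero => exact h0
  | succ N ih =>
    refine ⟨h0, fun _ => ContDiff.diff hf, fun v => ?_⟩
    have hv : ∀ n ≤ N, ∃ C, ∀ x, ‖iteratedFDeriv ℝ n (dirDeriv v f) x‖ ≤ C * w x := by
      intro n hn
      obtain ⟨C, hC⟩ := h (n + 1) (by omega)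
      refine ⟨‖v‖ * C, fun x => ?_⟩
      have h1 := norm_iteratedFDeriv_clm_apply_const (c := v) (x := x)
        (((contDiff_infty_iff_fderiv.1 hf).2).contDiffAt.of_le
          (show (n : WithTop ℕ∞) ≤ ∞ by exact_mod_cast le_top)) (n := n) le_rfl
      rw [norm_iteratedFDeriv_fderiv] at h1
      rw [mul_assoc]
      exact h1.trans (mul_le_mul_of_nonneg_left (hC x) (norm_nonneg _))
    refine ih (ContDiff.dirDeriv hf v) hv ?_
    obtain ⟨C, hC⟩ := hv 0 (Nat.zero_le _)
    exact ⟨⟨C, fun _ x => by simpa using hC x⟩,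
      (ContDiff.dirDeriv hf v).continuous.comp continuous_snd⟩

theorem norm_iteratedFDeriv_ofReal {f : H → ℝ} (hf : ContDiff ℝ ∞ f) (n : ℕ) (x : H) :
    ‖iteratedFDeriv ℝ n (fun x => (f x : ℂ)) x‖ = ‖iteratedFDeriv ℝ n f x‖ :=
  Complex.ofRealLI.norm_iteratedFDeriv_comp_left hf.contDiffAt
    (show (n : WithTop ℕ∞) ≤ ∞ by exact_mod_cast le_top)

theorem IsBCInfty.bddFamily {d : ℕ} {b : Space d → ℝ} (hb : IsBCInfty b) (N : ℕ) :
    BddFamily N (fun _ => 1) fun (_ : ι) x => (b x : ℂ) :=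
  bddFamily_of_iteratedFDeriv (Complex.ofRealCLM.contDiff.comp hb.smooth) fun n _ =>
    let ⟨C, hC⟩ := hb.bound n
    ⟨C, fun x => by
      rw [mul_one]; exact (norm_iteratedFDeriv_ofReal hb.smooth n x).le.trans (hC x)⟩

theorem bddFamily_exp {κ : ι → ℝ} (hκ : Continuous κ) (hb : ∃ C, ∀ t, |κ t| ≤ C) (N : ℕ) :
    BddFamily N (fun _ : ℝ => 1) fun t (s : ℝ) => Complex.exp (-Complex.I * κ t * s) := by
  have h0 : BddFamily 0 (fun _ : ℝ => 1) fun t (s : ℝ) => Complex.exp (-Complex.I * κ t * s) := by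
    refine ⟨⟨1, fun t s => ?_⟩, by fun_prop⟩
    rw [Complex.norm_exp]; simp
  induction N with
  | zero => exact h0
  | succ N ih =>
    have hd : ∀ (t : ι) (s : ℝ), HasFDerivAt (fun s : ℝ => Complex.exp (-Complex.I * κ t * s))
        (Complex.exp (-Complex.I * κ t * s) • ((-Complex.I * κ t) • Complex.ofRealCLM)) s := fun t s =>
      ((Complex.ofRealCLM.hasFDerivAt (x := s)).const_mul (-Complex.I * κ t)).cexp
    refine ⟨h0, fun t s => (hd t s).differentiableAt, fun v => ?_⟩
    have := ih.const_mul (c := fun t => -Complex.I * κ t * v) (by fun_prop) (by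
      obtain ⟨C, hC⟩ := hb
      refine ⟨C * |v|, fun t => ?_⟩
      simp only [norm_mul, norm_neg, Complex.norm_I, one_mul, Complex.norm_real, Real.norm_eq_abs]
      exact mul_le_mul_of_nonneg_right (hC t) (abs_nonneg v))
    refine this.congr fun t s => ?_
    rw [dirDeriv, (hd t s).fderiv]
    simp; ring

end Sources

/-! ### The scaled flux, its powers and its exponential. -/

section Flux

variable {ι : Type*} [TopologicalSpace ι] [FirstCountableTopology ι] {d : ℕ}

/-- The average of `b` over the triangle with corners `x - (ε/2)(y + z)`, `x + (ε/2)(y - z)`,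
`x + (ε/2)(y + z)`. -/
def triangleAvg (b : Space d → ℝ) (ε : ℝ) (c : Space d × Space d × Space d) : ℝ :=
  ∫ s in (0 : ℝ)..1, ∫ t in (0 : ℝ)..(1 - s),
    b (c.1 + (ε * (s + t - 1 / 2)) • c.2.1 + (ε * (t - 1 / 2)) • c.2.2)

theorem IsMagneticField.antisymm {B : Fin d → Fin d → Space d → ℝ} (hB : IsMagneticField B)
    (l j : Fin d) (x : Space d) : B j l x = -B l j x := by
  obtain ⟨A, hA⟩ := hB.exact
  rw [hA.represents, hA.represents]; ring

/-- The edges issuing from the first corner are `εy` and `ε(y + z)`. The `y_l y_j` part vanishes by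
antisymmetry of `B`, and `ε⁻¹` against the two edge factors `ε` leaves a single `ε`, so nothing
blows up for small `ε`. -/
theorem scaledFlux_eq {B : Fin d → Fin d → Space d → ℝ} (hB : IsMagneticField B) {ε : ℝ}
    (hε : ε ≠ 0) (x y z : Space d) : scaledFlux B ε x y z =
      ∑ p : Fin d × Fin d, y p.1 * (z p.2 * (ε * triangleAvg (B p.1 p.2) ε (x, y, z))) := by
  have hq : x + (ε / 2) • (y - z) - (x - (ε / 2) • (y + z)) = ε • y := by module
  have hr : x + (ε / 2) • (y + z) - (x - (ε / 2) • (y + z)) = ε • (y + z) := by module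
  have hp : ∀ s t : ℝ, x - (ε / 2) • (y + z) + s • ε • y + t • ε • (y + z) =
      x + (ε * (s + t - 1 / 2)) • y + (ε * (t - 1 / 2)) • z := fun s t => by module
  have hql : ∀ l, (x + (ε / 2) • (y - z)) l - (x - (ε / 2) • (y + z)) l = ε * y l := fun l => by
    rw [← PiLp.sub_apply, hq]; rfl
  have hrl : ∀ l, (x + (ε / 2) • (y + z)) l - (x - (ε / 2) • (y + z)) l = ε * (y l + z l) :=
    fun l => by rw [← PiLp.sub_apply, hr]; rfl
  unfold scaledFlux flux
  simp only [hq, hr, hp, hql, hrl]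
  have hT : ∀ l j, (∫ s in (0 : ℝ)..1, ∫ t in (0 : ℝ)..(1 - s), B l j
      (x + (ε * (s + t - 1 / 2)) • y + (ε * (t - 1 / 2)) • z)) = triangleAvg (B l j) ε (x, y, z) :=
    fun l j => rfl
  simp only [hT]
  have hanti : ∀ l j, triangleAvg (B j l) ε (x, y, z) = -triangleAvg (B l j) ε (x, y, z) := by
    intro l j
    simp only [triangleAvg, hB.antisymm l j, intervalIntegral.integral_neg]
  have h0 : ∑ l, ∑ j, y l * y j * triangleAvg (B l j) ε (x, y, z) = 0 := by
    have : ∑ l, ∑ j, y l * y j * triangleAvg (B l j) ε (x, y, z) =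
        -∑ l, ∑ j, y l * y j * triangleAvg (B l j) ε (x, y, z) := by
      conv_lhs => rw [Finset.sum_comm]
      simp only [← Finset.sum_neg_distrib]
      refine Finset.sum_congr rfl fun l _ => Finset.sum_congr rfl fun j _ => ?_
      rw [hanti]; ring
    linarith
  rw [Fintype.sum_prod_type, Finset.mul_sum]
  have h1 : ∑ l, ε⁻¹ * ∑ j, triangleAvg (B l j) ε (x, y, z) * (ε * y l) * (ε * (y j + z j)) =
      ε * (∑ l, ∑ j, y l * y j * triangleAvg (B l j) ε (x, y, z)) +
      ∑ l, ∑ j, y l * (z j * (ε * triangleAvg (B l j) ε (x, y, z))) := by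
    simp only [Finset.mul_sum, ← Finset.sum_add_distrib]
    refine Finset.sum_congr rfl fun l _ => Finset.sum_congr rfl fun j _ => ?_
    field_simp
  rw [h1, h0, mul_zero, zero_add]

theorem intervalIntegral_eq_unitInterval {E : Type*} [NormedAddCommGroup E] [NormedSpace ℝ E]
    (F : ℝ → E) : ∫ s in (0 : ℝ)..1, F s = ∫ s : unitInterval, F s := by
  rw [intervalIntegral.integral_of_le zero_le_one, ← integral_Icc_eq_integral_Ioc]
  exact (integral_subtype measurableSet_Icc F).symm

/-- The substitution `t = (1 - s)u` turns the triangle into a unit square, with Jacobian `1 - s`.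
The domain no longer depends on `s`, and `BddFamily.integral` can be applied twice. -/
theorem triangleAvg_eq (b : Space d → ℝ) (ε : ℝ) (c : Space d × Space d × Space d) :
    (triangleAvg b ε c : ℂ) = ∫ s : unitInterval, 1 * (((1 - s : ℝ) : ℂ) * ∫ u : unitInterval,
      1 * (b (c.1 + (ε * (s + (1 - s) * u - 1 / 2)) • c.2.1 +
        (ε * ((1 - s) * u - 1 / 2)) • c.2.2) : ℂ)) := by
  unfold triangleAvg
  rw [intervalIntegral_eq_unitInterval, ← integral_complex_ofReal]
  refine integral_congr_ae (Eventually.of_forall fun s => ?_)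
  simp only [one_mul]
  rw [integral_complex_ofReal, ← Complex.ofReal_mul, ← intervalIntegral_eq_unitInterval fun u =>
    b (c.1 + (ε * (s + (1 - s) * u - 1 / 2)) • c.2.1 + (ε * ((1 - s) * u - 1 / 2)) • c.2.2)]
  have h := intervalIntegral.smul_integral_comp_mul_left (a := 0) (b := 1) (fun t : ℝ =>
    b (c.1 + (ε * (s + t - 1 / 2)) • c.2.1 + (ε * (t - 1 / 2)) • c.2.2)) (1 - (s : ℝ))
  simp only [mul_zero, mul_one, smul_eq_mul] at h
  rw [h]

theorem bddFamily_triangleAvg {ε : ι → ℝ} (hεc : Continuous ε) (hε : ∀ t, |ε t| ≤ 1)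
    {b : Space d → ℝ} (hb : IsBCInfty b) (N : ℕ) :
    BddFamily N (fun _ => 1) fun t c => (triangleAvg b (ε t) c : ℂ) := by
  have hI : Integrable (fun _ : unitInterval => (1 : ℂ)) := integrable_const _
  simp only [triangleAvg_eq]
  let P1 : Space d × Space d × Space d →L[ℝ] Space d := ContinuousLinearMap.fst ℝ _ _
  let P2 : Space d × Space d × Space d →L[ℝ] Space d :=
    (ContinuousLinearMap.fst ℝ _ _).comp (ContinuousLinearMap.snd ℝ _ _)
  let P3 : Space d × Space d × Space d →L[ℝ] Space d :=
    (ContinuousLinearMap.snd ℝ _ _).comp (ContinuousLinearMap.snd ℝ _ _)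
  let α : unitInterval × unitInterval × ι → ℝ := fun p =>
    ε p.2.2 * (p.2.1 + (1 - p.2.1) * p.1 - 1 / 2)
  let β : unitInterval × unitInterval × ι → ℝ := fun p => ε p.2.2 * ((1 - p.2.1) * p.1 - 1 / 2)
  -- Since `s + (1 - s)u` lies in `[0, 1]`, the bracket is at most `1/2` in absolute value. The
  -- linear maps below are then bounded uniformly in all parameters.
  have hα : ∀ p, |α p| ≤ 1 := by
    rintro ⟨⟨u, hu0, hu1⟩, ⟨s, hs0, hs1⟩, t⟩
    simp only [α, abs_mul]
    refine mul_le_one₀ (hε t) (abs_nonneg _) (abs_le.2 ⟨?_, ?_⟩) <;> nlinarith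
  have hβ : ∀ p, |β p| ≤ 1 := by
    rintro ⟨⟨u, hu0, hu1⟩, ⟨s, hs0, hs1⟩, t⟩
    simp only [β, abs_mul]
    refine mul_le_one₀ (hε t) (abs_nonneg _) (abs_le.2 ⟨?_, ?_⟩) <;> nlinarith
  have h1 : BddFamily N (fun _ => 1) fun (p : unitInterval × unitInterval × ι) c =>
      (b ((P1 + α p • P2 + β p • P3) c) : ℂ) := by
    refine (hb.bddFamily N).comp (A := fun p => P1 + α p • P2 + β p • P3) ?_
      ⟨‖P1‖ + ‖P2‖ + ‖P3‖, fun p => ?_⟩ ⟨1, zero_le_one, by simp⟩ (by simp)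
    · simp only [_root_.add_apply, _root_.smul_apply, α, β]
      fun_prop
    · refine (norm_add₃_le).trans ?_
      rw [norm_smul, norm_smul]
      gcongr
      · exact mul_le_of_le_one_left (norm_nonneg _) (hα p)
      · exact mul_le_of_le_one_left (norm_nonneg _) (hβ p)
  have h2 := h1.integral continuous_const (fun _ => zero_le_one) hI
  have h3 := h2.const_mul (c := fun p : unitInterval × ι => (((1 - p.1 : ℝ)) : ℂ)) (by fun_prop)
    ⟨1, by
      rintro ⟨⟨s, hs0, hs1⟩, t⟩
      rw [Complex.norm_real, Real.norm_eq_abs, abs_le]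
      constructor <;> simp <;> linarith⟩
  exact h3.integral continuous_const (fun _ => zero_le_one) hI

variable {B : Fin d → Fin d → Space d → ℝ} {ε : ι → ℝ}

/-- The scaled flux as a complex function on triples. -/
def fluxFun (B : Fin d → Fin d → Space d → ℝ) (ε : ℝ) (c : Space d × Space d × Space d) : ℂ :=
  (scaledFlux B ε c.1 c.2.1 c.2.2 : ℂ)

theorem fluxFun_eq (hB : IsMagneticField B) {ε : ℝ} (hε : ε ≠ 0)
    (c : Space d × Space d × Space d) : fluxFun B ε c =
      ∑ p : Fin d × Fin d, (c.2.1 p.1 : ℂ) * ((c.2.2 p.2 : ℂ) *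
        ((ε : ℂ) * (triangleAvg (B p.1 p.2) ε c : ℂ))) := by
  rw [fluxFun, scaledFlux_eq hB hε]; push_cast; rfl

theorem polyFamily_triangleAvg (hB : IsMagneticField B) (hεc : Continuous ε) (hε : ∀ t, |ε t| ≤ 1)
    (l j : Fin d) :
    PolyFamily cfgWt fun t c => (ε t : ℂ) * (triangleAvg (B l j) (ε t) c : ℂ) :=
  (PolyFamily.of_bdd fun N => bddFamily_triangleAvg hεc hε (hB.bounded l j) N).const_mul
    (by fun_prop) ⟨1, fun t => by simpa using hε t⟩

theorem polyFamily_fluxFun (hB : IsMagneticField B) (hεc : Continuous ε) (hε : ∀ t, |ε t| ≤ 1)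
    (hε0 : ∀ t, ε t ≠ 0) : PolyFamily cfgWt fun t => fluxFun B (ε t) :=
  (PolyFamily.sum one_le_cfgWt Finset.univ fun p _ => (polyFamily_coordLeft p.1).mul
    ((polyFamily_coordRight p.2).mul (polyFamily_triangleAvg hB hεc hε p.1 p.2))).congr
    fun t c => (fluxFun_eq hB (hε0 t) c).symm

variable {G : ι → Space d × Space d × Space d → ℂ} {f g : ι → Phase d → ℂ} {m₁ m₂ ρ : ℝ}

/-- One factor of the flux is expanded into terms `y_l z_j`. Each of these moves a momentum
derivative onto `f` and another onto `g`, while `ε` times the average of `B_{lj}` is absorbed into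
`G`. Hence `G`, both symbols and both orders are free in the induction. -/
theorem symFamily_sharp_flux_pow (hρ : 0 ≤ ρ) (hB : IsMagneticField B) (hεc : Continuous ε)
    (hε : ∀ t, |ε t| ≤ 1) (hε0 : ∀ t, ε t ≠ 0) (hG : PolyFamily cfgWt G)
    (hf : ∀ N, SymFamily ρ N m₁ f) (hg : ∀ N, SymFamily ρ N m₂ g) (k N : ℕ) :
    SymFamily ρ N (m₁ + m₂ - 2 * k * ρ) fun t =>
      sharp (ε t) (fun c => fluxFun B (ε t) c ^ k * G t c) (f t) (g t) := by
  induction k generalizing G f g m₁ m₂ with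
  | zero => simpa using symFamily_sharp hρ hεc hε hG hf hg N
  | succ k ih =>
    have hγ := polyFamily_fluxFun hB hεc hε hε0
    have hT := polyFamily_triangleAvg hB hεc hε
    have hK : ∀ p : Fin d × Fin d, PolyFamily cfgWt fun t c => fluxFun B (ε t) c ^ k *
        ((ε t : ℂ) * (triangleAvg (B p.1 p.2) (ε t) c : ℂ) * G t c) := fun p =>
      (hγ.pow k).mul ((hT p.1 p.2).mul hG)
    have hfb := fun N => (hf N).bddFamily hρ
    have hgb := fun N => (hg N).bddFamily hρ
    have key : SymFamily ρ N (m₁ - ρ + (m₂ - ρ) - 2 * k * ρ) fun t X => ∑ p : Fin d × Fin d,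
        (-1 : ℂ) * sharp (ε t) (fun c => fluxFun B (ε t) c ^ k *
          ((ε t : ℂ) * (triangleAvg (B p.1 p.2) (ε t) c : ℂ) * G t c))
          (dirDeriv (momDir p.1) (f t)) (dirDeriv (momDir p.2) (g t)) X :=
      SymFamily.sum _ fun p _ => (ih ((hT p.1 p.2).mul hG)
        (fun N => ((hf (N + 1)).2.2 p.1).2) (fun N => ((hg (N + 1)).2.2 p.2).2)).const_mul
        continuous_const ⟨1, by simp⟩
    have e : m₁ - ρ + (m₂ - ρ) - 2 * k * ρ = m₁ + m₂ - 2 * ((k + 1 : ℕ) : ℝ) * ρ := by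
      push_cast; ring
    rw [e] at key
    refine key.congr fun t X => ?_
    have hw : (fun c => fluxFun B (ε t) c ^ (k + 1) * G t c) = fun c => ∑ p : Fin d × Fin d,
        (c.2.1 p.1 : ℂ) * ((c.2.2 p.2 : ℂ) * (fluxFun B (ε t) c ^ k *
          ((ε t : ℂ) * (triangleAvg (B p.1 p.2) (ε t) c : ℂ) * G t c))) := by
      ext c
      rw [pow_succ, mul_assoc]
      conv_lhs => enter [2, 1]; rw [fluxFun_eq hB (hε0 t)]
      rw [Finset.sum_mul, Finset.mul_sum]
      refine Finset.sum_congr rfl fun p _ => by ring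
    rw [hw, sharp_sum_weight Finset.univ (G := fun (p : Fin d × Fin d) t c => (c.2.1 p.1 : ℂ) *
      ((c.2.2 p.2 : ℂ) * (fluxFun B (ε t) c ^ k *
          ((ε t : ℂ) * (triangleAvg (B p.1 p.2) (ε t) c : ℂ) * G t c)))) hεc hε
      (fun p => (polyFamily_coordLeft p.1).mul ((polyFamily_coordRight p.2).mul (hK p))) hfb hgb]
    refine Finset.sum_congr rfl fun p _ => ?_
    rw [sharp_coord_mul hεc hε (hK p) hfb hgb, neg_one_mul]

theorem polyFamily_expFlux (hB : IsMagneticField B) (hεc : Continuous ε) (hε : ∀ t, |ε t| ≤ 1)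
    (hε0 : ∀ t, ε t ≠ 0) {κ : ι → ℝ} (hκ : Continuous κ) (hκb : ∀ t, |κ t| ≤ 1) :
    PolyFamily cfgWt fun t c => Complex.exp (-Complex.I * κ t * fluxFun B (ε t) c) :=
  PolyFamily.comp_real one_le_cfgWt (γ := fun t c => scaledFlux B (ε t) c.1 c.2.1 c.2.2)
    (bddFamily_exp hκ ⟨1, hκb⟩) (polyFamily_fluxFun hB hεc hε hε0)

/-- The function `s ↦ ∫₀¹ (1 - τ)^N e^{-iτκs} dτ`. -/
def taylorTail (N : ℕ) (κ s : ℝ) : ℂ :=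
  ∫ τ : unitInterval, ((1 - τ : ℝ) : ℂ) ^ N * Complex.exp (-Complex.I * ((τ * κ : ℝ) : ℂ) * s)

/-- Differentiation in `s` only brings down factors `-iτκ`, of modulus at most `1`. The bounds are
thus uniform in the coupling. -/
theorem bddFamily_taylorTail {κ : ι → ℝ} (hκ : Continuous κ) (hκb : ∀ t, |κ t| ≤ 1) (M N : ℕ) :
    BddFamily N (fun _ => 1) fun t => taylorTail M (κ t) := by
  refine BddFamily.integral (g := fun τ : unitInterval => ((1 - τ : ℝ) : ℂ) ^ M) continuous_const
    (fun _ => zero_le_one) ?_ (bddFamily_exp (κ := fun p : unitInterval × ι => p.1 * κ p.2)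
      (by fun_prop) ⟨1, ?_⟩ N)
  · exact Continuous.integrable_of_hasCompactSupport (by fun_prop) (HasCompactSupport.of_compactSpace _)
  · rintro ⟨⟨s, hs0, hs1⟩, t⟩
    simp only [abs_mul, abs_of_nonneg hs0]
    exact mul_le_one₀ hs1 (abs_nonneg _) (hκb t)

theorem polyFamily_taylorTail (hB : IsMagneticField B) (hεc : Continuous ε) (hε : ∀ t, |ε t| ≤ 1)
    (hε0 : ∀ t, ε t ≠ 0) {κ : ι → ℝ} (hκ : Continuous κ) (hκb : ∀ t, |κ t| ≤ 1) (N : ℕ) :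
    PolyFamily cfgWt fun t c => taylorTail N (κ t) (scaledFlux B (ε t) c.1 c.2.1 c.2.2) :=
  PolyFamily.comp_real one_le_cfgWt (γ := fun t c => scaledFlux B (ε t) c.1 c.2.1 c.2.2)
    (bddFamily_taylorTail hκ hκb N) (polyFamily_fluxFun hB hεc hε hε0)

/-- Integration by parts in `τ` raises the order: the boundary value at `τ = 0` supplies the next
Taylor term. -/
theorem exp_eq_taylor (N : ℕ) (z : ℂ) : Complex.exp z =
    ∑ k ∈ Finset.range (N + 1), z ^ k / (k.factorial : ℂ) +
      z ^ (N + 1) * ((N.factorial : ℂ)⁻¹ *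
        ∫ τ in (0 : ℝ)..1, ((1 - τ : ℝ) : ℂ) ^ N * Complex.exp (τ * z)) := by
  have hexp : ∀ τ : ℝ, HasDerivAt (fun τ : ℝ => Complex.exp (τ * z)) (Complex.exp (τ * z) * z) τ :=
    fun τ => by
      have := ((Complex.ofRealCLM.hasDerivAt (x := τ)).mul_const z).cexp
      simpa using this
  induction N with
  | zero =>
    have h := intervalIntegral.integral_eq_sub_of_hasDerivAt (a := 0) (b := 1)
      (fun τ _ => hexp τ) (Continuous.intervalIntegrable (by fun_prop) _ _)
    rw [intervalIntegral.integral_mul_const] at h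
    simp at h ⊢
    rw [mul_comm z, h]; ring
  | succ N ih =>
    have hF : ∀ τ : ℝ, HasDerivAt (fun τ : ℝ => ((1 - τ : ℝ) : ℂ) ^ (N + 1) * Complex.exp (τ * z))
        (-(N + 1) * (((1 - τ : ℝ) : ℂ) ^ N * Complex.exp (τ * z)) +
          z * (((1 - τ : ℝ) : ℂ) ^ (N + 1) * Complex.exp (τ * z))) τ := fun τ => by
      have h1 : HasDerivAt (fun τ : ℝ => ((1 - τ : ℝ) : ℂ)) (-1) τ := by
        simpa using ((hasDerivAt_id τ).const_sub 1).ofReal_comp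
      refine ((h1.pow (N + 1)).mul (hexp τ)).congr_deriv ?_
      push_cast
      simp only [Pi.pow_apply]; ring
    have h := intervalIntegral.integral_eq_sub_of_hasDerivAt (a := 0) (b := 1)
      (fun τ _ => hF τ) (Continuous.intervalIntegrable (by fun_prop) _ _)
    rw [intervalIntegral.integral_add (Continuous.intervalIntegrable (by fun_prop) _ _)
      (Continuous.intervalIntegrable (by fun_prop) _ _), intervalIntegral.integral_const_mul,
      intervalIntegral.integral_const_mul] at h
    simp only [sub_self, Complex.ofReal_zero, ne_eq, Nat.succ_ne_zero, not_false_eq_true, zero_pow,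
      zero_mul, sub_zero, Complex.ofReal_one, one_pow, Complex.exp_zero, mul_one, zero_sub] at h
    rw [Finset.sum_range_succ, ih, add_assoc]
    congr 1
    have hf : (((N + 1).factorial : ℕ) : ℂ) = (N + 1) * (N.factorial : ℂ) := by
      rw [Nat.factorial_succ]; push_cast; ring
    have hN : (N.factorial : ℂ) ≠ 0 := by exact_mod_cast N.factorial_ne_zero
    have hN1 : (N + 1 : ℂ) ≠ 0 := by exact_mod_cast N.succ_ne_zero
    rw [hf, mul_inv]
    set P := ∫ τ in (0 : ℝ)..1, ((1 - τ : ℝ) : ℂ) ^ N * Complex.exp (τ * z)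
    set Q := ∫ τ in (0 : ℝ)..1, ((1 - τ : ℝ) : ℂ) ^ (N + 1) * Complex.exp (τ * z)
    have hP : (N + 1) * P = 1 + z * Q := by linear_combination -h
    field_simp
    linear_combination z ^ (N + 1) * hP

theorem termWeight_eq (B : Fin d → Fin d → Space d → ℝ) (ε : ℝ) (k : ℕ)
    (c : Space d × Space d × Space d) : termWeight B ε k c.1 c.2.1 c.2.2 =
      (-Complex.I) ^ k / (k.factorial : ℂ) * fluxFun B ε c ^ k := rfl

theorem remainderWeight_eq (B : Fin d → Fin d → Space d → ℝ) (ε lam : ℝ) (N : ℕ)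
    (c : Space d × Space d × Space d) : remainderWeight B ε lam N c.1 c.2.1 c.2.2 =
      (lam : ℂ) ^ (N + 1) * ((N.factorial : ℂ)⁻¹ * (-Complex.I) ^ (N + 1) * (fluxFun B ε c ^ (N + 1) *
        taylorTail N lam (scaledFlux B ε c.1 c.2.1 c.2.2))) := by
  unfold remainderWeight taylorTail
  rw [intervalIntegral_eq_unitInterval, fluxFun, mul_pow, mul_pow]
  have : ∀ τ : ℝ, -Complex.I * lam * τ * (scaledFlux B ε c.1 c.2.1 c.2.2 : ℂ) =
      -Complex.I * ((τ * lam : ℝ) : ℂ) * (scaledFlux B ε c.1 c.2.1 c.2.2 : ℂ) := fun τ => by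
    push_cast; ring
  simp only [this]
  ring

theorem expFlux_eq (B : Fin d → Fin d → Space d → ℝ) (ε lam : ℝ) (N : ℕ)
    (c : Space d × Space d × Space d) : Complex.exp (-Complex.I * lam * fluxFun B ε c) =
      ∑ k ∈ Finset.range (N + 1), (lam : ℂ) ^ k * termWeight B ε k c.1 c.2.1 c.2.2 +
        remainderWeight B ε lam N c.1 c.2.1 c.2.2 := by
  rw [exp_eq_taylor N, remainderWeight]
  have : ∀ τ : ℝ, (τ : ℂ) * (-Complex.I * lam * fluxFun B ε c) =
      -Complex.I * lam * τ * (scaledFlux B ε c.1 c.2.1 c.2.2 : ℂ) := fun τ => by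
    rw [fluxFun]; ring
  simp only [this, termWeight_eq]
  congr 1
  · exact Finset.sum_congr rfl fun k _ => by rw [mul_pow, mul_pow]; ring
  · rw [fluxFun]; ring

end Flux

/-! ### Rapidly decreasing functions and their Fourier transforms -/

section FourierTransform

variable {ι : Type*} [TopologicalSpace ι]
variable {E : Type*} [NormedAddCommGroup E] [NormedSpace ℝ E] [PairedSpace E]
  [FiniteDimensional ℝ E] [MeasureSpace E] [BorelSpace E] [(volume : Measure E).IsAddHaarMeasure]

/-- The Fourier transform `θ ↦ ∫ e^{-i⟨x, θ⟩} u(x) dx`. -/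
def ft (u : E → ℂ) (θ : E) : ℂ := ∫ x, phase (x, θ) * u x

theorem continuous_phase_left (θ : E) : Continuous fun x : E => phase (x, θ) :=
  continuous_phase.comp (by fun_prop)

theorem Integrable.phase_mul {u : E → ℂ} (hu : Integrable u) (θ : E) :
    Integrable fun x => phase (x, θ) * u x :=
  hu.bdd_mul (c := 1) (continuous_phase_left θ).aestronglyMeasurable
    (Eventually.of_forall fun _ => (norm_phase _).le)

theorem ft_add {u v : E → ℂ} (hu : Integrable u) (hv : Integrable v) (θ : E) :
    ft (fun x => u x + v x) θ = ft u θ + ft v θ := by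
  simp only [ft, mul_add]
  exact integral_add (Integrable.phase_mul hu θ) (Integrable.phase_mul hv θ)

theorem ft_const_mul (c : ℂ) (u : E → ℂ) (θ : E) : ft (fun x => c * u x) θ = c * ft u θ := by
  simp only [ft]
  rw [← integral_const_mul]
  exact integral_congr_ae (Eventually.of_forall fun x => by simp only; ring)

theorem ft_dirDeriv {u : E → ℂ} (hd : Differentiable ℝ u) (hu : Integrable u) (v : E)
    (hv : Integrable (dirDeriv v u)) (θ : E) :
    ft (dirDeriv v u) θ = Complex.I * (pairing v θ : ℝ) * ft u θ := by
  have hp : ∀ x, HasFDerivAt (fun x : E => phase (x, θ)) ((-Complex.I * phase (x, θ)) •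
      Complex.ofRealCLM.comp (pairing.flip θ : E →L[ℝ] ℝ)) x := fun x => by
    have := HasFDerivAt.comp (g := phase) (f := fun x : E => (x, θ)) x (hasFDerivAt_phase (x, θ))
      (hasFDerivAt_prodMk_left x θ)
    refine this.congr_fderiv ?_
    ext v; simp
  have h1 : ∀ x, fderiv ℝ (fun x : E => phase (x, θ)) x v =
      -(Complex.I * (pairing v θ : ℝ)) * phase (x, θ) := fun x => by
    rw [(hp x).fderiv]; simp; ring
  have h := integral_mul_fderiv_eq_neg_fderiv_mul_of_integrable (μ := (volume : Measure E))
    (f := fun x => phase (x, θ)) (g := u) (v := v) (by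
      simp only [h1, mul_assoc]
      exact (Integrable.phase_mul hu θ).const_mul _)
    (Integrable.phase_mul hv θ) (Integrable.phase_mul hu θ)
    (fun x _ => (hp x).differentiableAt) fun x _ => hd x
  simp only [ft, dirDeriv]
  rw [h, ← integral_neg, ← integral_const_mul]
  refine integral_congr_ae (Eventually.of_forall fun x => ?_)
  simp only [h1]; ring

theorem integrable_of_bddFamily {u : ι → E → ℂ} {N : ℕ}
    (hu : BddFamily N (fun x => (wt x ^ (Module.finrank ℝ E + 1))⁻¹) u) (t : ι) :
    Integrable (u t) := by
  obtain ⟨C, hC⟩ := hu.bound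
  exact ((integrable_wt_pow_inv (volume : Measure E) le_rfl).const_mul C).mono'
    (hu.continuous_apply t).aestronglyMeasurable (Eventually.of_forall fun x => hC t x)

theorem continuous_ft [FirstCountableTopology ι] {u : ι → E → ℂ}
    (hu : BddFamily 0 (fun x => (wt x ^ (Module.finrank ℝ E + 1))⁻¹) u) :
    Continuous fun p : ι × E => ft (u p.1) p.2 := by
  obtain ⟨C, hC⟩ := hu.bound
  refine continuous_of_dominated (F := fun (p : ι × E) x => phase (x, p.2) * u p.1 x)
    (bound := fun x => C * (wt x ^ (Module.finrank ℝ E + 1))⁻¹) (fun p => ?_)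
    (fun p => Eventually.of_forall fun x => ?_)
    ((integrable_wt_pow_inv (volume : Measure E) le_rfl).const_mul C)
    (Eventually.of_forall fun x => ?_)
  · exact (continuous_phase_left p.2).mul (hu.continuous_apply p.1) |>.aestronglyMeasurable
  · rw [norm_mul, norm_phase, one_mul]; exact hC _ _
  · exact (continuous_phase.comp (by fun_prop)).mul
      (hu.continuous.comp (continuous_fst.prodMk continuous_const))

/-- The transform of `u` equals `coef v θ` times that of `u + ∂_v u`. The argument is repeated along
`n` copies of the frame, and the final bound is uniform in the index. -/
theorem exists_norm_ft_le {u : ι → E → ℂ}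
    (hu : ∀ N, BddFamily N (fun x => (wt x ^ (Module.finrank ℝ E + 1))⁻¹) u) (n : ℕ) :
    ∃ C, 0 ≤ C ∧ ∀ t θ, ‖ft (u t) θ‖ ≤ C * (wt θ ^ n)⁻¹ := by
  have key : ∀ (l : List E) (u : ι → E → ℂ),
      (∀ N, BddFamily N (fun x => (wt x ^ (Module.finrank ℝ E + 1))⁻¹) u) →
      ∃ C, 0 ≤ C ∧ ∀ t θ, ‖ft (u t) θ‖ ≤ C * (l.map fun v => coefWt v θ).prod := by
    intro l
    induction l with
    | nil =>
      intro u hu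
      obtain ⟨C, hC0, hC⟩ := (hu 0).exists_bound_pos fun x => inv_nonneg.2 (pow_nonneg (wt_nonneg _) _)
      refine ⟨∫ x : E, C * (wt x ^ (Module.finrank ℝ E + 1))⁻¹, integral_nonneg fun x =>
        mul_nonneg hC0 (inv_nonneg.2 (pow_nonneg (wt_nonneg _) _)), fun t θ => ?_⟩
      simp only [List.map_nil, List.prod_nil, mul_one]
      refine norm_integral_le_of_norm_le
        ((integrable_wt_pow_inv (volume : Measure E) le_rfl).const_mul C)
        (Eventually.of_forall fun x => ?_)
      rw [norm_mul, norm_phase, one_mul]; exact hC t x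
    | cons v l ih =>
      intro u hu
      obtain ⟨C, hC0, hC⟩ := ih (fun t x => u t x + dirDeriv v (u t) x) fun N =>
        (hu N).add ((hu (N + 1)).2.2 v)
      refine ⟨2 * C, by positivity, fun t θ => ?_⟩
      have h1 := ft_add (integrable_of_bddFamily (hu 0) t)
        (integrable_of_bddFamily ((hu 1).2.2 v) t) θ
      rw [ft_dirDeriv ((hu 1).2.1 t) (integrable_of_bddFamily (hu 0) t) v
        (integrable_of_bddFamily ((hu 1).2.2 v) t)] at h1
      have h2 : ft (u t) θ = coef v θ * ft (fun x => u t x + dirDeriv v (u t) x) θ := by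
        rw [h1, ← one_add_mul, coef, inv_mul_cancel_left₀ (one_add_I_mul_ne_zero _)]
      rw [h2, norm_mul, List.map_cons, List.prod_cons]
      calc _ ≤ 2 * coefWt v θ * (C * (l.map fun v => coefWt v θ).prod) :=
            mul_le_mul (norm_coef_le v θ) (hC t θ) (norm_nonneg _)
              (mul_nonneg zero_le_two (coefWt_nonneg _ _))
        _ = _ := by ring
  obtain ⟨C, hC0, hC⟩ := key (frames E n) u hu
  obtain ⟨D, hD0, hD⟩ := exists_prod_frames_le (E := E) n
  refine ⟨C * D, mul_nonneg hC0 hD0, fun t θ => (hC t θ).trans ?_⟩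
  rw [mul_assoc]
  exact mul_le_mul_of_nonneg_left (hD θ) hC0

end FourierTransform

/-- Fourier inversion. -/
theorem ft_ft {d : ℕ} {h : Space d → ℂ} (hc : Continuous h) (hi : Integrable h)
    (hF : Integrable (ft h)) (p : Space d) : ft (ft h) (-p) = ((2 * Real.pi) ^ d : ℝ) * h p := by
  have hpi : (2 * Real.pi) ≠ 0 := by positivity
  -- The transform with kernel `e^{-2πi x·w}` is a dilation of `ft` by `2π`; the Jacobian of this
  -- dilation is the source of `(2π)^d`.
  have e1 : FourierTransform.fourier h = fun w => ft h ((2 * Real.pi) • w) := by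
    ext w
    rw [Real.fourier_eq']
    refine integral_congr_ae (Eventually.of_forall fun x => ?_)
    simp only [phase, pairing_space, inner_smul_right, smul_eq_mul]
    congr 2
    push_cast; ring
  have hF' : Integrable (FourierTransform.fourier h) := by
    rw [e1]; exact (integrable_comp_smul_iff volume (ft h) hpi).2 hF
  have h1 := congrFun (hc.fourierInv_fourier_eq hi hF') p
  rw [Real.fourierInv_eq', e1] at h1
  have h2 := Measure.integral_comp_smul (volume : Measure (Space d))
    (fun η => phase (η, -p) * ft h η) (2 * Real.pi)
  have h3 : (∫ w : Space d, Complex.exp (((2 * Real.pi * inner ℝ w p : ℝ) : ℂ) * Complex.I) •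
      ft h ((2 * Real.pi) • w)) =
      ∫ w : Space d, phase ((2 * Real.pi) • w, -p) * ft h ((2 * Real.pi) • w) := by
    refine integral_congr_ae (Eventually.of_forall fun x => ?_)
    simp only [phase, pairing_space, inner_smul_left, inner_neg_right, smul_eq_mul]
    congr 2
    push_cast; simp; ring
  rw [h3, h2, finrank_euclideanSpace_fin, abs_of_pos (by positivity)] at h1
  rw [← h1, ft, Complex.real_smul, ← mul_assoc, ← Complex.ofReal_mul, mul_inv_cancel₀ (by positivity)]
  simp

/-! ### Rapidly decreasing families and Schwartz functions. -/

section Rapid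

variable {ι κ : Type*} [TopologicalSpace ι] [TopologicalSpace κ]
variable {H : Type*} [NormedAddCommGroup H] [NormedSpace ℝ H]
variable {K : Type*} [NormedAddCommGroup K] [NormedSpace ℝ K]

/-- Families of rapidly decreasing functions. -/
def RapidFamily (u : ι → H → ℂ) : Prop := ∀ N k : ℕ, BddFamily N (fun x => (wt x ^ k)⁻¹) u

theorem wt_pow_inv_nonneg (k : ℕ) (x : H) : 0 ≤ (wt x ^ k)⁻¹ := inv_nonneg.2 (pow_nonneg (wt_nonneg _) _)

theorem wt_pow_inv_le_one (k : ℕ) (x : H) : (wt x ^ k)⁻¹ ≤ 1 :=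
  inv_le_one_of_one_le₀ (one_le_pow₀ (one_le_wt x))

theorem wt_pow_inv_mul_pow (k n : ℕ) (x : H) : (wt x ^ (k + n))⁻¹ * wt x ^ n = (wt x ^ k)⁻¹ := by
  have := (wt_pos x).ne'
  rw [pow_add]; field_simp

namespace RapidFamily

variable {u v : ι → H → ℂ}

theorem mul_poly (hu : RapidFamily u) (hv : PolyFamily wt v) :
    RapidFamily fun t x => u t x * v t x := fun N k => by
  obtain ⟨n, hn⟩ := hv N
  simpa only [wt_pow_inv_mul_pow] using (hu N (k + n)).mul hn

theorem reindex {e : κ → ι} (he : Continuous e) (hu : RapidFamily u) :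
    RapidFamily fun t => u (e t) := fun N k => (hu N k).reindex he

theorem bddFamily (hu : RapidFamily u) (N : ℕ) : BddFamily N (fun _ => 1) u :=
  (hu N 0).mono' (fun x => by simp) fun x => by simp

theorem comp_const [FiniteDimensional ℝ K] {u : ι → K → ℂ} (A : H →L[ℝ] K)
    (hA : ∃ C, 0 ≤ C ∧ ∀ x, wt x ≤ C * wt (A x)) (hu : RapidFamily u) :
    RapidFamily fun t x => u t (A x) := fun N k => by
  obtain ⟨C, hC0, hC⟩ := hA
  refine (hu N k).comp_const A ⟨C ^ k, pow_nonneg hC0 k, fun x => ?_⟩ (wt_pow_inv_nonneg k)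
  rw [← div_eq_mul_inv, le_div_iff₀ (pow_pos (wt_pos _) _), inv_mul_le_iff₀ (pow_pos (wt_pos _) _),
    mul_comm, ← mul_pow]
  exact pow_le_pow_left₀ (wt_nonneg _) (hC x) k

theorem contDiff [FiniteDimensional ℝ H] (hu : RapidFamily u) (t : ι) : ContDiff ℝ ∞ (u t) :=
  BddFamily.contDiff_infty (fun N => hu N 0) t

theorem congr (h : RapidFamily u) (huv : ∀ t x, u t x = v t x) : RapidFamily v :=
  fun N k => (h N k).congr huv

theorem integrable [FiniteDimensional ℝ H] [MeasureSpace H] [BorelSpace H]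
    [(volume : Measure H).IsAddHaarMeasure] [PairedSpace H] (hu : RapidFamily u) (t : ι) :
    Integrable (u t) := integrable_of_bddFamily (hu 0 _) t

end RapidFamily

theorem wt_smul_le (c : ℝ) (x : H) : wt (c • x) ≤ (1 + |c|) * wt x := by
  simp only [wt, norm_smul, Real.norm_eq_abs]
  nlinarith [norm_nonneg x, abs_nonneg c]

theorem RapidFamily.dilate [FiniteDimensional ℝ H] {u : ι → H → ℂ} (hu : RapidFamily u) {δ : ℝ}
    (hδ : δ ≠ 0) : RapidFamily fun t x => u t (δ • x) := by
  refine (hu.comp_const (δ • ContinuousLinearMap.id ℝ H) ⟨1 + |δ⁻¹|, by positivity, fun x => ?_⟩).congr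
    fun t x => rfl
  have := wt_smul_le δ⁻¹ (δ • x)
  rwa [inv_smul_smul₀ hδ] at this

theorem SchwartzMap.rapidFamily (φ : 𝓢(H, ℂ)) : RapidFamily fun _ : ι => (φ : H → ℂ) := fun N k =>
  bddFamily_of_iteratedFDeriv φ.smooth' fun n _ =>
    ⟨_, fun x => by
      have h := SchwartzMap.one_add_le_sup_seminorm_apply (𝕜 := ℝ) (m := (k, n)) le_rfl le_rfl φ x
      rw [← div_eq_mul_inv, le_div_iff₀ (pow_pos (wt_pos _) _), mul_comm]
      exact h⟩

/-- In a basis the total derivative is a finite sum of constant linear maps applied to directional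
derivatives, which converts bounds along directions into bounds of the iterated derivative. -/
theorem norm_iteratedFDeriv_le_of_bddFamily [FiniteDimensional ℝ H] {w : H → ℝ} (hw : ∀ x, 0 ≤ w x)
    {u : H → ℂ} {N : ℕ} (hu : BddFamily N w fun _ : Unit => u) :
    ∃ C, 0 ≤ C ∧ ∀ x, ‖iteratedFDeriv ℝ N u x‖ ≤ C * w x := by
  induction N generalizing u with
  | zero =>
    obtain ⟨C, hC0, hC⟩ := hu.exists_bound_pos hw
    exact ⟨C, hC0, fun x => by simpa using hC () x⟩
  | succ N ih =>
    let e := Module.finBasis ℝ H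
    have hs : ∀ v, ContDiff ℝ N (dirDeriv v u) := fun v => (hu.2.2 v).contDiff ()
    choose C hC0 hC using fun i => ih (hu.2.2 (e i))
    let c : Fin (Module.finrank ℝ H) → H →L[ℝ] ℝ := fun i => LinearMap.toContinuousLinearMap (e.coord i)
    let L : ∀ i, ℂ →L[ℝ] (H →L[ℝ] ℂ) := fun i =>
      (ContinuousLinearMap.smulRightL ℝ H ℂ (c i))
    have hsum : fderiv ℝ u = fun x => ∑ i, L i (dirDeriv (e i) u x) := by
      ext x v
      refine (congrArg (fderiv ℝ u x) (e.sum_repr v).symm).trans ?_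
      rw [map_sum]
      simp [L, c, dirDeriv]
    refine ⟨∑ i, ‖L i‖ * C i, Finset.sum_nonneg fun i _ => mul_nonneg (L i).opNorm_nonneg (hC0 i),
      fun x => ?_⟩
    rw [← norm_iteratedFDeriv_fderiv, hsum]
    have h1 : iteratedFDeriv ℝ N (fun x => ∑ i, L i (dirDeriv (e i) u x)) x =
        ∑ i, iteratedFDeriv ℝ N (fun x => L i (dirDeriv (e i) u x)) x :=
      iteratedFDeriv_fun_sum_apply fun i _ => ((L i).contDiff.comp (hs _)).contDiffAt
    rw [h1, Finset.sum_mul]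
    refine (norm_sum_le _ _).trans (Finset.sum_le_sum fun i _ => ?_)
    rw [mul_assoc]
    exact ((L i).norm_iteratedFDeriv_comp_left (hs _).contDiffAt le_rfl).trans
      (mul_le_mul_of_nonneg_left (hC i x) (L i).opNorm_nonneg)

theorem RapidFamily.exists_schwartzMap [FiniteDimensional ℝ H] {u : H → ℂ}
    (hu : RapidFamily fun _ : Unit => u) : ∃ φ : 𝓢(H, ℂ), ⇑φ = u := by
  refine ⟨⟨u, hu.contDiff (), fun k n => ?_⟩, rfl⟩
  obtain ⟨C, hC0, hC⟩ := norm_iteratedFDeriv_le_of_bddFamily (wt_pow_inv_nonneg k) (hu n k)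
  refine ⟨C, fun x => ?_⟩
  calc _ ≤ wt x ^ k * (C * (wt x ^ k)⁻¹) := by
        refine mul_le_mul (pow_le_pow_left₀ (norm_nonneg _) (by simp [wt]) k) (hC x) (norm_nonneg _)
          (pow_nonneg (wt_nonneg _) _)
    _ = C := by have := (wt_pos x).ne'; field_simp

end Rapid

/-! ### The partial Fourier transform in the second variable. -/

section PartialFourier

variable {Q : Type*} [NormedAddCommGroup Q] [NormedSpace ℝ Q]
variable {E : Type*} [NormedAddCommGroup E] [NormedSpace ℝ E] [PairedSpace E]
  [FiniteDimensional ℝ E] [MeasureSpace E] [BorelSpace E] [(volume : Measure E).IsAddHaarMeasure]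

theorem wt_fst_le {H K : Type*} [NormedAddCommGroup H] [NormedAddCommGroup K] (h : H × K) :
    wt h.1 ≤ wt h := add_le_add le_rfl (norm_fst_le h)

theorem wt_snd_le {H K : Type*} [NormedAddCommGroup H] [NormedAddCommGroup K] (h : H × K) :
    wt h.2 ≤ wt h := add_le_add le_rfl (norm_snd_le h)

theorem wt_prod_le {H K : Type*} [NormedAddCommGroup H] [NormedAddCommGroup K] (h : H × K) :
    wt h ≤ wt h.1 * wt h.2 := by
  simp only [wt, Prod.norm_def]
  rcases max_cases ‖h.1‖ ‖h.2‖ with e | e <;>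
    nlinarith [norm_nonneg h.1, norm_nonneg h.2, mul_nonneg (norm_nonneg h.1) (norm_nonneg h.2)]

theorem wt_pow_inv_prod_le {H K : Type*} [NormedAddCommGroup H] [NormedAddCommGroup K] (k : ℕ)
    (h : H × K) : (wt h ^ (2 * k))⁻¹ ≤ (wt h.1 ^ k)⁻¹ * (wt h.2 ^ k)⁻¹ := by
  rw [← mul_inv, two_mul, pow_add]
  exact inv_anti₀ (mul_pos (pow_pos (wt_pos _) _) (pow_pos (wt_pos _) _))
    (mul_le_mul (pow_le_pow_left₀ (wt_nonneg _) (wt_fst_le h) k)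
      (pow_le_pow_left₀ (wt_nonneg _) (wt_snd_le h) k) (pow_nonneg (wt_nonneg _) _)
      (pow_nonneg (wt_nonneg _) _))

theorem wt_pow_inv_mul_le {H K : Type*} [NormedAddCommGroup H] [NormedAddCommGroup K] (k : ℕ)
    (h : H × K) : (wt h.1 ^ k)⁻¹ * (wt h.2 ^ k)⁻¹ ≤ (wt h ^ k)⁻¹ := by
  rw [← mul_inv, ← mul_pow]
  exact inv_anti₀ (pow_pos (wt_pos _) _) (pow_le_pow_left₀ (wt_nonneg _) (wt_prod_le h) k)

/-- The partial Fourier transform in the second variable. -/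
def pft (u : Q × E → ℂ) (h : Q × E) : ℂ := ft (fun x => u (h.1, x)) h.2

/-- The first variable becomes an index. The factor `wt q ^ k` is multiplied in beforehand and
divided out in `exists_norm_pft_le`, where it shows up as decay in `q`. -/
theorem RapidFamily.slice_bdd [FiniteDimensional ℝ Q] {u : Q × E → ℂ}
    (hu : RapidFamily fun _ : Unit => u) (k N : ℕ) :
    BddFamily N (fun x : E => (wt x ^ (Module.finrank ℝ E + 1))⁻¹) fun (q : Q) x =>
      ((((wt q ^ k)⁻¹)⁻¹ : ℝ) : ℂ) * u (q, x) := by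
  let A : E × Q →L[ℝ] Q × E :=
    (ContinuousLinearMap.snd ℝ E Q).prod (ContinuousLinearMap.fst ℝ E Q)
  set n := k + (Module.finrank ℝ E + 1)
  have h1 : BddFamily N (fun h : E × Q => (wt h.1 ^ (Module.finrank ℝ E + 1))⁻¹ * (wt h.2 ^ k)⁻¹)
      fun (_ : Unit) h => u (A h) := by
    -- Joint decay of order `2n` dominates separate decay of order `n` in each of the two variables.
    refine (hu N (2 * n)).comp_const A ⟨1, zero_le_one, fun h => ?_⟩ (wt_pow_inv_nonneg _)
    rw [one_mul]
    refine (wt_pow_inv_prod_le n (A h)).trans ?_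
    rw [mul_comm]
    refine mul_le_mul (inv_anti₀ (pow_pos (wt_pos _) _) (pow_le_pow_right₀ (one_le_wt _) (by omega)))
      (inv_anti₀ (pow_pos (wt_pos _) _) (pow_le_pow_right₀ (one_le_wt _) (by omega)))
      (wt_pow_inv_nonneg _ _) (wt_pow_inv_nonneg _ _)
  exact (BddFamily.slice (om := fun x : E => (wt x ^ (Module.finrank ℝ E + 1))⁻¹)
    (ρ := fun q : Q => (wt q ^ k)⁻¹) (continuous_wt_pow_inv k) (fun z => inv_pos.2 (pow_pos (wt_pos z) k)) h1).reindex
    (f := fun q : Q => (q, ())) (by fun_prop)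

theorem RapidFamily.continuous_pft [FiniteDimensional ℝ Q] {u : Q × E → ℂ}
    (hu : RapidFamily fun _ : Unit => u) : Continuous (pft u) := by
  have := continuous_ft (hu.slice_bdd 0 0)
  exact this.congr fun p => by simp [pft]

theorem RapidFamily.exists_norm_pft_le [FiniteDimensional ℝ Q] {u : Q × E → ℂ}
    (hu : RapidFamily fun _ : Unit => u) (k : ℕ) : ∃ C, 0 ≤ C ∧
      ∀ h : Q × E, ‖pft u h‖ ≤ C * ((wt h.1 ^ k)⁻¹ * (wt h.2 ^ k)⁻¹) := by
  obtain ⟨C, hC0, hC⟩ := exists_norm_ft_le (fun N => hu.slice_bdd k N) k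
  refine ⟨C, hC0, fun h => ?_⟩
  have := hC h.1 h.2
  rw [ft_const_mul, norm_mul, inv_inv, Complex.norm_real, Real.norm_of_nonneg
    (pow_nonneg (wt_nonneg _) _), ← le_inv_mul_iff₀ (pow_pos (wt_pos _) _)] at this
  exact this.trans_eq (by ring)

end PartialFourier

/-! ### The kernel form of twisted products -/

/-- Regroups `((y, η), (z, ζ))` as `((y, z), (η, ζ))`, so that position and momentum integrations
can be separated. -/
theorem measurePreserving_interchange {α : Type*} [MeasureSpace α]
    [SFinite (volume : Measure α)] : MeasurePreserving
      (fun p : (α × α) × (α × α) => (((p.1.1, p.2.1), (p.1.2, p.2.2)) : (α × α) × (α × α))) := by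
  have hA : MeasurePreserving (fun p : (α × α) × (α × α) => (p.1.1, (p.1.2, p.2))) :=
    volume_preserving_prodAssoc
  have hA' : MeasurePreserving (fun p : α × (α × (α × α)) => ((p.1, p.2.1), p.2.2)) :=
    volume_preserving_prodAssoc.symm MeasurableEquiv.prodAssoc
  have hB : MeasurePreserving (fun p : α × (α × α) => ((p.1, p.2.1), p.2.2)) :=
    volume_preserving_prodAssoc.symm MeasurableEquiv.prodAssoc
  have hB' : MeasurePreserving (fun p : (α × α) × α => (p.1.1, (p.1.2, p.2))) :=
    volume_preserving_prodAssoc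
  have hS : MeasurePreserving (fun p : (α × α) × α => ((p.1.2, p.1.1), p.2)) :=
    (Measure.measurePreserving_swap (μ := (volume : Measure α)) (ν := (volume : Measure α))).prod
      (MeasurePreserving.id _)
  have hT : MeasurePreserving (fun p : α × (α × α) => (p.2.1, (p.1, p.2.2))) := hB'.comp (hS.comp hB)
  have hT' : MeasurePreserving (fun p : α × (α × (α × α)) => (p.1, (p.2.2.1, (p.2.1, p.2.2.2)))) :=
    (MeasurePreserving.id _).prod hT
  exact hA'.comp (hT'.comp hA)

theorem integral_interchange {α E : Type*} [MeasureSpace α] [SFinite (volume : Measure α)]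
    [NormedAddCommGroup E] [NormedSpace ℝ E] (F : (α × α) × (α × α) → E) :
    ∫ p : (α × α) × (α × α), F ((p.1.1, p.2.1), (p.1.2, p.2.2)) = ∫ p, F p := by
  let e : (α × α) × (α × α) ≃ᵐ (α × α) × (α × α) :=
    { toFun := fun p => ((p.1.1, p.2.1), (p.1.2, p.2.2))
      invFun := fun p => ((p.1.1, p.2.1), (p.1.2, p.2.2))
      left_inv := fun _ => rfl
      right_inv := fun _ => rfl
      measurable_toFun := measurePreserving_interchange.measurable
      measurable_invFun := measurePreserving_interchange.measurable }
  exact measurePreserving_interchange.integral_comp e.measurableEmbedding F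

theorem integral_volume_prod {α β E : Type*} [MeasureSpace α] [MeasureSpace β]
    [SFinite (volume : Measure α)] [SFinite (volume : Measure β)] [NormedAddCommGroup E]
    [NormedSpace ℝ E] {F : α × β → E} (hF : Integrable F) : ∫ p, F p = ∫ x, ∫ y, F (x, y) :=
  integral_prod F hF

section Kernel

variable {d : ℕ}

theorem symplecticFourier_eq (u : Phase d → ℂ) (Y : Phase d) :
    symplecticFourier u Y = (((2 * Real.pi) ^ d : ℝ) : ℂ)⁻¹ * ft u (-Y.2, Y.1) := by
  unfold symplecticFourier ft
  congr 1
  refine integral_congr_ae (Eventually.of_forall fun x => ?_)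
  simp only [phase, symplectic, pairing_prod, pairing_space, inner_neg_right]
  rw [real_inner_comm x.1 Y.2, real_inner_comm x.2 Y.1]
  congr 2
  push_cast; ring

theorem ft_prod {u : Phase d → ℂ} (hu : Integrable u) (θ : Phase d) :
    ft u θ = ft (fun p => pft u (p, θ.2)) θ.1 := by
  unfold ft
  rw [integral_volume_prod (Integrable.phase_mul hu θ)]
  refine integral_congr_ae (Eventually.of_forall fun x => ?_)
  simp only [pft, ft]
  rw [← integral_const_mul]
  refine integral_congr_ae (Eventually.of_forall fun y => ?_)
  simp only [phase, pairing_prod]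
  rw [← mul_assoc, ← Complex.exp_add]
  congr 2
  push_cast; ring

variable {u v : Phase d → ℂ}

theorem RapidFamily.exists_norm_symplecticFourier_le (hu : RapidFamily fun _ : Unit => u) (k : ℕ) :
    ∃ C, 0 ≤ C ∧ ∀ Y, ‖symplecticFourier u Y‖ ≤ C * (wt Y ^ k)⁻¹ := by
  obtain ⟨C, hC0, hC⟩ := exists_norm_ft_le (fun N => hu N _) k
  refine ⟨‖(((2 * Real.pi) ^ d : ℝ) : ℂ)⁻¹‖ * C, mul_nonneg (norm_nonneg _) hC0, fun Y => ?_⟩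
  rw [symplecticFourier_eq, norm_mul, mul_assoc]
  have e : wt ((-Y.2, Y.1) : Phase d) = wt Y := by simp [wt, Prod.norm_def, max_comm]
  rw [← e]
  exact mul_le_mul_of_nonneg_left (hC () _) (norm_nonneg _)

theorem RapidFamily.continuous_symplecticFourier (hu : RapidFamily fun _ : Unit => u) :
    Continuous (symplecticFourier u) := by
  have h := continuous_ft (hu 0 (Module.finrank ℝ (Phase d) + 1))
  have h2 : Continuous fun Y : Phase d => ((() , (-Y.2, Y.1)) : Unit × Phase d) := by fun_prop
  have := (h.comp h2).const_mul ((((2 * Real.pi) ^ d : ℝ) : ℂ)⁻¹)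
  exact this.congr fun Y => (symplecticFourier_eq u Y).symm

/-- The symplectic transform is the full Fourier transform evaluated at `(-η, y)`. Integrating over
`η` inverts its position half and leaves the partial transform in momentum. -/
theorem RapidFamily.integral_phase_symplecticFourier (hu : RapidFamily fun _ : Unit => u)
    (q y : Space d) : ∫ η, phase (q, η) * symplecticFourier u (y, η) = pft u (q, y) := by
  have hpi : (((2 * Real.pi) ^ d : ℝ) : ℂ) ≠ 0 := by
    exact_mod_cast (pow_pos (by positivity : (0 : ℝ) < 2 * Real.pi) d).ne'
  have hc : Continuous fun p : Space d => pft u (p, y) := hu.continuous_pft.comp (by fun_prop)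
  have hi : Integrable fun p : Space d => pft u (p, y) := by
    obtain ⟨C, hC0, hC⟩ := hu.exists_norm_pft_le (Module.finrank ℝ (Space d) + 1)
    refine ((integrable_wt_pow_inv (volume : Measure (Space d)) le_rfl).const_mul C).mono'
      hc.aestronglyMeasurable (Eventually.of_forall fun p => (hC (p, y)).trans ?_)
    exact mul_le_mul_of_nonneg_left (mul_le_of_le_one_right (wt_pow_inv_nonneg _ _)
      (wt_pow_inv_le_one _ _)) hC0
  have hui : Integrable u := hu.integrable ()
  have hF : Integrable (ft fun p : Space d => pft u (p, y)) := by
    have e : (ft fun p : Space d => pft u (p, y)) = fun η => ft u (η, y) := by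
      ext η; rw [ft_prod hui]
    rw [e]
    obtain ⟨C, hC0, hC⟩ := exists_norm_ft_le (fun N => hu N _) (Module.finrank ℝ (Space d) + 1)
    have hcont := continuous_ft (hu 0 (Module.finrank ℝ (Phase d) + 1))
    refine ((integrable_wt_pow_inv (volume : Measure (Space d)) le_rfl).const_mul C).mono'
      (hcont.comp (by fun_prop : Continuous fun η : Space d => (((), (η, y)) : Unit × Phase d))).aestronglyMeasurable
      (Eventually.of_forall fun η => (hC () (η, y)).trans ?_)
    exact mul_le_mul_of_nonneg_left (inv_anti₀ (pow_pos (wt_pos _) _)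
      (pow_le_pow_left₀ (wt_nonneg _) (wt_fst_le (η, y)) _)) hC0
  have h := ft_ft hc hi hF q
  simp only [symplecticFourier_eq]
  rw [← integral_neg_eq_self]
  have e2 : ∀ η : Space d, phase (q, -η) * ((((2 * Real.pi) ^ d : ℝ) : ℂ)⁻¹ * ft u (- -η, y)) =
      (((2 * Real.pi) ^ d : ℝ) : ℂ)⁻¹ * (phase (η, -q) * ft (fun p => pft u (p, y)) η) := by
    intro η
    rw [neg_neg, ft_prod hui]
    have : phase (q, -η) = phase (η, -q) := by
      simp only [phase, pairing_space, inner_neg_right]; rw [real_inner_comm]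
    rw [this]; ring
  simp only [e2]
  rw [integral_const_mul]
  change _ * ft (ft fun p => pft u (p, y)) (-q) = _
  rw [h, inv_mul_cancel_left₀ hpi]

/-- The kernel form of twisted products. -/
def kernelIntegral (ε : ℝ) (G : Space d × Space d × Space d → ℂ) (u v : Phase d → ℂ)
    (X : Phase d) : ℂ := (((2 * Real.pi) ^ (2 * d) : ℝ) : ℂ)⁻¹ * ∫ w : Phase d,
      phase (w, (-X.2, -X.2)) * (G (X.1, w) *
        (pft u (X.1 - (ε / 2) • w.2, w.1) * pft v (X.1 + (ε / 2) • w.1, w.2)))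

variable {G : Space d × Space d × Space d → ℂ}

/-- Everything converges absolutely here. The two exponentials combine into `e^{iξ·(y+z)}` and one
factor each for `η` and `ζ`; these two integrals separate and are evaluated by Fourier inversion at
`x - εz/2` and `x + εy/2`. -/
theorem twistedIntegral_eq_kernelIntegral (ε : ℝ) (hGc : Continuous G)
    (hG : ∃ C k, 0 ≤ C ∧ ∀ c, ‖G c‖ ≤ C * cfgWt c ^ k)
    (hu : RapidFamily fun _ : Unit => u) (hv : RapidFamily fun _ : Unit => v) (X : Phase d) :
    twistedIntegral ε (fun x y z => G (x, y, z)) u v X = kernelIntegral ε G u v X := by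
  obtain ⟨C, k, hC0, hC⟩ := hG
  set n := Module.finrank ℝ (Phase d) + 1 with hn
  obtain ⟨Cu, hCu0, hCu⟩ := hu.exists_norm_symplecticFourier_le (n + k)
  obtain ⟨Cv, hCv0, hCv⟩ := hv.exists_norm_symplecticFourier_le (n + k)
  have hcu := hu.continuous_symplecticFourier
  have hcv := hv.continuous_symplecticFourier
  set F : Phase d × Phase d → ℂ := fun p =>
    Complex.exp (Complex.I * (symplectic X (p.1 + p.2) : ℂ)) *
    Complex.exp (Complex.I * (ε / 2) * (symplectic p.1 p.2 : ℂ)) *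
    G (X.1, p.1.1, p.2.1) * symplecticFourier u p.1 * symplecticFourier v p.2 with hFdef
  have hFc : Continuous F := by
    simp only [hFdef, symplectic]
    fun_prop
  have hFb : ∀ p, ‖F p‖ ≤ C * Cu * Cv * ((wt p.1 ^ n)⁻¹ * (wt p.2 ^ n)⁻¹) := by
    intro p
    have e1 : ‖Complex.exp (Complex.I * (symplectic X (p.1 + p.2) : ℂ))‖ = 1 := by
      rw [Complex.norm_exp]; simp
    have e2 : ‖Complex.exp (Complex.I * (ε / 2) * (symplectic p.1 p.2 : ℂ))‖ = 1 := by
      rw [show Complex.I * (ε / 2) * (symplectic p.1 p.2 : ℂ) =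
        ((ε / 2 * symplectic p.1 p.2 : ℝ) : ℂ) * Complex.I by push_cast; ring,
        Complex.norm_exp_ofReal_mul_I]
    simp only [hFdef, norm_mul, e1, e2, one_mul]
    have hw : cfgWt (X.1, p.1.1, p.2.1) ≤ wt p.1 * wt p.2 :=
      (wt_prod_le (p.1.1, p.2.1)).trans (mul_le_mul (wt_fst_le p.1) (wt_fst_le p.2) (wt_nonneg _)
        (wt_nonneg _))
    have hG1 : ‖G (X.1, p.1.1, p.2.1)‖ ≤ C * (wt p.1 ^ k * wt p.2 ^ k) := by
      refine (hC _).trans (mul_le_mul_of_nonneg_left ?_ hC0)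
      rw [← mul_pow]
      exact pow_le_pow_left₀ (wt_nonneg _) hw k
    have h0 := wt_nonneg p.1
    have h0' := wt_nonneg p.2
    calc _ ≤ C * (wt p.1 ^ k * wt p.2 ^ k) * (Cu * (wt p.1 ^ (n + k))⁻¹) *
          (Cv * (wt p.2 ^ (n + k))⁻¹) := by
          refine mul_le_mul (mul_le_mul hG1 (hCu _) (norm_nonneg _) (by positivity)) (hCv _)
            (norm_nonneg _) (by positivity)
      _ = C * Cu * Cv * (((wt p.1 ^ (n + k))⁻¹ * wt p.1 ^ k) *
          ((wt p.2 ^ (n + k))⁻¹ * wt p.2 ^ k)) := by ring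
      _ = _ := by rw [wt_pow_inv_mul_pow, wt_pow_inv_mul_pow]
  have hFi : Integrable F := by
    refine Integrable.mono' (g := fun p : Phase d × Phase d =>
      C * Cu * Cv * ((wt p.1 ^ n)⁻¹ * (wt p.2 ^ n)⁻¹)) (Integrable.const_mul ?_ _)
      hFc.aestronglyMeasurable (Eventually.of_forall hFb)
    exact (integrable_wt_pow_inv (volume : Measure (Phase d)) le_rfl).mul_prod
      (integrable_wt_pow_inv (volume : Measure (Phase d)) le_rfl)
  have h1 : twistedIntegral ε (fun x y z => G (x, y, z)) u v X =
      (((2 * Real.pi) ^ (2 * d) : ℝ) : ℂ)⁻¹ * ∫ p, F p := by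
    rw [twistedIntegral, integral_volume_prod hFi]
  have hFi' : Integrable fun p : Phase d × Phase d => F ((p.1.1, p.2.1), (p.1.2, p.2.2)) :=
    measurePreserving_interchange.integrable_comp hFi.aestronglyMeasurable |>.2 hFi
  rw [h1, ← integral_interchange F, integral_volume_prod hFi',
    kernelIntegral]
  congr 1
  refine integral_congr_ae (Eventually.of_forall fun w => ?_)
  have h2 : ∀ θ : Phase d, F ((w.1, θ.1), (w.2, θ.2)) =
      phase (w, (-X.2, -X.2)) * G (X.1, w) *
        ((phase (X.1 - (ε / 2) • w.2, θ.1) * symplecticFourier u (w.1, θ.1)) *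
          (phase (X.1 + (ε / 2) • w.1, θ.2) * symplecticFourier v (w.2, θ.2))) := by
    intro θ
    have e : Complex.exp (Complex.I * (symplectic X ((w.1, θ.1) + (w.2, θ.2)) : ℂ)) *
        Complex.exp (Complex.I * (ε / 2) * (symplectic (w.1, θ.1) (w.2, θ.2) : ℂ)) =
        phase (w, (-X.2, -X.2)) * (phase (X.1 - (ε / 2) • w.2, θ.1) *
          phase (X.1 + (ε / 2) • w.1, θ.2)) := by
      simp only [phase, ← Complex.exp_add]
      congr 1
      simp only [symplectic, pairing_prod, pairing_space, inner_add_left, inner_add_right,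
        inner_sub_left, inner_neg_right, inner_smul_left, Prod.fst_add, Prod.snd_add]
      rw [real_inner_comm w.1 X.2, real_inner_comm w.2 X.2, real_inner_comm w.2 θ.1]
      push_cast
      simp only [conj_trivial]
      push_cast
      ring
    simp only [hFdef]
    rw [e]; ring
  simp only [h2]
  rw [integral_const_mul, Measure.volume_eq_prod, integral_prod_mul (fun η => phase (X.1 - (ε / 2) • w.2, η) *
    symplecticFourier u (w.1, η)) (fun ζ => phase (X.1 + (ε / 2) • w.1, ζ) *
    symplecticFourier v (w.2, ζ)), hu.integral_phase_symplecticFourier,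
    hv.integral_phase_symplecticFourier]
  ring

theorem wt_le_of_add_smul (x y : Space d) {ε : ℝ} (hε : ε ≠ 0) :
    wt y ≤ (1 + |ε⁻¹|) * wt x * wt (x + ε • y) := by
  have h : y = ε⁻¹ • ((x + ε • y) - x) := by
    rw [add_sub_cancel_left, inv_smul_smul₀ hε]
  calc wt y = wt (ε⁻¹ • ((x + ε • y) - x)) := by rw [← h]
    _ ≤ (1 + |ε⁻¹|) * wt ((x + ε • y) - x) := wt_smul_le _ _
    _ ≤ (1 + |ε⁻¹|) * (wt (x + ε • y) * wt x) :=
        mul_le_mul_of_nonneg_left (wt_sub_le _ _) (by positivity)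
    _ = _ := by ring

theorem RapidFamily.exists_norm_shift_le (hu : RapidFamily fun _ : Unit => u) (n : ℕ) (x ξ : Space d)
    {ε : ℝ} (hε : ε ≠ 0) : ∃ C, 0 ≤ C ∧ ∀ y η : Space d,
      ‖u (x + ε • y, ξ + η)‖ ≤ C * ((wt y ^ n)⁻¹ * (wt η ^ n)⁻¹) := by
  obtain ⟨C, hC0, hC⟩ := (hu 0 (2 * n)).exists_bound_pos (wt_pow_inv_nonneg _)
  have hx := wt_pos x
  have hξ := wt_pos ξ
  refine ⟨C * (((1 + |ε⁻¹|) * wt x) ^ n * wt ξ ^ n), by positivity, fun y η => ?_⟩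
  have hy := wt_pos y
  have hη := wt_pos η
  have hq := wt_pos (x + ε • y)
  have hk := wt_pos (ξ + η)
  refine (hC () _).trans ?_
  rw [mul_assoc]
  refine mul_le_mul_of_nonneg_left ((wt_pow_inv_prod_le n _).trans ?_) hC0
  have h1 : (wt (x + ε • y) ^ n)⁻¹ ≤ ((1 + |ε⁻¹|) * wt x) ^ n * (wt y ^ n)⁻¹ := by
    rw [← div_eq_mul_inv, le_div_iff₀ (by positivity), inv_mul_le_iff₀ (by positivity), mul_comm,
      ← mul_pow]
    exact pow_le_pow_left₀ hy.le (wt_le_of_add_smul x y hε) n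
  have h2 : (wt (ξ + η) ^ n)⁻¹ ≤ wt ξ ^ n * (wt η ^ n)⁻¹ := by
    rw [← div_eq_mul_inv, le_div_iff₀ (by positivity), inv_mul_le_iff₀ (by positivity), mul_comm,
      ← mul_pow]
    refine pow_le_pow_left₀ hη.le ?_ n
    have := wt_sub_le (ξ + η) ξ
    rw [add_sub_cancel_left] at this
    linarith [mul_comm (wt ξ) (wt (ξ + η))]
  calc _ ≤ (((1 + |ε⁻¹|) * wt x) ^ n * (wt y ^ n)⁻¹) * (wt ξ ^ n * (wt η ^ n)⁻¹) :=
        mul_le_mul h1 h2 (by positivity) (by positivity)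
    _ = _ := by ring

theorem ft_shift (u : Phase d → ℂ) (q ξ y : Space d) :
    ∫ η, phase (y, η) * u (q, ξ + η) = phase (y, -ξ) * pft u (q, y) := by
  rw [← integral_sub_right_eq_self (fun η => phase (y, η) * u (q, ξ + η)) ξ, pft, ft,
    ← integral_const_mul]
  refine integral_congr_ae (Eventually.of_forall fun η => ?_)
  simp only [add_sub_cancel]
  rw [← mul_assoc]
  congr 1
  simp only [phase, ← Complex.exp_add, pairing_space, inner_neg_right, inner_sub_right]
  rw [real_inner_comm y η]
  congr 1
  push_cast; ring

/-- Decay in `z` and `y` comes from the position arguments `x - εz/2` of `u` and `x + εy/2` of `v`,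
hence the need for `ε ≠ 0`. The oscillatory integral is then an ordinary one, and its momentum
integrals are partial Fourier transforms shifted by `ξ`. -/
theorem sharp_eq_kernelIntegral {ε : ℝ} (hε : ε ≠ 0) (hGc : Continuous G)
    (hG : ∃ C k, 0 ≤ C ∧ ∀ c, ‖G c‖ ≤ C * cfgWt c ^ k)
    (hu : RapidFamily fun _ : Unit => u) (hv : RapidFamily fun _ : Unit => v) (X : Phase d) :
    sharp ε G u v X = kernelIntegral ε G u v X := by
  obtain ⟨C, k, hC0, hC⟩ := hG
  set n := Module.finrank ℝ (Phase d) + 1 with hn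
  have hε2 : ε / 2 ≠ 0 := div_ne_zero hε two_ne_zero
  obtain ⟨Cu, hCu0, hCu⟩ := hu.exists_norm_shift_le (n + k) X.1 X.2 (neg_ne_zero.2 hε2)
  obtain ⟨Cv, hCv0, hCv⟩ := hv.exists_norm_shift_le (n + k) X.1 X.2 hε2
  have hcu := (hu.contDiff ()).continuous
  have hcv := (hv.contDiff ()).continuous
  have hFc : Continuous fun z => sharpAmp ε G u v (X, z) := by
    unfold sharpAmp
    exact (hGc.comp (cfgMap.continuous.comp (by fun_prop))).mul ((hcu.comp
      ((leftMap ε).continuous.comp (by fun_prop))).mul (hcv.comp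
      ((rightMap ε).continuous.comp (by fun_prop))))
  have hFb : ∀ z, ‖sharpAmp ε G u v (X, z)‖ ≤ C * Cu * Cv * decay z := by
    rintro ⟨⟨y, z⟩, η, ζ⟩
    have hy := wt_pos y
    have hz := wt_pos z
    have hη := wt_pos η
    have hζ := wt_pos ζ
    have h1 := hCu z η
    rw [neg_smul, ← sub_eq_add_neg] at h1
    have h2 := hCv y ζ
    simp only [sharpAmp, leftMap_apply, rightMap_apply, cfgMap_apply, norm_mul]
    have h3 : ‖G (X.1, y, z)‖ ≤ C * (wt y ^ k * wt z ^ k) := by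
      refine (hC _).trans (mul_le_mul_of_nonneg_left ?_ hC0)
      rw [← mul_pow]
      exact pow_le_pow_left₀ (wt_nonneg _) (wt_prod_le (y, z)) k
    have h4 : (wt ζ ^ (n + k))⁻¹ ≤ (wt ζ ^ n)⁻¹ :=
      inv_anti₀ (by positivity) (pow_le_pow_right₀ (one_le_wt ζ) (by omega))
    have h5 : (wt η ^ (n + k))⁻¹ ≤ (wt η ^ n)⁻¹ :=
      inv_anti₀ (by positivity) (pow_le_pow_right₀ (one_le_wt η) (by omega))
    calc _ ≤ C * (wt y ^ k * wt z ^ k) * ((Cu * ((wt z ^ (n + k))⁻¹ * (wt η ^ (n + k))⁻¹)) *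
          (Cv * ((wt y ^ (n + k))⁻¹ * (wt ζ ^ (n + k))⁻¹))) := by
          refine mul_le_mul h3 (mul_le_mul h1 h2 (norm_nonneg _) (by positivity)) (by positivity)
            (by positivity)
      _ = C * Cu * Cv * ((((wt y ^ (n + k))⁻¹ * wt y ^ k) * ((wt z ^ (n + k))⁻¹ * wt z ^ k)) *
          ((wt η ^ (n + k))⁻¹ * (wt ζ ^ (n + k))⁻¹)) := by ring
      _ ≤ C * Cu * Cv * (((wt y ^ n)⁻¹ * (wt z ^ n)⁻¹) * ((wt η ^ n)⁻¹ * (wt ζ ^ n)⁻¹)) := by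
          rw [wt_pow_inv_mul_pow, wt_pow_inv_mul_pow]
          gcongr
      _ ≤ _ := mul_le_mul_of_nonneg_left (mul_le_mul (wt_pow_inv_mul_le n (y, z))
          (wt_pow_inv_mul_le n (η, ζ)) (by positivity) (wt_pow_inv_nonneg _ _)) (by positivity)
  have hFi : Integrable fun z => sharpAmp ε G u v (X, z) :=
    (integrable_decay.const_mul _).mono' hFc.aestronglyMeasurable (Eventually.of_forall hFb)
  have hFi' : Integrable fun z => phase z * sharpAmp ε G u v (X, z) :=
    hFi.bdd_mul (c := 1) continuous_phase.aestronglyMeasurable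
      (Eventually.of_forall fun _ => (norm_phase _).le)
  rw [sharp, (HasOscInt.of_integrable hFi).oscInt_eq, integral_volume_prod hFi', kernelIntegral]
  congr 1
  refine integral_congr_ae (Eventually.of_forall fun w => ?_)
  have h2 : ∀ θ : Phase d, phase (w, θ) * sharpAmp ε G u v (X, (w, θ)) = G (X.1, w) *
      ((phase (w.1, θ.1) * u (X.1 - (ε / 2) • w.2, X.2 + θ.1)) *
        (phase (w.2, θ.2) * v (X.1 + (ε / 2) • w.1, X.2 + θ.2))) := by
    intro θ
    have e : phase (w, θ) = phase (w.1, θ.1) * phase (w.2, θ.2) := by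
      simp only [phase, pairing_prod, ← Complex.exp_add]
      congr 1
      push_cast; ring
    rw [e, sharpAmp, leftMap_apply, rightMap_apply, cfgMap_apply]
    ring
  simp only [h2]
  rw [integral_const_mul, Measure.volume_eq_prod, integral_prod_mul
    (fun η => phase (w.1, η) * u (X.1 - (ε / 2) • w.2, X.2 + η))
    (fun ζ => phase (w.2, ζ) * v (X.1 + (ε / 2) • w.1, X.2 + ζ)), ft_shift, ft_shift]
  have e : phase (w, (-X.2, -X.2)) = phase (w.1, -X.2) * phase (w.2, -X.2) := by
    simp only [phase, pairing_prod, ← Complex.exp_add]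
    congr 1
    push_cast; ring
  rw [e]; ring

end Kernel

/-! ### Existence of the oscillatory integrals -/

section Existence

variable {d : ℕ} {m m₁ m₂ : ℝ}

theorem symWt_le_wt (m : ℝ) : ∃ C, 0 ≤ C ∧ ∀ X : Phase d, symWt m X ≤ C * wt X ^ ⌈|m|⌉₊ := by
  obtain ⟨C, hC0, hC⟩ := bracket_add_rpow_le (d := d) m
  refine ⟨C, hC0, fun X => ?_⟩
  have h := hC 0 X.2
  have h0 : bracket (0 : Space d) = 1 := by simp [bracket]
  rw [zero_add, h0, Real.one_rpow, one_mul] at h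
  exact h.trans (mul_le_mul_of_nonneg_left (pow_le_pow_left₀ (wt_nonneg _) (wt_snd_le X) _) hC0)

theorem polyFamily_of_symWt {ι : Type*} [TopologicalSpace ι] {f : ι → Phase d → ℂ}
    (hf : ∀ N, BddFamily N (symWt m) f) : PolyFamily wt f := fun N =>
  ⟨_, (hf N).mono (symWt_le_wt m) (symWt_nonneg m)⟩

/-- The dilated cut-offs of a symbol. -/
def dilateMul (χ f : Phase d → ℂ) (δ : ℝ) (X : Phase d) : ℂ := χ (δ • X) * f X

theorem bddFamily_dilateMul {χ f : Phase d → ℂ} (hχ : RapidFamily fun _ : Unit => χ)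
    (hf : ∀ N, BddFamily N (symWt m) fun _ : Unit => f) (N : ℕ) :
    BddFamily N (symWt m) fun δ : unitInterval => dilateMul χ f δ := by
  have h1 : BddFamily N (fun _ => 1) fun _ : unitInterval => χ :=
    (hχ.bddFamily N).reindex (f := fun _ : unitInterval => ()) continuous_const
  have h2 := (bddFamily_dilation (ContinuousLinearMap.id ℝ (Phase d)) h1).mul
    ((hf N).reindex (f := fun _ : unitInterval => ()) continuous_const)
  simp only [one_mul] at h2
  exact h2

theorem rapidFamily_dilateMul {χ f : Phase d → ℂ} (hχ : RapidFamily fun _ : Unit => χ)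
    (hf : ∀ N, BddFamily N (symWt m) fun _ : Unit => f) {δ : ℝ} (hδ : δ ≠ 0) :
    RapidFamily fun _ : Unit => dilateMul χ f δ :=
  (hχ.dilate hδ).mul_poly (polyFamily_of_symWt hf)

theorem PolyFamily.exists_bound {G : Space d × Space d × Space d → ℂ}
    (hG : PolyFamily cfgWt fun _ : Unit => G) :
    Continuous G ∧ ∃ C k, 0 ≤ C ∧ ∀ c, ‖G c‖ ≤ C * cfgWt c ^ k := by
  obtain ⟨k, hk⟩ := hG 0
  obtain ⟨C, hC0, hC⟩ := hk.exists_bound_pos fun x => pow_nonneg (wt_nonneg _) k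
  exact ⟨hk.continuous_apply (), C, k, hC0, hC ()⟩

theorem PolyFamily.of_unit {κ H : Type*} [TopologicalSpace κ] [NormedAddCommGroup H] [NormedSpace ℝ H]
    {W : H → ℝ} {G : H → ℂ} (hG : PolyFamily W fun _ : Unit => G) : PolyFamily W fun _ : κ => G :=
  fun N => let ⟨k, hk⟩ := hG N; ⟨k, hk.reindex (f := fun _ : κ => ()) continuous_const⟩

theorem tendsto_apply_of_unitInterval {Y : Type*} [TopologicalSpace Y] [T2Space Y]
    {F : ℝ → Y} (h : Continuous fun δ : unitInterval => F δ) : Tendsto F (𝓝[>] 0) (𝓝 (F 0)) := by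
  have h1 : Continuous fun δ : ℝ => F (Set.projIcc (0 : ℝ) 1 zero_le_one δ) :=
    h.comp continuous_projIcc
  have h2 := (h1.tendsto 0).mono_left (nhdsWithin_le_nhds (s := Ioi (0 : ℝ)))
  simp only [Set.projIcc_left] at h2
  refine h2.congr' ?_
  filter_upwards [Ioc_mem_nhdsGT (zero_lt_one (α := ℝ))] with δ hδ
  rw [Set.projIcc_of_mem zero_le_one ⟨hδ.1.le, hδ.2⟩]

/-- For `δ > 0` the cut-off symbols decrease rapidly, and the two kernel forms identify the
regularized integral with `sharp`. The dilated symbols form a bounded family over `δ ∈ [0, 1]`, so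
`sharp` is continuous at `δ = 0`, where any `χ` with `χ(0) = 1` restores `f` and `g`. -/
theorem hasOscillatoryIntegral_sharp {ε : ℝ} (hε0 : ε ≠ 0) (hε : |ε| ≤ 1)
    {G : Space d × Space d × Space d → ℂ} (hG : PolyFamily cfgWt fun _ : Unit => G)
    {f g : Phase d → ℂ} (hf : ∀ N, BddFamily N (symWt m₁) fun _ : Unit => f)
    (hg : ∀ N, BddFamily N (symWt m₂) fun _ : Unit => g) :
    HasOscillatoryIntegral ε (fun x y z => G (x, y, z)) f g (sharp ε G f g) := by
  intro χ hχ0 X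
  have hχ := SchwartzMap.rapidFamily (ι := Unit) χ
  obtain ⟨hGc, hGb⟩ := hG.exists_bound
  have h1 := bddFamily_sharp (ι := unitInterval) (ε := fun _ => ε) continuous_const (fun _ => hε)
    hG.of_unit (bddFamily_dilateMul hχ hf) (bddFamily_dilateMul hχ hg) 0
  have h2 : Continuous fun δ : unitInterval =>
      sharp ε G (dilateMul χ f δ) (dilateMul χ g δ) X := by
    have hX : Continuous fun δ : unitInterval => (δ, X) := by fun_prop
    have h := h1.continuous.comp hX
    simp only [Function.comp_def] at h
    exact h
  have h3 := tendsto_apply_of_unitInterval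
    (F := fun δ : ℝ => sharp ε G (dilateMul χ f δ) (dilateMul χ g δ) X) h2
  have e0 : ∀ f : Phase d → ℂ, dilateMul χ f 0 = f := fun f => by
    ext X; simp [dilateMul, hχ0]
  simp only [e0] at h3
  refine h3.congr' ?_
  filter_upwards [self_mem_nhdsWithin] with δ hδ
  have hδ' : δ ≠ 0 := (mem_Ioi.1 hδ).ne'
  have hu := rapidFamily_dilateMul hχ hf hδ'
  have hv := rapidFamily_dilateMul hχ hg hδ'
  exact (sharp_eq_kernelIntegral hε0 hGc hGb hu hv X).trans
    (twistedIntegral_eq_kernelIntegral ε hGc hGb hu hv X).symm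

end Existence

/-! ### Quantization with a gauge factor -/

section Quantization

variable {ι : Type*} [TopologicalSpace ι] {d : ℕ} {m : ℝ}

/-- `(x, (y, η)) ↦ (x, x + y)`. -/
def segMap : Space d × Space d × Space d →L[ℝ] Space d × Space d :=
  (ContinuousLinearMap.fst ℝ _ _).prod (ContinuousLinearMap.fst ℝ _ _ +
    (ContinuousLinearMap.fst ℝ _ _).comp (ContinuousLinearMap.snd ℝ _ _))

/-- `(x, (y, η)) ↦ (εx + (ε/2)y, η)`. -/
def midMap (ε : ℝ) : Space d × Space d × Space d →L[ℝ] Phase d :=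
  ContinuousLinearMap.prod (ε • ContinuousLinearMap.fst ℝ _ _ +
    (ε / 2) • (ContinuousLinearMap.fst ℝ _ _).comp (ContinuousLinearMap.snd ℝ _ _))
    ((ContinuousLinearMap.snd ℝ _ _).comp (ContinuousLinearMap.snd ℝ _ _))

theorem segMap_apply (h : Space d × Space d × Space d) : segMap h = (h.1, h.1 + h.2.1) := rfl

theorem midMap_apply (ε : ℝ) (h : Space d × Space d × Space d) :
    midMap ε h = (ε • h.1 + (ε / 2) • h.2.1, h.2.2) := rfl

/-- The amplitude of the quantization of `f` with gauge factor `e`, applied to `φ`. -/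
def opAmp (ε : ℝ) (e : Space d × Space d → ℂ) (f : Phase d → ℂ) (φ : Space d → ℂ)
    (h : Space d × Space d × Space d) : ℂ :=
  e (segMap h) * φ (segMap h).2 * f (midMap ε h)

/-- The quantization of `f` with gauge factor `e`, applied to `φ`. -/
def op (ε : ℝ) (e : Space d × Space d → ℂ) (f : Phase d → ℂ) (φ : Space d → ℂ) (x : Space d) : ℂ :=
  (((2 * Real.pi) ^ d : ℝ) : ℂ)⁻¹ * oscInt fun z => opAmp ε e f φ (x, z)

theorem symWt_le_wt_snd (m : ℝ) :
    ∃ C, 0 ≤ C ∧ ∀ X : Phase d, symWt m X ≤ C * wt X.2 ^ ⌈|m|⌉₊ := by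
  obtain ⟨C, hC0, hC⟩ := bracket_add_rpow_le (d := d) m
  refine ⟨C, hC0, fun X => ?_⟩
  have h := hC 0 X.2
  have h0 : bracket (0 : Space d) = 1 := by simp [bracket]
  rwa [zero_add, h0, Real.one_rpow, one_mul] at h

theorem wt_left_le (x y : Space d) : wt x ≤ wt (x + y) * wt y := by
  have := wt_sub_le (x + y) y
  rwa [add_sub_cancel_right] at this

theorem wt_right_le (x y : Space d) : wt y ≤ wt (x + y) * wt x := by
  have := wt_sub_le (x + y) x
  rwa [add_sub_cancel_left] at this

theorem inv_pow_le_of_le_mul {a b c : ℝ} (ha : 0 < a) (hb : 0 < b) (h : a ≤ b * c)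
    (k : ℕ) : (b ^ k)⁻¹ ≤ c ^ k * (a ^ k)⁻¹ := by
  rw [← div_eq_mul_inv, le_div_iff₀ (pow_pos ha _), inv_mul_le_iff₀ (pow_pos hb _), ← mul_pow]
  exact pow_le_pow_left₀ ha.le h k

variable {e : Space d × Space d → ℂ} {f : ι → Phase d → ℂ} {φ : ι → Space d → ℂ}

/-- The growth of `e` in its second argument is absorbed by `φ`; that in the first one, of order
`n`, remains. Decay of order `n + k` is kept so that it can offset this growth and still leave order
`k`. -/
theorem exists_bddFamily_gauge_mul (he : PolyFamily wt fun _ : Unit => e) (hφ : RapidFamily φ)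
    (N k : ℕ) : ∃ n, BddFamily N
      (fun p : Space d × Space d => wt p.1 ^ n * (wt p.2 ^ (n + k))⁻¹) fun t p => e p * φ t p.2 := by
  obtain ⟨n, hn⟩ := he N
  have h1 := hn.reindex (f := fun _ : ι => ()) continuous_const
  have h2 := (hφ N (n + k + n)).comp_const (w := fun p => (wt p.2 ^ (n + k + n))⁻¹)
    (ContinuousLinearMap.snd ℝ (Space d) (Space d))
    ⟨1, zero_le_one, fun p => (one_mul _).ge⟩ (wt_pow_inv_nonneg _)
  refine ⟨n, (h1.mul h2).mono' (fun p => ?_) fun p => mul_nonneg (pow_nonneg (wt_nonneg _) _)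
    (wt_pow_inv_nonneg _ _)⟩
  rw [← wt_pow_inv_mul_pow (n + k) n p.2]
  calc _ ≤ (wt p.1 * wt p.2) ^ n * (wt p.2 ^ (n + k + n))⁻¹ :=
        mul_le_mul_of_nonneg_right (pow_le_pow_left₀ (wt_nonneg _) (wt_prod_le p) n)
          (wt_pow_inv_nonneg _ _)
    _ = _ := by rw [mul_pow]; ring

theorem BddFamily.comp_midMap (ε : ℝ) {N : ℕ} (hf : BddFamily N (symWt m) f) :
    BddFamily N (fun h : Space d × Space d × Space d => wt h.2.2 ^ ⌈|m|⌉₊)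
      fun t h => f t (midMap ε h) := by
  obtain ⟨C, hC0, hC⟩ := symWt_le_wt_snd (d := d) m
  exact hf.comp_const (midMap ε) ⟨C, hC0, fun h => hC (midMap ε h)⟩ (symWt_nonneg m)

theorem contDiff_opAmp (ε : ℝ) (he : PolyFamily wt fun _ : Unit => e) (hφ : RapidFamily φ)
    (hf : ∀ N, BddFamily N (symWt m) f) (t : ι) : ContDiff ℝ ∞ (opAmp ε e (f t) (φ t)) :=
  (((he.contDiff ()).comp segMap.contDiff).mul ((hφ.contDiff t).comp
    (contDiff_snd.comp segMap.contDiff))).mul ((BddFamily.contDiff_infty hf t).comp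
      (midMap ε).contDiff)

/-- Decay of `φ` at `x + y` is traded for decay in `x` at the price of powers of `wt y`, which the
oscillatory integral tolerates. The factor with these powers does not depend on `η`, as
`AmpBound.of_indep` demands. -/
theorem amp_opAmp (ε : ℝ) (he : PolyFamily wt fun _ : Unit => e) (hφ : RapidFamily φ)
    (hf : ∀ N, BddFamily N (symWt m) f) (k : ℕ) :
    Amp (fun x : Space d => (wt x ^ k)⁻¹) ⌈|m|⌉₊ fun t => opAmp ε e (f t) (φ t) := by
  refine ⟨contDiff_opAmp ε he hφ hf, fun N => ?_⟩
  obtain ⟨n, hn⟩ := exists_bddFamily_gauge_mul he hφ N k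
  have s1 : ∀ t, ContDiff ℝ ∞ fun p : Space d × Space d => e p * φ t p.2 := fun t =>
    (he.contDiff ()).mul ((hφ.contDiff t).comp contDiff_snd)
  have h1 : AmpBound N (fun h : Space d × Space d × Space d => (wt h.1 ^ k)⁻¹ * wt h.2.1 ^ (n + k))
      fun t h => e (segMap h) * φ t (segMap h).2 := by
    refine AmpBound.of_indep (hn.comp_const segMap ⟨1, zero_le_one, fun h => ?_⟩ fun p =>
      mul_nonneg (pow_nonneg (wt_nonneg _) _) (wt_pow_inv_nonneg _ _)) fun t u => ?_
    · rw [one_mul, segMap_apply]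
      have h2 := inv_pow_le_of_le_mul (wt_pos h.1) (wt_pos (h.1 + h.2.1)) (wt_left_le h.1 h.2.1) (n + k)
      calc _ ≤ wt h.1 ^ n * (wt h.2.1 ^ (n + k) * (wt h.1 ^ (n + k))⁻¹) :=
            mul_le_mul_of_nonneg_left h2 (pow_nonneg (wt_nonneg _) _)
        _ = ((wt h.1 ^ (k + n))⁻¹ * wt h.1 ^ n) * wt h.2.1 ^ (n + k) := by
            rw [add_comm k n]; ring
        _ = _ := by rw [wt_pow_inv_mul_pow]
    · rw [dirDeriv_comp (a := fun p => e p * φ t p.2) (ContDiff.diff (s1 t))]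
      ext h
      have : segMap ((0, 0, u) : Space d × Space d × Space d) = 0 := by
        rw [segMap_apply]; simp
      simp [dirDeriv, this]
  have h2 := AmpBound.of_forall (fun N => (hf N).comp_midMap ε) N
  exact ⟨n + k, h1.mul (fun t => (s1 t).comp segMap.contDiff) (fun t =>
    (BddFamily.contDiff_infty hf t).comp (midMap ε).contDiff) h2⟩

theorem rapidFamily_op [FirstCountableTopology ι] (ε : ℝ) (he : PolyFamily wt fun _ : Unit => e)
    (hφ : RapidFamily φ) (hf : ∀ N, BddFamily N (symWt m) f) :
    RapidFamily fun t => op ε e (f t) (φ t) := fun N k =>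
  ((amp_opAmp ε he hφ hf k).bddFamily_oscInt (continuous_wt_pow_inv k)
    (wt_pow_inv_nonneg k) N).smul_const _

/-- The opposite trade to `amp_opAmp`: decay in `y` is bought with growth in `x`, which is harmless
at a fixed `x`. -/
theorem bddFamily_opAmp (ε : ℝ) (he : PolyFamily wt fun _ : Unit => e) (hφ : RapidFamily φ)
    (hf : ∀ N, BddFamily N (symWt m) f) (N k : ℕ) : ∃ n, BddFamily N
      (fun h : Space d × Space d × Space d => wt h.1 ^ n * (wt h.2.1 ^ k)⁻¹ * wt h.2.2 ^ ⌈|m|⌉₊)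
      fun t => opAmp ε e (f t) (φ t) := by
  obtain ⟨n, hn⟩ := exists_bddFamily_gauge_mul he hφ N k
  refine ⟨n + k, (hn.comp_const segMap ⟨1, zero_le_one, fun h => ?_⟩ fun p =>
      mul_nonneg (pow_nonneg (wt_nonneg _) _) (wt_pow_inv_nonneg _ _)).mul ((hf N).comp_midMap ε)⟩
  rw [one_mul, segMap_apply]
  have h2 := inv_pow_le_of_le_mul (wt_pos h.2.1) (wt_pos (h.1 + h.2.1)) (wt_right_le h.1 h.2.1) k
  calc _ ≤ wt h.1 ^ n * (wt (h.1 + h.2.1) ^ k)⁻¹ :=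
        mul_le_mul_of_nonneg_left (inv_anti₀ (pow_pos (wt_pos _) _)
          (pow_le_pow_right₀ (one_le_wt _) (by omega))) (pow_nonneg (wt_nonneg _) _)
    _ ≤ wt h.1 ^ n * (wt h.1 ^ k * (wt h.2.1 ^ k)⁻¹) :=
        mul_le_mul_of_nonneg_left h2 (pow_nonneg (wt_nonneg _) _)
    _ = _ := by rw [pow_add]; ring

end Quantization

/-! ### Integration by parts in the inner variable alone. -/

section Iterated

variable {Q : Type*} [NormedAddCommGroup Q] [NormedSpace ℝ Q]
variable {E : Type*} [NormedAddCommGroup E] [NormedSpace ℝ E] [PairedSpace E]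
  [FiniteDimensional ℝ E] [MeasureSpace E] [BorelSpace E] [(volume : Measure E).IsAddHaarMeasure]

theorem integrable_slice {a : Q × E × E → ℂ} {om : Q → ℝ} {M : ℕ} (ha : BddFamily 0
      (fun h : Q × E × E => om h.1 * (wt h.2.1 ^ (Module.finrank ℝ E + 1))⁻¹ * wt h.2.2 ^ M)
      fun _ : Unit => a) (q : Q) (θ : E) : Integrable fun w => a (q, (w, θ)) := by
  obtain ⟨C, hC⟩ := ha.bound
  refine ((integrable_wt_pow_inv (volume : Measure E) le_rfl).const_mul
    (C * (om q * wt θ ^ M))).mono' ((ha.continuous_apply ()).comp (by fun_prop)).aestronglyMeasurable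
    (Eventually.of_forall fun w => (hC () (q, (w, θ))).trans_eq (by ring))

/-- With `θ` frozen, the integral over the first phase variable converges absolutely, and the
multipliers are constants. Integrability replaces compact support in the integration by parts. -/
theorem integral_phase_stepsFst_slice {a : Q × E × E → ℂ} {om : Q → ℝ} (hom : ∀ q, 0 ≤ om q) {M : ℕ}
    (l : List E) (ha : BddFamily l.length
      (fun h : Q × E × E => om h.1 * (wt h.2.1 ^ (Module.finrank ℝ E + 1))⁻¹ * wt h.2.2 ^ M)
      fun _ : Unit => a) (q : Q) (θ : E) :
    ∫ w, phase (w, θ) * stepsFst l a (q, (w, θ)) = ∫ w, phase (w, θ) * a (q, (w, θ)) := by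
  have hw : ∀ h : Q × E × E,
      0 ≤ om h.1 * (wt h.2.1 ^ (Module.finrank ℝ E + 1))⁻¹ * wt h.2.2 ^ M := fun h =>
    mul_nonneg (mul_nonneg (hom _) (wt_pow_inv_nonneg _ _)) (pow_nonneg (wt_nonneg _) _)
  induction l with
  | nil => rfl
  | cons v l ih =>
    have hl : BddFamily 1
        (fun h : Q × E × E => om h.1 * (wt h.2.1 ^ (Module.finrank ℝ E + 1))⁻¹ * wt h.2.2 ^ M)
        fun _ : Unit => stepsFst l a :=
      ((ha.of_le (by simp [add_comm])).stepsFst (N := 1) l).mono' (fun h => mul_le_of_le_one_left (hw h)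
        (prod_coefWt_mem l h.2.2).2) fun h => mul_nonneg (prod_coefWt_mem l h.2.2).1 (hw h)
    rw [← ih ha.of_succ]
    set b := stepsFst l a with hb
    have hbd : Differentiable ℝ b := hl.differentiable ()
    have hs : Differentiable ℝ fun w => b (q, (w, θ)) := hbd.comp (by fun_prop)
    have hi := integrable_slice hl.of_succ q θ
    have hi' := integrable_slice (hl.2.2 (0, v, 0)) q θ
    have hder : dirDeriv v (fun w => b (q, (w, θ))) = fun w => dirDeriv (0, v, 0) b (q, (w, θ)) := by
      ext w
      have h1 : HasFDerivAt (fun w : E => (q, (w, θ)))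
          ((ContinuousLinearMap.inr ℝ Q (E × E)).comp (ContinuousLinearMap.inl ℝ E E)) w :=
        (hasFDerivAt_prodMk_right q (w, θ)).comp w (hasFDerivAt_prodMk_left w θ)
      exact congrArg (fun L : E →L[ℝ] ℂ => L v)
        ((hbd (q, (w, θ))).hasFDerivAt.comp w h1).fderiv
    have h2 := ft_dirDeriv hs hi v (by rw [hder]; exact hi') θ
    have h3 := ft_add hi hi' θ
    rw [← hder, h2] at h3
    have h4 : ∀ w, phase (w, θ) * stepsFst (v :: l) a (q, (w, θ)) =
        coef v θ * (phase (w, θ) * (b (q, (w, θ)) + dirDeriv (0, v, 0) b (q, (w, θ)))) := by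
      intro w
      change phase (w, θ) * stepFst v b (q, (w, θ)) = _
      simp only [stepFst]; ring
    simp only [h4]
    rw [integral_const_mul]
    change coef v θ * ft _ θ = ft _ θ
    rw [h3, ← one_add_mul, coef, inv_mul_cancel_left₀ (one_add_I_mul_ne_zero _)]

end Iterated

/-! ### Quantization as an iterated integral and through its kernel. -/

section Operators

variable {d : ℕ} {m : ℝ} {e : Space d × Space d → ℂ} {f : Phase d → ℂ} {φ : Space d → ℂ}

/-- The function `φ` already provides decay in `y`, so only the steps that gain decay in `η` are
needed. After these, Fubini's theorem applies, and the steps are undone separately for each `η`. -/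
theorem oscInt_opAmp_eq_iterated (he : PolyFamily wt fun _ : Unit => e)
    (hφ : RapidFamily fun _ : Unit => φ) (hf : ∀ N, BddFamily N (symWt m) fun _ : Unit => f)
    (ε : ℝ) (x : Space d) : oscInt (fun z => opAmp ε e f φ (x, z)) =
      ∫ η : Space d, ∫ y : Space d, phase (y, η) * opAmp ε e f φ (x, (y, η)) := by
  set D := Module.finrank ℝ (Space d) + 1 with hD
  set M := ⌈|m|⌉₊ with hM
  set l := frames (Space d) (M + D) with hl
  obtain ⟨n, hn⟩ := bddFamily_opAmp ε he hφ hf l.length D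
  have hom : ∀ x : Space d, 0 ≤ wt x ^ n := fun x => pow_nonneg (wt_nonneg _) _
  have hS : BddFamily (0 + l.length)
      (fun h : Space d × Space d × Space d => wt h.1 ^ n * (wt h.2.1 ^ D)⁻¹ * wt h.2.2 ^ M)
      fun p : unitInterval × Unit => stepsSnd [] (regularize p.1 (opAmp ε e f φ)) := by
    rw [zero_add]
    have h1 := (Amp.bddFamily_cutoffs (Q := Space d) (E := Space d) l.length).reindex
      (f := fun p : unitInterval × Unit => p.1) continuous_fst
    have h2 := h1.mul (hn.reindex (f := fun p : unitInterval × Unit => p.2) continuous_snd)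
    simp only [one_mul] at h2
    exact h2
  obtain ⟨h1, h2⟩ := oscInt_representation (a := fun _ : Unit => opAmp ε e f φ) le_rfl
    (om := fun x : Space d => wt x ^ n) (continuous_wt.pow n) hom (contDiff_opAmp ε he hφ hf) hS
  have hi : Integrable fun z : Space d × Space d =>
      phase z * stepsFst l (stepsSnd [] (opAmp ε e f φ)) (x, z) := by
    obtain ⟨C, hC⟩ := h2.bound
    refine (integrable_decay.const_mul (C * wt x ^ n)).mono' (continuous_phase.mul
      ((h2.continuous_apply ()).comp (by fun_prop))).aestronglyMeasurable
      (Eventually.of_forall fun z => ?_)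
    rw [norm_mul, norm_phase, one_mul]
    exact (hC () (x, z)).trans_eq (by ring)
  rw [(h1 () x).oscInt_eq, Measure.volume_eq_prod, integral_prod_symm _ hi]
  exact integral_congr_ae (Eventually.of_forall fun η =>
    integral_phase_stepsFst_slice hom l hn x η)

/-- The quantization as an iterated integral. -/
theorem op_eq_iterated (he : PolyFamily wt fun _ : Unit => e)
    (hφ : RapidFamily fun _ : Unit => φ) (hf : ∀ N, BddFamily N (symWt m) fun _ : Unit => f)
    (ε : ℝ) (x : Space d) : op ε e f φ x = (((2 * Real.pi) ^ d : ℝ) : ℂ)⁻¹ *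
      ∫ η : Space d, ∫ y : Space d, Complex.exp (-Complex.I * ((inner ℝ (y - x) η : ℝ) : ℂ)) *
        e (x, y) * f ((ε / 2) • (x + y), η) * φ y := by
  rw [op, oscInt_opAmp_eq_iterated he hφ hf]
  congr 1
  refine integral_congr_ae (Eventually.of_forall fun η => ?_)
  simp only
  rw [← integral_sub_right_eq_self (fun y => phase (y, η) * opAmp ε e f φ (x, (y, η))) x]
  refine integral_congr_ae (Eventually.of_forall fun y => ?_)
  have h1 : ε • x + (ε / 2) • (y - x) = (ε / 2) • (x + y) := by module
  simp only [phase, pairing_space, opAmp, segMap_apply, midMap_apply, add_sub_cancel, h1]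
  ring

theorem symWt_le_wt_inv (n : ℕ) (hm : m ≤ -(n : ℝ)) (X : Phase d) :
    symWt m X ≤ 2 ^ n * (wt X.2 ^ n)⁻¹ := by
  refine (symWt_mono hm X).trans ?_
  have hb := bracket_pos X.2
  rw [symWt, Real.rpow_neg hb.le, Real.rpow_natCast, ← div_eq_mul_inv,
    le_div_iff₀ (pow_pos (wt_pos _) _), inv_mul_le_iff₀ (pow_pos hb _), mul_comm, ← mul_pow]
  exact pow_le_pow_left₀ (wt_nonneg _) (wt_le_bracket _) n

theorem exists_norm_gauge_mul_le (he : PolyFamily wt fun _ : Unit => e)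
    (hφ : RapidFamily fun _ : Unit => φ) (x : Space d) (k : ℕ) : ∃ C, 0 ≤ C ∧
      ∀ y, ‖e (x, y) * φ y‖ ≤ C * (wt y ^ k)⁻¹ := by
  obtain ⟨n, hn⟩ := exists_bddFamily_gauge_mul he hφ 0 k
  obtain ⟨C, hC0, hC⟩ := hn.exists_bound_pos fun p =>
    mul_nonneg (pow_nonneg (wt_nonneg _) _) (wt_pow_inv_nonneg _ _)
  refine ⟨C * wt x ^ n, mul_nonneg hC0 (pow_nonneg (wt_nonneg _) _), fun y =>
    (hC () (x, y)).trans ?_⟩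
  rw [mul_assoc]
  exact mul_le_mul_of_nonneg_left (mul_le_mul_of_nonneg_left (inv_anti₀ (pow_pos (wt_pos _) _)
    (pow_le_pow_right₀ (one_le_wt _) (by omega))) (pow_nonneg (wt_nonneg _) _)) hC0

/-- The quantization of a symbol that decays in the momentum, in terms of its kernel. -/
theorem op_eq_kernel (he : PolyFamily wt fun _ : Unit => e)
    (hφ : RapidFamily fun _ : Unit => φ) (hf : ∀ N, BddFamily N (symWt m) fun _ : Unit => f)
    (hm : m ≤ -((Module.finrank ℝ (Space d) + 1 : ℕ) : ℝ))
    (ε : ℝ) (x : Space d) : op ε e f φ x = (((2 * Real.pi) ^ d : ℝ) : ℂ)⁻¹ *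
      ∫ y : Space d, e (x, y) * φ y * pft f ((ε / 2) • (x + y), y - x) := by
  rw [op_eq_iterated he hφ hf]
  congr 1
  set D := Module.finrank ℝ (Space d) + 1 with hD
  obtain ⟨C, hC0, hC⟩ := exists_norm_gauge_mul_le he hφ x D
  obtain ⟨C', hC0', hC'⟩ := (hf 0).exists_bound_pos (symWt_nonneg m)
  have hec : Continuous e := (he.contDiff ()).continuous
  have hφc : Continuous φ := (hφ.contDiff ()).continuous
  have hfc : Continuous f := (hf 0).continuous_apply ()
  have hi : Integrable (fun p : Space d × Space d =>
      Complex.exp (-Complex.I * ((inner ℝ (p.2 - x) p.1 : ℝ) : ℂ)) *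
        e (x, p.2) * f ((ε / 2) • (x + p.2), p.1) * φ p.2) := by
    refine Integrable.mono' (g := fun p : Space d × Space d =>
      (C * C' * 2 ^ D) * ((wt p.1 ^ D)⁻¹ * (wt p.2 ^ D)⁻¹)) (Integrable.const_mul
      ((integrable_wt_pow_inv (volume : Measure (Space d)) le_rfl).mul_prod
        (integrable_wt_pow_inv (volume : Measure (Space d)) le_rfl)) _)
      (Continuous.aestronglyMeasurable (by fun_prop)) (Eventually.of_forall fun p => ?_)
    have e1 : ‖Complex.exp (-Complex.I * ((inner ℝ (p.2 - x) p.1 : ℝ) : ℂ))‖ = 1 := by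
      rw [Complex.norm_exp]; simp
    have h1 := hC p.2
    have h2 := (hC' () ((ε / 2) • (x + p.2), p.1)).trans
      (mul_le_mul_of_nonneg_left (symWt_le_wt_inv D hm _) hC0')
    calc _ = ‖e (x, p.2) * φ p.2‖ * ‖f ((ε / 2) • (x + p.2), p.1)‖ := by
          simp only [norm_mul, e1]; ring
      _ ≤ (C * (wt p.2 ^ D)⁻¹) * (C' * (2 ^ D * (wt p.1 ^ D)⁻¹)) :=
          mul_le_mul h1 h2 (norm_nonneg _) (mul_nonneg hC0 (wt_pow_inv_nonneg _ _))
      _ = _ := by ring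
  -- Decay of `f` in momentum makes the double integral absolutely convergent; with `η` innermost it
  -- becomes the partial Fourier transform.
  rw [integral_integral_swap hi]
  refine integral_congr_ae (Eventually.of_forall fun y => ?_)
  simp only [pft, ft]
  rw [← integral_const_mul]
  refine integral_congr_ae (Eventually.of_forall fun η => ?_)
  simp only [phase, pairing_space]
  rw [real_inner_comm]
  ring

end Operators

/-! ### Composition of quantizations -/

section CompositionRapid

variable {d : ℕ}

theorem RapidFamily.symWt {ι : Type*} [TopologicalSpace ι] {u : ι → Phase d → ℂ}
    (hu : RapidFamily u) (m : ℝ) (N : ℕ) : BddFamily N (symWt m) u := by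
  refine (hu N ⌈|m|⌉₊).mono' (fun X => ?_) (wt_pow_inv_nonneg _)
  have hb := bracket_pos X.2
  have h1 : -((⌈|m|⌉₊ : ℕ) : ℝ) ≤ m := by
    have := Nat.le_ceil |m|
    linarith [neg_abs_le m]
  refine le_trans ?_ (symWt_mono h1 X)
  rw [MagneticWeyl.symWt, Real.rpow_neg hb.le, Real.rpow_natCast]
  exact inv_anti₀ (pow_pos hb _) (pow_le_pow_left₀ hb.le
    ((bracket_le_wt _).trans (wt_snd_le X)) _)

/-- The integrand of the kernel form of a twisted product. -/
def kernelAmp (ε : ℝ) (G : Space d × Space d × Space d → ℂ) (u v : Phase d → ℂ) (p : Space d)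
    (w : Phase d) : ℂ :=
  G (p, w) * (pft u (p - (ε / 2) • w.2, w.1) * pft v (p + (ε / 2) • w.1, w.2))

variable {u v : Phase d → ℂ} {G : Space d × Space d × Space d → ℂ}

theorem continuous_kernelAmp (ε : ℝ) (hG : PolyFamily cfgWt fun _ : Unit => G)
    (hu : RapidFamily fun _ : Unit => u) (hv : RapidFamily fun _ : Unit => v) (p : Space d) :
    Continuous (kernelAmp ε G u v p) := by
  have h1 := hG.exists_bound.1
  have h2 := hu.continuous_pft
  have h3 := hv.continuous_pft
  unfold kernelAmp
  fun_prop

theorem exists_norm_kernelAmp_le (ε : ℝ) (hG : PolyFamily cfgWt fun _ : Unit => G)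
    (hu : RapidFamily fun _ : Unit => u) (hv : RapidFamily fun _ : Unit => v) (n : ℕ) :
    ∃ C, 0 ≤ C ∧ ∀ p w, ‖kernelAmp ε G u v p w‖ ≤ C * ((wt w.1 ^ n)⁻¹ * (wt w.2 ^ n)⁻¹) := by
  obtain ⟨-, C, k, hC0, hC⟩ := hG.exists_bound
  obtain ⟨Cu, hCu0, hCu⟩ := hu.exists_norm_pft_le (n + k)
  obtain ⟨Cv, hCv0, hCv⟩ := hv.exists_norm_pft_le (n + k)
  refine ⟨C * Cu * Cv, by positivity, fun p w => ?_⟩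
  have hy := wt_pos w.1
  have hz := wt_pos w.2
  have h1 : ‖G (p, w)‖ ≤ C * (wt w.1 ^ k * wt w.2 ^ k) := by
    refine (hC _).trans (mul_le_mul_of_nonneg_left ?_ hC0)
    rw [← mul_pow]
    exact pow_le_pow_left₀ (wt_nonneg _) (wt_prod_le w) k
  have h2 : ‖pft u (p - (ε / 2) • w.2, w.1)‖ ≤ Cu * (wt w.1 ^ (n + k))⁻¹ :=
    (hCu _).trans (mul_le_mul_of_nonneg_left (mul_le_of_le_one_left (wt_pow_inv_nonneg _ _)
      (wt_pow_inv_le_one _ _)) hCu0)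
  have h3 : ‖pft v (p + (ε / 2) • w.1, w.2)‖ ≤ Cv * (wt w.2 ^ (n + k))⁻¹ :=
    (hCv _).trans (mul_le_mul_of_nonneg_left (mul_le_of_le_one_left (wt_pow_inv_nonneg _ _)
      (wt_pow_inv_le_one _ _)) hCv0)
  rw [kernelAmp, norm_mul, norm_mul]
  calc _ ≤ C * (wt w.1 ^ k * wt w.2 ^ k) * ((Cu * (wt w.1 ^ (n + k))⁻¹) *
        (Cv * (wt w.2 ^ (n + k))⁻¹)) := mul_le_mul h1 (mul_le_mul h2 h3 (norm_nonneg _)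
          (by positivity)) (by positivity) (by positivity)
    _ = C * Cu * Cv * (((wt w.1 ^ (n + k))⁻¹ * wt w.1 ^ k) *
        ((wt w.2 ^ (n + k))⁻¹ * wt w.2 ^ k)) := by ring
    _ = _ := by rw [wt_pow_inv_mul_pow, wt_pow_inv_mul_pow]

theorem integrable_wt_pow_inv_mul (d : ℕ) : Integrable fun p : Space d × Space d =>
    (wt p.1 ^ (Module.finrank ℝ (Space d) + 1))⁻¹ * (wt p.2 ^ (Module.finrank ℝ (Space d) + 1))⁻¹ :=
  (integrable_wt_pow_inv (volume : Measure (Space d)) le_rfl).mul_prod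
    (integrable_wt_pow_inv (volume : Measure (Space d)) le_rfl)

/-- The kernel of the composition. -/
def compKernel (ε : ℝ) (G : Space d × Space d × Space d → ℂ) (u v : Phase d → ℂ) (p w : Space d) : ℂ :=
  ∫ y, kernelAmp ε G u v p (y, w - y)

theorem integrable_kernelAmp (ε : ℝ) (hG : PolyFamily cfgWt fun _ : Unit => G)
    (hu : RapidFamily fun _ : Unit => u) (hv : RapidFamily fun _ : Unit => v) (p : Space d) :
    Integrable (kernelAmp ε G u v p) := by
  obtain ⟨C, hC0, hC⟩ := exists_norm_kernelAmp_le ε hG hu hv (Module.finrank ℝ (Space d) + 1)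
  exact ((integrable_wt_pow_inv_mul d).const_mul C).mono'
    (continuous_kernelAmp ε hG hu hv p).aestronglyMeasurable (Eventually.of_forall (hC p))

theorem integrable_shear {F : Phase d → ℂ} (hF : Integrable F) :
    Integrable fun q : Phase d => F (q.1, q.2 - q.1) := by
  have h := measurePreserving_prod_neg_add (volume : Measure (Space d)) (volume : Measure (Space d))
  refine (h.integrable_comp_of_integrable hF).congr (Eventually.of_forall fun q => ?_)
  simp [neg_add_eq_sub]

/-- In the kernel form `ξ` meets only `y + z`, so the substitution `w = y + z` exhibits a Fourier
transform in `w`. -/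
theorem sharp_eq_ft_compKernel {ε : ℝ} (hε : ε ≠ 0) (hG : PolyFamily cfgWt fun _ : Unit => G)
    (hu : RapidFamily fun _ : Unit => u) (hv : RapidFamily fun _ : Unit => v) (p ξ : Space d) :
    sharp ε G u v (p, ξ) =
      (((2 * Real.pi) ^ (2 * d) : ℝ) : ℂ)⁻¹ * ft (compKernel ε G u v p) (-ξ) := by
  obtain ⟨hGc, hGb⟩ := hG.exists_bound
  rw [sharp_eq_kernelIntegral hε hGc hGb hu hv, kernelIntegral]
  congr 1
  have hF := integrable_kernelAmp ε hG hu hv p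
  have h1 : Integrable fun w : Phase d => phase (w, (-ξ, -ξ)) * kernelAmp ε G u v p w :=
    Integrable.phase_mul hF _
  have h2 : Integrable fun q : Phase d => phase (q.2, -ξ) * kernelAmp ε G u v p (q.1, q.2 - q.1) :=
    (integrable_shear hF).bdd_mul (c := 1)
      (continuous_phase.comp (by fun_prop)).aestronglyMeasurable
      (Eventually.of_forall fun _ => (norm_phase _).le)
  change ∫ w : Phase d, phase (w, (-ξ, -ξ)) * kernelAmp ε G u v p w = _
  rw [integral_volume_prod h1]
  have h3 : ∀ y : Space d, ∫ z, phase ((y, z), (-ξ, -ξ)) * kernelAmp ε G u v p (y, z) =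
      ∫ w, phase (w, -ξ) * kernelAmp ε G u v p (y, w - y) := by
    intro y
    rw [← integral_sub_right_eq_self (fun z => phase ((y, z), (-ξ, -ξ)) *
      kernelAmp ε G u v p (y, z)) y]
    refine integral_congr_ae (Eventually.of_forall fun w => ?_)
    simp only [phase, pairing_prod, pairing_space, ← inner_add_left, add_sub_cancel]
  simp only [h3]
  rw [integral_integral_swap h2]
  refine integral_congr_ae (Eventually.of_forall fun w => ?_)
  simp only [compKernel]
  rw [integral_const_mul]

theorem pft_sharp {ε : ℝ} (hε : ε ≠ 0) (hε1 : |ε| ≤ 1) (hG : PolyFamily cfgWt fun _ : Unit => G)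
    (hu : RapidFamily fun _ : Unit => u) (hv : RapidFamily fun _ : Unit => v) (p w : Space d) :
    pft (sharp ε G u v) (p, w) = (((2 * Real.pi) ^ d : ℝ) : ℂ)⁻¹ * compKernel ε G u v p w := by
  set D := Module.finrank ℝ (Space d) + 1 with hD
  have hpi : (((2 * Real.pi) ^ d : ℝ) : ℂ) ≠ 0 := by
    exact_mod_cast (pow_pos (by positivity : (0 : ℝ) < 2 * Real.pi) d).ne'
  have hc : Continuous (compKernel ε G u v p) := by
    obtain ⟨C, hC0, hC⟩ := exists_norm_kernelAmp_le ε hG hu hv D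
    have hk := continuous_kernelAmp ε hG hu hv p
    refine continuous_of_dominated (bound := fun y => C * (wt y ^ D)⁻¹)
      (fun w => (hk.comp (by fun_prop)).aestronglyMeasurable)
      (fun w => Eventually.of_forall fun y => (hC p _).trans ?_)
      ((integrable_wt_pow_inv (volume : Measure (Space d)) le_rfl).const_mul C)
      (Eventually.of_forall fun y => hk.comp (by fun_prop))
    exact mul_le_mul_of_nonneg_left (mul_le_of_le_one_right (wt_pow_inv_nonneg _ _)
      (wt_pow_inv_le_one _ _)) hC0
  have hi : Integrable (compKernel ε G u v p) :=
    (integrable_shear (integrable_kernelAmp ε hG hu hv p)).integral_prod_right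
  have hs : ∀ N, BddFamily N (symWt (-(D : ℝ))) fun _ : Unit => sharp ε G u v := fun N => by
    -- Rapid decrease permits any orders: `-D` for `u` and `0` for `v` give a product of order `-D`,
    -- integrable in momentum.
    have := bddFamily_sharp (ε := fun _ : Unit => ε) continuous_const (fun _ => hε1) hG
      (hu.symWt (-(D : ℝ))) (hv.symWt 0) N
    simpa only [add_zero] using this
  have hsi : Integrable fun ξ => sharp ε G u v (p, ξ) := by
    obtain ⟨C, hC0, hC⟩ := (hs 0).exists_bound_pos (symWt_nonneg _)
    refine ((integrable_wt_pow_inv (volume : Measure (Space d)) le_rfl).const_mul (C * 2 ^ D)).mono'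
      (((hs 0).continuous_apply ()).comp (by fun_prop)).aestronglyMeasurable
      (Eventually.of_forall fun ξ => (hC () (p, ξ)).trans ?_)
    rw [mul_assoc]
    exact mul_le_mul_of_nonneg_left (symWt_le_wt_inv D le_rfl _) hC0
  have hc2 : (((2 * Real.pi) ^ (2 * d) : ℝ) : ℂ) = ((2 * Real.pi) ^ d : ℝ) * ((2 * Real.pi) ^ d : ℝ) := by
    rw [← Complex.ofReal_mul, ← pow_add, two_mul d]
  have hF : Integrable (ft (compKernel ε G u v p)) := by
    refine ((hsi.comp_neg).const_mul (((2 * Real.pi) ^ (2 * d) : ℝ) : ℂ)).congr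
      (Eventually.of_forall fun η => ?_)
    simp only
    rw [sharp_eq_ft_compKernel hε hG hu hv, neg_neg, hc2, mul_inv_cancel_left₀ (mul_ne_zero hpi hpi)]
  have h := ft_ft hc hi hF w
  have e1 : pft (sharp ε G u v) (p, w) =
      (((2 * Real.pi) ^ (2 * d) : ℝ) : ℂ)⁻¹ * ft (ft (compKernel ε G u v p)) (-w) := by
    simp only [pft, sharp_eq_ft_compKernel hε hG hu hv]
    rw [ft_const_mul]
    congr 1
    rw [ft, ← integral_neg_eq_self, ft]
    refine integral_congr_ae (Eventually.of_forall fun ξ => ?_)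
    simp only [neg_neg]
    congr 1
    simp [phase, pairing_space]
  rw [e1, h, hc2]
  field_simp

/-- The kernel of the composition is an integral over the intermediate point `y`. With `p = (ε/2)(x
+ r)`, the arguments `p - (ε/2)(r - y)` and `p + (ε/2)(y - x)` in `kernelAmp` are the scaled
midpoints of `x, y` and of `y, r`, and the cocycle identity exchanges the gauge factors for `G`. -/
theorem op_comp_of_rapid {ε : ℝ} (hε : ε ≠ 0) (hε1 : |ε| ≤ 1) {e : Space d × Space d → ℂ}
    (he : PolyFamily wt fun _ : Unit => e) (he1 : ∀ p, ‖e p‖ ≤ 1)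
    (hG : PolyFamily cfgWt fun _ : Unit => G)
    (hcocycle : ∀ x y r, e (x, y) * e (y, r) = e (x, r) * G ((ε / 2) • (x + r), (y - x, r - y)))
    (hu : RapidFamily fun _ : Unit => u) (hv : RapidFamily fun _ : Unit => v)
    {φ : Space d → ℂ} (hφ : RapidFamily fun _ : Unit => φ) (x : Space d) :
    op ε e u (op ε e v φ) x = op ε e (sharp ε G u v) φ x := by
  set D := Module.finrank ℝ (Space d) + 1 with hD
  have hm : -(D : ℝ) ≤ -((Module.finrank ℝ (Space d) + 1 : ℕ) : ℝ) := le_rfl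
  have hs : ∀ N, BddFamily N (symWt (-(D : ℝ))) fun _ : Unit => sharp ε G u v := fun N => by
    have := bddFamily_sharp (ε := fun _ : Unit => ε) continuous_const (fun _ => hε1) hG
      (hu.symWt (-(D : ℝ))) (hv.symWt 0) N
    simpa only [add_zero] using this
  rw [op_eq_kernel he hφ hs hm, op_eq_kernel he (rapidFamily_op ε he hφ (hv.symWt 0))
    (hu.symWt _) hm]
  simp only [op_eq_kernel he hφ (hv.symWt _) hm]
  congr 1
  have hec : Continuous e := (he.contDiff ()).continuous
  have hφc : Continuous φ := (hφ.contDiff ()).continuous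
  have huc := hu.continuous_pft
  have hvc := hv.continuous_pft
  have hi : Integrable fun q : Space d × Space d => (e (x, q.1) * e (q.1, q.2)) *
      (φ q.2 * (pft u ((ε / 2) • (x + q.1), q.1 - x) * pft v ((ε / 2) • (q.1 + q.2), q.2 - q.1))) := by
    obtain ⟨Cu, hCu0, hCu⟩ := hu.exists_norm_pft_le D
    obtain ⟨Cv, hCv0, hCv⟩ := hv.exists_norm_pft_le 0
    obtain ⟨Cφ, hCφ0, hCφ⟩ := (hφ 0 D).exists_bound_pos (wt_pow_inv_nonneg _)
    have hg : Integrable fun q : Space d × Space d => (wt (q.1 - x) ^ D)⁻¹ * (wt q.2 ^ D)⁻¹ :=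
      (((integrable_wt_pow_inv (volume : Measure (Space d)) le_rfl).comp_sub_right x)).mul_prod
        (integrable_wt_pow_inv (volume : Measure (Space d)) le_rfl)
    refine (hg.const_mul (Cφ * Cu * Cv)).mono' (Continuous.aestronglyMeasurable (by fun_prop))
      (Eventually.of_forall fun q => ?_)
    have h1 : ‖pft u ((ε / 2) • (x + q.1), q.1 - x)‖ ≤ Cu * (wt (q.1 - x) ^ D)⁻¹ :=
      (hCu _).trans (mul_le_mul_of_nonneg_left (mul_le_of_le_one_left (wt_pow_inv_nonneg _ _)
        (wt_pow_inv_le_one _ _)) hCu0)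
    have h2 : ‖pft v ((ε / 2) • (q.1 + q.2), q.2 - q.1)‖ ≤ Cv := by
      simpa using hCv ((ε / 2) • (q.1 + q.2), q.2 - q.1)
    have h3 := hCφ () q.2
    simp only [norm_mul]
    have h4 := wt_pow_inv_nonneg D (q.1 - x)
    have h5 := wt_pow_inv_nonneg D q.2
    calc _ ≤ (1 * 1) * ((Cφ * (wt q.2 ^ D)⁻¹) * ((Cu * (wt (q.1 - x) ^ D)⁻¹) * Cv)) := by
          gcongr
          · exact he1 _
          · exact he1 _
      _ = _ := by ring
  have hL : ∀ y, e (x, y) * ((((2 * Real.pi) ^ d : ℝ) : ℂ)⁻¹ * ∫ r, e (y, r) * φ r *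
      pft v ((ε / 2) • (y + r), r - y)) * pft u ((ε / 2) • (x + y), y - x) =
      (((2 * Real.pi) ^ d : ℝ) : ℂ)⁻¹ * ∫ r, (e (x, y) * e (y, r)) *
      (φ r * (pft u ((ε / 2) • (x + y), y - x) * pft v ((ε / 2) • (y + r), r - y))) := by
    intro y
    rw [mul_left_comm, mul_assoc, ← integral_const_mul, ← integral_mul_const]
    congr 1
    exact integral_congr_ae (Eventually.of_forall fun r => by simp only; ring)
  simp only [hL]
  rw [integral_const_mul, integral_integral_swap hi, ← integral_const_mul]
  refine integral_congr_ae (Eventually.of_forall fun r => ?_)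
  simp only [pft_sharp hε hε1 hG hu hv, compKernel]
  rw [mul_left_comm]
  congr 1
  rw [← integral_sub_right_eq_self (fun y => kernelAmp ε G u v ((ε / 2) • (x + r)) (y, r - x - y)) x,
    ← integral_const_mul]
  refine integral_congr_ae (Eventually.of_forall fun y => ?_)
  have e1 : r - x - (y - x) = r - y := by abel
  have e2 : (ε / 2) • (x + r) - (ε / 2) • (r - y) = (ε / 2) • (x + y) := by module
  have e3 : (ε / 2) • (x + r) + (ε / 2) • (y - x) = (ε / 2) • (y + r) := by module
  simp only [kernelAmp, e1, e2, e3, hcocycle]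
  ring

end CompositionRapid

/-! ### Composition of quantizations -/

section Composition

variable {d : ℕ} {m₁ m₂ : ℝ}

theorem rapidFamily_cutoff : RapidFamily fun _ : Unit => (cutoff : Phase d → ℂ) :=
  (SchwartzMap.rapidFamily (hasCompactSupport_cutoff.toSchwartzMap contDiff_cutoff)).congr
    fun _ _ => rfl

theorem dilateMul_cutoff_zero (f : Phase d → ℂ) : dilateMul cutoff f 0 = f := by
  ext X; simp [dilateMul, cutoff_zero]

/-- Both sides are continuous in the cut-off parameter on `[0, 1]` and agree for `δ > 0` by
`op_comp_of_rapid`, hence at `δ = 0`. -/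
theorem op_comp {ε : ℝ} (hε : ε ≠ 0) (hε1 : |ε| ≤ 1) {e : Space d × Space d → ℂ}
    (he : PolyFamily wt fun _ : Unit => e) (he1 : ∀ p, ‖e p‖ ≤ 1)
    {G : Space d × Space d × Space d → ℂ} (hG : PolyFamily cfgWt fun _ : Unit => G)
    (hcocycle : ∀ x y r, e (x, y) * e (y, r) = e (x, r) * G ((ε / 2) • (x + r), (y - x, r - y)))
    {f g : Phase d → ℂ} (hf : ∀ N, BddFamily N (symWt m₁) fun _ : Unit => f)
    (hg : ∀ N, BddFamily N (symWt m₂) fun _ : Unit => g)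
    {φ : Space d → ℂ} (hφ : RapidFamily fun _ : Unit => φ) (x : Space d) :
    op ε e f (op ε e g φ) x = op ε e (sharp ε G f g) φ x := by
  have hχ := rapidFamily_cutoff (d := d)
  have hφ' : RapidFamily fun _ : unitInterval => φ :=
    hφ.reindex (e := fun _ : unitInterval => ()) continuous_const
  have hX : Continuous fun δ : unitInterval => (δ, x) := by fun_prop
  have hL : Continuous fun δ : unitInterval =>
      op ε e (dilateMul cutoff f δ) (op ε e (dilateMul cutoff g δ) φ) x := by
    have h := (rapidFamily_op ε he (rapidFamily_op ε he hφ' (bddFamily_dilateMul hχ hg))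
      (bddFamily_dilateMul hχ hf) 0 0).continuous.comp hX
    simp only [Function.comp_def] at h
    exact h
  have hR : Continuous fun δ : unitInterval =>
      op ε e (sharp ε G (dilateMul cutoff f δ) (dilateMul cutoff g δ)) φ x := by
    have h := (rapidFamily_op ε he hφ' (bddFamily_sharp (ι := unitInterval) (ε := fun _ => ε)
      continuous_const (fun _ => hε1) hG.of_unit (bddFamily_dilateMul hχ hf)
      (bddFamily_dilateMul hχ hg)) 0 0).continuous.comp hX
    simp only [Function.comp_def] at h
    exact h
  have hL' := tendsto_apply_of_unitInterval
    (F := fun δ : ℝ => op ε e (dilateMul cutoff f δ) (op ε e (dilateMul cutoff g δ) φ) x) hL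
  have hR' := tendsto_apply_of_unitInterval
    (F := fun δ : ℝ => op ε e (sharp ε G (dilateMul cutoff f δ) (dilateMul cutoff g δ)) φ x) hR
  simp only [dilateMul_cutoff_zero] at hL' hR'
  refine tendsto_nhds_unique (hL'.congr' ?_) hR'
  filter_upwards [self_mem_nhdsWithin] with δ hδ
  have hδ' : δ ≠ 0 := (mem_Ioi.1 hδ).ne'
  exact op_comp_of_rapid hε hε1 he he1 hG hcocycle (rapidFamily_dilateMul hχ hf hδ')
    (rapidFamily_dilateMul hχ hg hδ') hφ x

end Composition

/-! ### Stokes' theorem on a triangle -/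

section Stokes

/-- The standard triangle. -/
def stdTriangle : Set (ℝ × ℝ) := {z | 0 < z.1 ∧ 0 < z.2 ∧ z.1 + z.2 ≤ 1}

theorem measurableSet_stdTriangle : MeasurableSet stdTriangle :=
  (measurableSet_lt measurable_const measurable_fst).inter
    ((measurableSet_lt measurable_const measurable_snd).inter
      (measurableSet_le (measurable_fst.add measurable_snd) measurable_const))

theorem integrableOn_stdTriangle {F : ℝ × ℝ → ℝ} (hF : Continuous F) :
    IntegrableOn F stdTriangle := by
  refine (hF.continuousOn.integrableOn_compact (isCompact_Icc (a := ((0, 0) : ℝ × ℝ))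
    (b := (1, 1)))).mono_set fun z hz => ?_
  obtain ⟨h1, h2, h3⟩ := hz
  exact ⟨⟨h1.le, h2.le⟩, ⟨by simp only; linarith, by simp only; linarith⟩⟩

/-- The triangle is half-open so that its slices are exactly the intervals `(0, 1 - s]`. As a set
integral it can be reflected and split without regard to the order of integration. -/
theorem setIntegral_stdTriangle {F : ℝ × ℝ → ℝ} (hF : Continuous F) :
    ∫ z in stdTriangle, F z = ∫ s in (0 : ℝ)..1, ∫ t in (0 : ℝ)..(1 - s), F (s, t) := by
  rw [← integral_indicator measurableSet_stdTriangle, Measure.volume_eq_prod, integral_prod _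
    ((integrable_indicator_iff measurableSet_stdTriangle).2 (integrableOn_stdTriangle hF)),
    intervalIntegral.integral_of_le zero_le_one, ← integral_indicator measurableSet_Ioc]
  refine integral_congr_ae (Eventually.of_forall fun s => ?_)
  simp only [indicator_apply]
  split_ifs with hs
  · rw [intervalIntegral.integral_of_le (by linarith [hs.2]), ← integral_indicator measurableSet_Ioc]
    refine integral_congr_ae (Eventually.of_forall fun t => ?_)
    have h : (s, t) ∈ stdTriangle ↔ t ∈ Ioc 0 (1 - s) :=
      ⟨fun ⟨_, h2, h3⟩ => ⟨h2, by simp only at h3; linarith⟩,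
        fun ⟨h2, h3⟩ => ⟨hs.1, h2, by simp only; linarith⟩⟩
    beta_reduce
    by_cases ht : t ∈ Ioc 0 (1 - s)
    · rw [indicator_of_mem (h.2 ht), indicator_of_mem ht]
    · rw [indicator_of_notMem (fun h' => ht (h.1 h')), indicator_of_notMem ht]
  · have : ∀ t, (s, t) ∉ stdTriangle := fun t ⟨h1, h2, h3⟩ => by
      simp only at h1 h2 h3
      exact hs ⟨h1, by linarith⟩
    simp [this]

theorem setIntegral_stdTriangle_swap (F : ℝ × ℝ → ℝ) :
    ∫ z in stdTriangle, F z.swap = ∫ z in stdTriangle, F z := by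
  have h : MeasurePreserving (MeasurableEquiv.prodComm : ℝ × ℝ ≃ᵐ ℝ × ℝ) := by
    rw [Measure.volume_eq_prod]
    exact Measure.measurePreserving_swap
  have h2 := h.setIntegral_preimage_emb MeasurableEquiv.prodComm.measurableEmbedding F stdTriangle
  have h3 : (MeasurableEquiv.prodComm : ℝ × ℝ ≃ᵐ ℝ × ℝ) ⁻¹' stdTriangle = stdTriangle := by
    ext z
    change (0 < z.2 ∧ 0 < z.1 ∧ z.2 + z.1 ≤ 1) ↔ (0 < z.1 ∧ 0 < z.2 ∧ z.1 + z.2 ≤ 1)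
    rw [add_comm z.2]
    tauto
  rw [h3] at h2
  exact h2

variable {d : ℕ}

/-- The integral over a triangle of a derivative along one of its sides. -/
theorem setIntegral_stdTriangle_fderiv {h : Space d → ℝ} (hh : ContDiff ℝ ∞ h) (p a b : Space d) :
    ∫ z in stdTriangle, fderiv ℝ h (p + z.1 • a + z.2 • b) b =
      (∫ s in (0 : ℝ)..1, h (p + s • a + (1 - s) • b)) - ∫ s in (0 : ℝ)..1, h (p + s • a) := by
  have hc := hh.continuous
  have hd : Continuous (fderiv ℝ h) := hh.continuous_fderiv (by simp)
  have hF : Continuous fun z : ℝ × ℝ => fderiv ℝ h (p + z.1 • a + z.2 • b) b :=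
    (hd.comp (by fun_prop)).clm_apply continuous_const
  rw [setIntegral_stdTriangle hF, ← intervalIntegral.integral_sub
    (Continuous.intervalIntegrable (by fun_prop) _ _)
    (Continuous.intervalIntegrable (by fun_prop) _ _)]
  refine intervalIntegral.integral_congr fun s _ => ?_
  have hder : ∀ t : ℝ, HasDerivAt (fun t : ℝ => h (p + s • a + t • b))
      (fderiv ℝ h (p + s • a + t • b) b) t := fun t => by
    have h1 : HasDerivAt (fun t : ℝ => p + s • a + t • b) b t := by
      simpa using ((hasDerivAt_id t).smul_const b).const_add (p + s • a)
    exact ((hh.differentiable (by simp) _).hasFDerivAt).comp_hasDerivAt t h1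
  have := intervalIntegral.integral_eq_sub_of_hasDerivAt (a := 0) (b := 1 - s)
    (fun t _ => hder t) (Continuous.intervalIntegrable (hF.comp (by fun_prop : Continuous fun t : ℝ =>
      (s, t))) _ _)
  simpa using this

theorem fderiv_eq_sum {h : Space d → ℝ} (x a : Space d) :
    fderiv ℝ h x a = ∑ l, a l * fderiv ℝ h x (basisVec l) := by
  have : a = ∑ l, a l • basisVec l := by
    ext i; simp [Pi.single_apply]
  conv_lhs => rw [this]
  simp

/-- Stokes' theorem: the flux through a triangle is the circulation along its boundary. -/
theorem flux_eq_circulation {B : Fin d → Fin d → Space d → ℝ} {A : Fin d → Space d → ℝ}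
    (hA : IsVectorPotential B A) (p q r : Space d) :
    flux B p q r = circulation A p q + circulation A q r - circulation A p r := by
  set a := q - p with ha
  set b := r - p with hb
  have hs : ∀ l, ContDiff ℝ ∞ (A l) := fun l => (hA.growth l).1
  have hd : ∀ l, Continuous (fderiv ℝ (A l)) := fun l => (hs l).continuous_fderiv (by simp)
  have hF : ∀ l v, Continuous fun z : ℝ × ℝ => fderiv ℝ (A l) (p + z.1 • a + z.2 • b) v := fun l v =>
    ((hd l).comp (by fun_prop)).clm_apply continuous_const
  have hBc : ∀ l j, Continuous fun z : ℝ × ℝ => B l j (p + z.1 • a + z.2 • b) := fun l j => by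
    simp only [hA.represents]
    exact (hF j _).sub (hF l _)
  have e1 : flux B p q r = ∑ l, ∑ j,
      (∫ z in stdTriangle, B l j (p + z.1 • a + z.2 • b)) * a l * b j := by
    unfold flux
    refine Finset.sum_congr rfl fun l _ => Finset.sum_congr rfl fun j _ => ?_
    rw [setIntegral_stdTriangle (hBc l j)]
    simp [a, b]
  have e2 : ∀ j v, ∫ z in stdTriangle, fderiv ℝ (A j) (p + z.1 • a + z.2 • b) v =
      ∑ l, v l * ∫ z in stdTriangle, fderiv ℝ (A j) (p + z.1 • a + z.2 • b) (basisVec l) := by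
    intro j v
    simp only [← integral_const_mul]
    rw [← integral_finsetSum _ fun l _ => ((integrableOn_stdTriangle (hF j _)).const_mul _)]
    simp only [← fderiv_eq_sum]
  -- On the edge vectors the two-form `dA` is `∂_a(A·b) - ∂_b(A·a)`, so both terms are derivatives
  -- along an edge.
  have e3 : flux B p q r =
      (∑ j, b j * ∫ z in stdTriangle, fderiv ℝ (A j) (p + z.1 • a + z.2 • b) a) -
        ∑ l, a l * ∫ z in stdTriangle, fderiv ℝ (A l) (p + z.1 • a + z.2 • b) b := by
    rw [e1]
    simp only [e2 _ a, e2 _ b, Finset.mul_sum]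
    conv_rhs => rw [Finset.sum_comm]
    rw [← Finset.sum_sub_distrib]
    refine Finset.sum_congr rfl fun l _ => ?_
    rw [← Finset.sum_sub_distrib]
    refine Finset.sum_congr rfl fun j _ => ?_
    simp only [hA.represents]
    rw [integral_sub (integrableOn_stdTriangle (hF j _)) (integrableOn_stdTriangle (hF l _))]
    ring
  have e4 : ∀ j, ∫ z in stdTriangle, fderiv ℝ (A j) (p + z.1 • a + z.2 • b) a =
      (∫ t in (0 : ℝ)..1, A j (p + t • b + (1 - t) • a)) - ∫ t in (0 : ℝ)..1, A j (p + t • b) := by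
    intro j
    rw [← setIntegral_stdTriangle_fderiv (hs j), ← setIntegral_stdTriangle_swap]
    refine integral_congr_ae (Eventually.of_forall fun z => ?_)
    simp only [Prod.fst_swap, Prod.snd_swap]
    congr 2
    abel
  have e5 : ∀ l, ∫ z in stdTriangle, fderiv ℝ (A l) (p + z.1 • a + z.2 • b) b =
      (∫ t in (0 : ℝ)..1, A l (p + t • b + (1 - t) • a)) - ∫ s in (0 : ℝ)..1, A l (p + s • a) := by
    intro l
    rw [setIntegral_stdTriangle_fderiv (hs l)]
    congr 1
    have := intervalIntegral.integral_comp_sub_left (a := 0) (b := 1)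
      (fun t : ℝ => A l (p + t • b + (1 - t) • a)) 1
    simp only [sub_self, sub_zero, sub_sub_cancel] at this
    rw [← this]
    congr 1
    ext s
    congr 1
    abel
  -- Both boundary terms `e4` and `e5` involve the side from `q` to `r`; together they occur with
  -- coefficient `b - a = r - q`, which is the circulation along that side.
  have e6 : ∀ t : ℝ, p + t • b + (1 - t) • a = q + t • (r - q) := fun t => by
    simp only [a, b]; module
  have e7 : ∀ j, r j - q j = b j - a j := fun j => by simp [a, b]
  rw [e3]
  simp only [e4, e5, e6, circulation, e7]
  rw [← Finset.sum_sub_distrib, ← Finset.sum_add_distrib, ← Finset.sum_sub_distrib]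
  refine Finset.sum_congr rfl fun j _ => ?_
  simp only [a, b, PiLp.sub_apply]
  ring

theorem scaledFlux_eq_circulation {B : Fin d → Fin d → Space d → ℝ} {A : Fin d → Space d → ℝ}
    (hA : IsVectorPotential B A) (ε : ℝ) (x y r : Space d) :
    scaledFlux B ε ((ε / 2) • (x + r)) (y - x) (r - y) =
      scaledCirculation A ε x y + scaledCirculation A ε y r - scaledCirculation A ε x r := by
  have h1 : (ε / 2) • (x + r) - (ε / 2) • (y - x + (r - y)) = ε • x := by module
  have h2 : (ε / 2) • (x + r) + (ε / 2) • (y - x - (r - y)) = ε • y := by module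
  have h3 : (ε / 2) • (x + r) + (ε / 2) • (y - x + (r - y)) = ε • r := by module
  rw [scaledFlux, h1, h2, h3, flux_eq_circulation hA]
  simp only [scaledCirculation]
  ring

end Stokes

/-! ### The magnetic gauge factor -/

section Gauge

variable {d : ℕ}

/-- The magnetic gauge factor `e^{-iλ Γ^A_ε([x, y])}`. -/
def gauge (A : Fin d → Space d → ℝ) (ε lam : ℝ) (p : Space d × Space d) : ℂ :=
  Complex.exp (-Complex.I * lam * (scaledCirculation A ε p.1 p.2 : ℂ))

theorem norm_gauge (A : Fin d → Space d → ℝ) (ε lam : ℝ) (p : Space d × Space d) :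
    ‖gauge A ε lam p‖ = 1 := by
  rw [gauge, Complex.norm_exp]; simp

/-- Stokes' theorem on the triangle with corners `εx`, `εy`, `εr`: the defect is a flux and so
depends on `B` only, not on the potential. -/
theorem gauge_cocycle {B : Fin d → Fin d → Space d → ℝ} {A : Fin d → Space d → ℝ}
    (hA : IsVectorPotential B A) (ε lam : ℝ) (x y r : Space d) :
    gauge A ε lam (x, y) * gauge A ε lam (y, r) = gauge A ε lam (x, r) *
      Complex.exp (-Complex.I * lam * fluxFun B ε ((ε / 2) • (x + r), (y - x, r - y))) := by
  simp only [gauge, fluxFun, scaledFlux_eq_circulation hA, ← Complex.exp_add]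
  congr 1
  push_cast
  ring

theorem polyFamily_segmentAvg {b : Space d → ℝ} (hb : b.HasTemperateGrowth) (ε : ℝ) :
    PolyFamily wt fun (_ : Unit) (p : Space d × Space d) =>
      ((∫ s in (0 : ℝ)..1, b (ε • p.1 + s • (ε • p.2 - ε • p.1)) : ℝ) : ℂ) := by
  intro N
  have hI : Integrable (fun _ : unitInterval => (1 : ℂ)) := integrable_const _
  obtain ⟨k, C, hC0, hC⟩ := hb.norm_iteratedFDeriv_le_uniform N
  have hb1 : BddFamily N (fun x => wt x ^ k) fun (_ : unitInterval × Unit) x => (b x : ℂ) :=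
    bddFamily_of_iteratedFDeriv (Complex.ofRealCLM.contDiff.comp hb.1) fun n hn =>
      ⟨C, fun x => (norm_iteratedFDeriv_ofReal hb.1 n x).le.trans (hC n hn x)⟩
  let P1 : Space d × Space d →L[ℝ] Space d := ContinuousLinearMap.fst ℝ _ _
  let P2 : Space d × Space d →L[ℝ] Space d := ContinuousLinearMap.snd ℝ _ _
  let L : unitInterval × Unit → (Space d × Space d →L[ℝ] Space d) := fun s =>
    ε • P1 + (s.1 : ℝ) • (ε • P2 - ε • P1)
  have hL : ∀ s, ‖L s‖ ≤ ‖ε • P1‖ + ‖ε • P2 - ε • P1‖ := by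
    rintro ⟨⟨s, hs0, hs1⟩, _⟩
    refine (norm_add_le _ _).trans (add_le_add le_rfl ?_)
    rw [norm_smul, Real.norm_eq_abs, abs_of_nonneg hs0]
    exact mul_le_of_le_one_left (norm_nonneg _) hs1
  set D := ‖ε • P1‖ + ‖ε • P2 - ε • P1‖ with hD
  have hD0 : 0 ≤ D := by positivity
  have h1 : BddFamily N (fun p : Space d × Space d => wt p ^ k) fun s p => (b (L s p) : ℂ) := by
    refine hb1.comp (A := L) ?_ ⟨D, hL⟩ ⟨(1 + D) ^ k, by positivity, fun s p => ?_⟩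
      fun x => pow_nonneg (wt_nonneg _) _
    · simp only [L, _root_.add_apply, _root_.sub_apply, _root_.smul_apply]
      fun_prop
    · rw [← mul_pow]
      refine pow_le_pow_left₀ (wt_nonneg _) ?_ k
      have := ((L s).le_opNorm p).trans (mul_le_mul_of_nonneg_right (hL s) (norm_nonneg p))
      simp only [wt]
      nlinarith [norm_nonneg p]
  have h2 := h1.integral (continuous_wt.pow k) (fun p => pow_nonneg (wt_nonneg _) _) hI
  refine ⟨k, h2.congr fun _ p => ?_⟩
  rw [intervalIntegral_eq_unitInterval, ← integral_complex_ofReal]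
  exact integral_congr_ae (Eventually.of_forall fun s => one_mul _)

theorem polyFamily_scaledCirculation {A : Fin d → Space d → ℝ} (hA : ∀ l, (A l).HasTemperateGrowth)
    (ε : ℝ) : PolyFamily wt fun (_ : Unit) (p : Space d × Space d) =>
      (scaledCirculation A ε p.1 p.2 : ℂ) := by
  have c1 : ∀ l : Fin d, PolyFamily wt fun (_ : Unit) (p : Space d × Space d) => (p.1 l : ℂ) := fun l => by
    refine polyFamily_linear one_le_wt ((EuclideanSpace.proj l).comp
      (ContinuousLinearMap.fst ℝ (Space d) (Space d))) fun p => ?_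
    exact ((PiLp.norm_apply_le p.1 l).trans (norm_fst_le p)).trans (by simp [wt])
  have c2 : ∀ l : Fin d, PolyFamily wt fun (_ : Unit) (p : Space d × Space d) => (p.2 l : ℂ) := fun l => by
    refine polyFamily_linear one_le_wt ((EuclideanSpace.proj l).comp
      (ContinuousLinearMap.snd ℝ (Space d) (Space d))) fun p => ?_
    exact ((PiLp.norm_apply_le p.2 l).trans (norm_snd_le p)).trans (by simp [wt])
  -- The circulation runs between `εx` and `εy`, so its coordinate differences contain a factor `ε`.
  -- Collecting it as `ε⁻¹ * ε` also covers `ε = 0`.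
  refine ((PolyFamily.sum one_le_wt Finset.univ fun l _ =>
    (((c2 l).add one_le_wt ((c1 l).const_mul (c := fun _ => -1) continuous_const ⟨1, by simp⟩)).mul
      (polyFamily_segmentAvg (hA l) ε))).const_mul (c := fun _ => ((ε⁻¹ * ε : ℝ) : ℂ))
      continuous_const ⟨_, fun _ => le_rfl⟩).congr fun _ p => ?_
  simp only [scaledCirculation, circulation, PiLp.smul_apply, smul_eq_mul]
  push_cast
  rw [mul_assoc, Finset.mul_sum]
  congr 1
  refine Finset.sum_congr rfl fun l _ => ?_
  ring

theorem polyFamily_gauge {A : Fin d → Space d → ℝ} (hA : ∀ l, (A l).HasTemperateGrowth)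
    (ε lam : ℝ) : PolyFamily wt fun _ : Unit => gauge A ε lam := by
  have h1 : ∀ N, BddFamily N (fun _ : ℝ => 1) fun (_ : Unit) (s : ℝ) =>
      Complex.exp (-Complex.I * lam * s) :=
    bddFamily_exp (κ := fun _ => lam) continuous_const ⟨|lam|, fun _ => le_rfl⟩
  have h2 := PolyFamily.comp_real (H := Space d × Space d) one_le_wt
    (γ := fun _ p => scaledCirculation A ε p.1 p.2) h1 (polyFamily_scaledCirculation hA ε)
  exact h2.congr fun _ p => by rw [gauge]

variable {m : ℝ} {f : Phase d → ℂ} {φ : Space d → ℂ}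

theorem magneticQuantization_eq_op {A : Fin d → Space d → ℝ} (hA : ∀ l, (A l).HasTemperateGrowth)
    (ε lam : ℝ) (hφ : RapidFamily fun _ : Unit => φ)
    (hf : ∀ N, BddFamily N (symWt m) fun _ : Unit => f) :
    magneticQuantization A ε lam f φ = op ε (gauge A ε lam) f φ := by
  ext x
  exact (op_eq_iterated (polyFamily_gauge hA ε lam) hφ hf ε x).symm

theorem weylQuantization_eq_op (ε : ℝ) (hφ : RapidFamily fun _ : Unit => φ)
    (hf : ∀ N, BddFamily N (symWt m) fun _ : Unit => f) :
    weylQuantization ε f φ = op ε (fun _ => 1) f φ := by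
  ext x
  rw [op_eq_iterated PolyFamily.one hφ hf]
  simp only [mul_one, weylQuantization]

end Gauge

/-! ### Uniqueness of symbols -/

section Uniqueness

variable {d : ℕ} {m : ℝ} {f g : Phase d → ℂ} {φ : Space d → ℂ}

theorem op_sub {e : Space d × Space d → ℂ} (he : PolyFamily wt fun _ : Unit => e)
    (hφ : RapidFamily fun _ : Unit => φ) (hf : ∀ N, BddFamily N (symWt m) fun _ : Unit => f)
    (hg : ∀ N, BddFamily N (symWt m) fun _ : Unit => g) (ε : ℝ) (x : Space d) :
    op ε e (fun X => f X - g X) φ x = op ε e f φ x - op ε e g φ x := by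
  have h1 := amp_opAmp ε he hφ hf 0
  have h2 := amp_opAmp ε he hφ (fun N => (hg N).neg) 0
  have h3 := amp_opAmp ε he hφ hg 0
  have hc := continuous_wt_pow_inv (E := Space d) 0
  have h4 := h1.oscInt_add hc (wt_pow_inv_nonneg 0) h2 () x
  have h5 := h3.oscInt_const_mul hc (wt_pow_inv_nonneg 0) (-1) () x
  have e1 : ∀ z, opAmp ε e (fun X => f X - g X) φ (x, z) =
      opAmp ε e f φ (x, z) + opAmp ε e (fun X => -g X) φ (x, z) := fun z => by
    simp only [opAmp]; ring
  have e2 : ∀ z, opAmp ε e (fun X => -g X) φ (x, z) = -1 * opAmp ε e g φ (x, z) := fun z => by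
    simp only [opAmp]; ring
  simp only [op, e1]
  rw [h4]
  simp only [e2]
  rw [h5]
  ring

theorem bddFamily_one (N : ℕ) : BddFamily N (symWt 0) fun (_ : Unit) (_ : Phase d) => (1 : ℂ) :=
  (BddFamily.const continuous_const ⟨1, by simp⟩).mono' (fun X => by simp [symWt]) fun X => by simp

theorem rapidFamily_of_hasCompactSupport {H : Type*} [NormedAddCommGroup H] [NormedSpace ℝ H]
    {u : H → ℂ} (hu : ContDiff ℝ ∞ u) (hc : HasCompactSupport u) :
    RapidFamily fun _ : Unit => u :=
  (SchwartzMap.rapidFamily (hc.toSchwartzMap hu)).congr fun _ _ => rfl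

/-- The quantization of the symbol `1` is the identity. -/
theorem op_one (ε : ℝ) (hφ : RapidFamily fun _ : Unit => φ) (x : Space d) :
    op ε (fun _ => 1) (fun _ => 1) φ x = φ x := by
  have hpi : (((2 * Real.pi) ^ d : ℝ) : ℂ) ≠ 0 := by
    exact_mod_cast (pow_pos (by positivity : (0 : ℝ) < 2 * Real.pi) d).ne'
  rw [op_eq_iterated PolyFamily.one hφ bddFamily_one, inv_mul_eq_iff_eq_mul₀ hpi]
  have hc : Continuous φ := (hφ.contDiff ()).continuous
  have hF : Integrable (ft φ) := by
    obtain ⟨C, hC0, hC⟩ := exists_norm_ft_le (fun N => hφ N (Module.finrank ℝ (Space d) + 1))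
      (Module.finrank ℝ (Space d) + 1)
    have h1 := (continuous_ft (hφ 0 (Module.finrank ℝ (Space d) + 1))).comp
      (by fun_prop : Continuous fun θ : Space d => ((), θ))
    exact ((integrable_wt_pow_inv (volume : Measure (Space d)) le_rfl).const_mul C).mono'
      h1.aestronglyMeasurable (Eventually.of_forall fun θ => hC () θ)
  rw [← ft_ft hc (hφ.integrable ()) hF x, ft]
  refine integral_congr_ae (Eventually.of_forall fun η => ?_)
  simp only [ft]
  rw [← integral_const_mul]
  refine integral_congr_ae (Eventually.of_forall fun y => ?_)
  simp only [phase, pairing_space, mul_one, inner_sub_left, inner_neg_right]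
  rw [← mul_assoc, ← Complex.exp_add, real_inner_comm x η]
  congr 2
  push_cast
  ring

/-- At such an order the quantization has a continuous kernel. Testing shows that the kernel
vanishes, and Fourier inversion in the momentum then recovers `f = 0`. -/
theorem eq_zero_of_op_eq_zero_of_decay {ε : ℝ} (hε : ε ≠ 0)
    (hm : m ≤ -((Module.finrank ℝ (Space d) + 1 : ℕ) : ℝ))
    (hf : ∀ N, BddFamily N (symWt m) fun _ : Unit => f)
    (h : ∀ φ : Space d → ℂ, (RapidFamily fun _ : Unit => φ) → ∀ x, op ε (fun _ => 1) f φ x = 0) :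
    f = 0 := by
  have hpi : (((2 * Real.pi) ^ d : ℝ) : ℂ) ≠ 0 := by
    exact_mod_cast (pow_pos (by positivity : (0 : ℝ) < 2 * Real.pi) d).ne'
  set D := Module.finrank ℝ (Space d) + 1 with hD
  have hfc : Continuous f := (hf 0).continuous_apply ()
  obtain ⟨C, hC0, hC⟩ := (hf 0).exists_bound_pos (symWt_nonneg m)
  have hb : ∀ p ξ, ‖f (p, ξ)‖ ≤ C * 2 ^ D * (wt ξ ^ D)⁻¹ := fun p ξ => by
    rw [mul_assoc]
    exact (hC () (p, ξ)).trans (mul_le_mul_of_nonneg_left (symWt_le_wt_inv D hm _) hC0)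
  have hint : Integrable fun ξ : Space d => C * 2 ^ D * (wt ξ ^ D)⁻¹ :=
    (integrable_wt_pow_inv (volume : Measure (Space d)) le_rfl).const_mul _
  have hcont : Continuous (pft f) := by
    refine continuous_of_dominated (F := fun (p : Space d × Space d) ξ => phase (ξ, p.2) * f (p.1, ξ))
      (fun p => (Continuous.mul (continuous_phase.comp (by fun_prop)) (hfc.comp
        (by fun_prop))).aestronglyMeasurable) (fun p => Eventually.of_forall fun ξ => ?_) hint
      (Eventually.of_forall fun ξ => Continuous.mul (continuous_phase.comp (by fun_prop))
        (hfc.comp (by fun_prop)))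
    rw [norm_mul, norm_phase, one_mul]
    exact hb _ _
  have hker : ∀ x y, pft f ((ε / 2) • (x + y), y - x) = 0 := by
    intro x
    have hk : Continuous fun y => pft f ((ε / 2) • (x + y), y - x) := hcont.comp (by fun_prop)
    have h0 : ∀ᵐ y, pft f ((ε / 2) • (x + y), y - x) = 0 := by
      refine ae_eq_zero_of_integral_contDiff_smul_eq_zero hk.locallyIntegrable fun g hg hgc => ?_
      have hg' : RapidFamily fun _ : Unit => fun y => (g y : ℂ) :=
        rapidFamily_of_hasCompactSupport (Complex.ofRealCLM.contDiff.comp hg)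
          (hgc.comp_left (g := fun r : ℝ => (r : ℂ)) (by simp))
      have h1 := h _ hg' x
      rw [op_eq_kernel PolyFamily.one hg' hf hm] at h1
      simpa [hpi, Real.pi_ne_zero] using h1
    have h1 : (fun y => pft f ((ε / 2) • (x + y), y - x)) = fun _ => 0 :=
      (Continuous.ae_eq_iff_eq volume hk continuous_const).1 h0
    exact fun y => congrFun h1 y
  -- For `ε ≠ 0` the scaled midpoint and the difference of `x, y` take every pair of values.
  have hpft : ∀ p w, pft f (p, w) = 0 := fun p w => by
    have h1 := hker (ε⁻¹ • p - (1 / 2 : ℝ) • w) (ε⁻¹ • p + (1 / 2 : ℝ) • w)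
    have e1 : (ε / 2) • (ε⁻¹ • p - (1 / 2 : ℝ) • w + (ε⁻¹ • p + (1 / 2 : ℝ) • w)) = p := by
      rw [show ε⁻¹ • p - (1 / 2 : ℝ) • w + (ε⁻¹ • p + (1 / 2 : ℝ) • w) = (2 * ε⁻¹) • p by module,
        smul_smul, show ε / 2 * (2 * ε⁻¹) = 1 by field_simp, one_smul]
    have e2 : ε⁻¹ • p + (1 / 2 : ℝ) • w - (ε⁻¹ • p - (1 / 2 : ℝ) • w) = w := by module
    rwa [e1, e2] at h1
  ext ⟨p, ξ⟩
  have hft : ft (fun ξ => f (p, ξ)) = 0 := funext fun w => hpft p w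
  have hi : Integrable fun ξ => f (p, ξ) := hint.mono'
    (hfc.comp (by fun_prop)).aestronglyMeasurable (Eventually.of_forall (hb p))
  have hc : Continuous fun ξ => f (p, ξ) := hfc.comp (by fun_prop)
  have h1 := ft_ft hc hi
    (by rw [hft]; exact integrable_zero _ _ _) ξ
  rw [hft] at h1
  have h2 : ft (0 : Space d → ℂ) (-ξ) = 0 := by simp [ft]
  rw [h2] at h1
  exact (mul_eq_zero.1 h1.symm).resolve_left hpi

/-- The symbol `1` is neutral for the product. -/
theorem sharp_one {ε : ℝ} (hε : ε ≠ 0) (hε1 : |ε| ≤ 1)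
    (hf : ∀ N, BddFamily N (symWt m) fun _ : Unit => f) :
    sharp ε (fun _ => 1) f (fun _ => 1) = f := by
  have hχ := rapidFamily_cutoff (d := d)
  set D := Module.finrank ℝ (Space d) + 1 with hD
  have key : ∀ u : Phase d → ℂ, (RapidFamily fun _ : Unit => u) →
      sharp ε (fun _ => 1) u (fun _ => 1) = u := by
    intro u hu
    have hu' := hu.symWt (-(D : ℝ))
    have hs : ∀ N, BddFamily N (symWt (-(D : ℝ))) fun _ : Unit => sharp ε (fun _ => 1) u fun _ => 1 := by
      intro N
      have := bddFamily_sharp (ι := Unit) (ε := fun _ => ε) continuous_const (fun _ => hε1)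
        PolyFamily.one hu' bddFamily_one N
      rwa [add_zero] at this
    -- The operator of the product with `1` is that of `u` composed with the identity, so uniqueness
    -- at order `-D` identifies the symbols.
    have h0 := eq_zero_of_op_eq_zero_of_decay hε le_rfl (f := fun X =>
      sharp ε (fun _ => 1) u (fun _ => 1) X - u X)
      (fun N => ((hs N).add (hu' N).neg).congr fun _ X => (sub_eq_add_neg _ _).symm)
      fun φ hφ x => by
        rw [op_sub PolyFamily.one hφ hs hu', ← op_comp hε hε1 PolyFamily.one (by simp)
          PolyFamily.one (by simp) hu' bddFamily_one hφ,
          show op ε (fun _ => 1) (fun _ => 1) φ = φ from funext (op_one ε hφ), sub_self]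
    exact funext fun X => sub_eq_zero.1 (congrFun h0 X)
  ext X
  have hX : Continuous fun δ : unitInterval => (δ, X) := by fun_prop
  have hL : Continuous fun δ : unitInterval =>
      sharp ε (fun _ => 1) (dilateMul cutoff f δ) (fun _ => 1) X := by
    have h := (bddFamily_sharp (ι := unitInterval) (ε := fun _ => ε) continuous_const
      (fun _ => hε1) PolyFamily.one (bddFamily_dilateMul hχ hf) (fun N => (bddFamily_one N).reindex
        (f := fun _ : unitInterval => ()) continuous_const) 0).continuous.comp hX
    simp only [Function.comp_def] at h
    exact h
  have hR : Continuous fun δ : unitInterval => dilateMul cutoff f δ X := by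
    have h := (bddFamily_dilateMul hχ hf 0).continuous.comp hX
    simp only [Function.comp_def] at h
    exact h
  have hL' := tendsto_apply_of_unitInterval
    (F := fun δ : ℝ => sharp ε (fun _ => 1) (dilateMul cutoff f δ) (fun _ => 1) X) hL
  have hR' := tendsto_apply_of_unitInterval (F := fun δ : ℝ => dilateMul cutoff f δ X) hR
  simp only [dilateMul_cutoff_zero] at hL' hR'
  refine tendsto_nhds_unique (hL'.congr' ?_) hR'
  filter_upwards [self_mem_nhdsWithin] with δ hδ
  exact congrFun (key _ (rapidFamily_dilateMul hχ hf (mem_Ioi.1 hδ).ne')) X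

/-- If the operator of `f` vanishes, so does that of its product with any rapidly decreasing `u`.
This product has order `-D`, hence is zero. Letting `u` tend to `1` through dilated cut-offs, the
products tend to the product of `f` with `1`, which is `f`. -/
theorem eq_zero_of_op_eq_zero {ε : ℝ} (hε : ε ≠ 0) (hε1 : |ε| ≤ 1)
    (hf : ∀ N, BddFamily N (symWt m) fun _ : Unit => f)
    (h : ∀ φ : Space d → ℂ, (RapidFamily fun _ : Unit => φ) → ∀ x, op ε (fun _ => 1) f φ x = 0) :
    f = 0 := by
  have hχ := rapidFamily_cutoff (d := d)
  set D := Module.finrank ℝ (Space d) + 1 with hD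
  have key : ∀ u : Phase d → ℂ, (RapidFamily fun _ : Unit => u) →
      sharp ε (fun _ => 1) f u = 0 := by
    intro u hu
    have hu' := hu.symWt (-(D : ℝ) - m)
    have hs : ∀ N, BddFamily N (symWt (-(D : ℝ))) fun _ : Unit => sharp ε (fun _ => 1) f u := by
      intro N
      have := bddFamily_sharp (ι := Unit) (ε := fun _ => ε) continuous_const (fun _ => hε1)
        PolyFamily.one hf hu' N
      rwa [add_sub_cancel] at this
    refine eq_zero_of_op_eq_zero_of_decay hε le_rfl hs fun φ hφ x => ?_
    rw [← op_comp hε hε1 PolyFamily.one (by simp) PolyFamily.one (by simp) hf hu' hφ]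
    exact h _ (rapidFamily_op ε PolyFamily.one hφ hu') x
  rw [← sharp_one hε hε1 hf]
  ext X
  have hX : Continuous fun δ : unitInterval => (δ, X) := by fun_prop
  have hL : Continuous fun δ : unitInterval =>
      sharp ε (fun _ => 1) f (dilateMul cutoff (fun _ => 1) δ) X := by
    have h := (bddFamily_sharp (ι := unitInterval) (ε := fun _ => ε) continuous_const
      (fun _ => hε1) PolyFamily.one (fun N => (hf N).reindex
        (f := fun _ : unitInterval => ()) continuous_const)
      (bddFamily_dilateMul hχ bddFamily_one) 0).continuous.comp hX
    simp only [Function.comp_def] at h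
    exact h
  have hL' := tendsto_apply_of_unitInterval
    (F := fun δ : ℝ => sharp ε (fun _ => 1) f (dilateMul cutoff (fun _ => 1) δ) X) hL
  simp only [dilateMul_cutoff_zero] at hL'
  refine tendsto_nhds_unique hL' (tendsto_const_nhds.congr' ?_)
  filter_upwards [self_mem_nhdsWithin] with δ hδ
  exact (congrFun (key _ (rapidFamily_dilateMul hχ bddFamily_one (mem_Ioi.1 hδ).ne')) X).symm

/-- A symbol is determined by its quantization. -/
theorem eq_of_op_eq {ε : ℝ} (hε : ε ≠ 0) (hε1 : |ε| ≤ 1) {e e' : Space d × Space d → ℂ}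
    (he : PolyFamily wt fun _ : Unit => e) (he' : PolyFamily wt fun _ : Unit => e')
    (hee' : ∀ p, e p * e' p = 1)
    (hf : ∀ N, BddFamily N (symWt m) fun _ : Unit => f)
    (hg : ∀ N, BddFamily N (symWt m) fun _ : Unit => g)
    (h : ∀ φ : Space d → ℂ, (RapidFamily fun _ : Unit => φ) → op ε e f φ = op ε e g φ) :
    f = g := by
  have hfg : ∀ N, BddFamily N (symWt m) fun _ : Unit => fun X => f X - g X :=
    fun N => ((hf N).add (hg N).neg).congr fun _ X => (sub_eq_add_neg _ _).symm
  have h0 := eq_zero_of_op_eq_zero hε hε1 hfg fun φ hφ x => by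
    -- At a fixed `x` the gauge factor is removed by testing with `φ(y) e'(x, y)`, which reduces the
    -- claim to the case without gauge.
    have hψ : RapidFamily fun _ : Unit => fun y => φ y * e' (x, y) := by
      refine hφ.mul_poly fun N => ?_
      obtain ⟨k, hk⟩ := he' N
      have h1 : BddFamily N (fun p : Space d × Space d => wt p.1 ^ k * wt p.2 ^ k)
          fun (_ : Unit) p => e' p.swap :=
        hk.comp_const ((ContinuousLinearMap.snd ℝ (Space d) (Space d)).prod
          (ContinuousLinearMap.fst ℝ (Space d) (Space d))) ⟨1, zero_le_one, fun p => by
            rw [one_mul, ← mul_pow, mul_comm (wt p.1)]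
            exact pow_le_pow_left₀ (wt_nonneg _) (wt_prod_le _) k⟩
          fun p => pow_nonneg (wt_nonneg _) _
      have h2 := ((h1.slice (om := fun y => wt y ^ k) (ρ := fun z => wt z ^ k) (continuous_wt.pow k) fun z => pow_pos (wt_pos z) k).reindex
        (f := fun _ : Unit => (x, ())) continuous_const).smul_const ((wt x ^ k : ℝ) : ℂ)
      refine ⟨k, h2.congr fun _ y => ?_⟩
      rw [← mul_assoc, ← Complex.ofReal_mul, mul_inv_cancel₀ (pow_pos (wt_pos x) k).ne',
        Complex.ofReal_one, one_mul, Prod.swap_prod_mk]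
    have e1 : ∀ z, opAmp ε (fun _ => 1) (fun X => f X - g X) φ (x, z) =
        opAmp ε e (fun X => f X - g X) (fun y => φ y * e' (x, y)) (x, z) := fun z => by
      simp only [opAmp, segMap_apply]
      rw [mul_left_comm, hee']
      ring
    have e2 := op_sub he hψ hf hg ε x
    rw [h _ hψ, sub_self] at e2
    rw [← e2]
    simp only [op, e1]
  exact funext fun X => sub_eq_zero.1 (congrFun h0 X)

end Uniqueness

/-! ### The magnetic Weyl product and its expansion -/

section Expansion

variable {d : ℕ} {m m₁ m₂ ρ : ℝ} {f g h : Phase d → ℂ}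

theorem mixedDeriv_const_mul {u : Phase d → ℂ} (hu : ContDiff ℝ ∞ u) (r : ℂ) {j k : ℕ}
    (a : Fin j → Fin d) (α : Fin k → Fin d) (X : Phase d) :
    mixedDeriv a α (fun X => r * u X) X = r * mixedDeriv a α u X := by
  have := iteratedFDeriv_const_smul_apply' (𝕜 := ℝ) (i := j + k) (a := r) (x := X)
    (hu.contDiffAt.of_le (by exact_mod_cast le_top))
  simp only [smul_eq_mul] at this
  rw [mixedDeriv, this]
  rfl

theorem IsHormanderSymbol.const_mul (hf : IsHormanderSymbol m ρ f) (r : ℂ) :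
    IsHormanderSymbol m ρ fun X => r * f X :=
  ⟨contDiff_const.mul hf.smooth, fun j k a α => by
    obtain ⟨C, hC⟩ := hf.bound j k a α
    refine ⟨‖r‖ * C, fun x ξ => ?_⟩
    rw [mixedDeriv_const_mul hf.smooth, norm_mul, mul_assoc]
    exact mul_le_mul_of_nonneg_left (hC x ξ) (norm_nonneg _)⟩

theorem IsHormanderSymbol.bddFamily (hρ : 0 ≤ ρ) (hf : IsHormanderSymbol m ρ f) (N : ℕ) :
    BddFamily N (symWt m) fun _ : Unit => f :=
  (hf.symFamily N).bddFamily hρ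

theorem BddFamily.symWt_mono {ι : Type*} [TopologicalSpace ι] {N : ℕ} {u : ι → Phase d → ℂ}
    (hm : m₁ ≤ m₂) (hu : BddFamily N (symWt m₁) u) : BddFamily N (symWt m₂) u :=
  hu.mono' (MagneticWeyl.symWt_mono hm) (symWt_nonneg m₁)

theorem isHormanderSymbol_sharp {ε : ℝ} (hε1 : |ε| ≤ 1) (hρ : 0 ≤ ρ)
    {G : Space d × Space d × Space d → ℂ} (hG : PolyFamily cfgWt fun _ : Unit => G)
    (hf : IsHormanderSymbol m₁ ρ f) (hg : IsHormanderSymbol m₂ ρ g) :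
    IsHormanderSymbol (m₁ + m₂) ρ (sharp ε G f g) :=
  SymFamily.isHormanderSymbol hρ (symFamily_sharp hρ (ε := fun _ : Unit => ε) continuous_const
    (fun _ => hε1) hG hf.symFamily hg.symFamily) ()

/-- The symbol `sharp ε G f g` has the same quantization by `op_comp`. Both symbols are placed in
the class of the larger order, where a symbol is determined by its operator. -/
theorem eq_sharp_of_op {ε : ℝ} (hε : ε ≠ 0) (hε1 : |ε| ≤ 1) (hρ : 0 ≤ ρ)
    {e e' : Space d × Space d → ℂ}
    (he : PolyFamily wt fun _ : Unit => e) (he' : PolyFamily wt fun _ : Unit => e')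
    (hee' : ∀ p, e p * e' p = 1) (he1 : ∀ p, ‖e p‖ ≤ 1)
    {G : Space d × Space d × Space d → ℂ} (hG : PolyFamily cfgWt fun _ : Unit => G)
    (hcocycle : ∀ x y r, e (x, y) * e (y, r) = e (x, r) * G ((ε / 2) • (x + r), (y - x, r - y)))
    (hf : IsHormanderSymbol m₁ ρ f) (hg : IsHormanderSymbol m₂ ρ g) (hh : IsHormanderSymbol m ρ h)
    (hop : ∀ φ : Space d → ℂ, (RapidFamily fun _ : Unit => φ) →
      op ε e f (op ε e g φ) = op ε e h φ) : h = sharp ε G f g :=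
  eq_of_op_eq (m := max m (m₁ + m₂)) hε hε1 he he' hee'
    (fun N => (hh.bddFamily hρ N).symWt_mono (le_max_left _ _))
    (fun N => ((isHormanderSymbol_sharp hε1 hρ hG hf hg).bddFamily hρ N).symWt_mono
      (le_max_right _ _))
    fun φ hφ => by
      rw [← hop φ hφ]
      exact funext (op_comp hε hε1 he he1 hG hcocycle (hf.bddFamily hρ) (hg.bddFamily hρ) hφ)

theorem isWeylProduct_iff {ε : ℝ} (hε : ε ≠ 0) (hε1 : |ε| ≤ 1) (hρ : 0 ≤ ρ)
    (hf : IsHormanderSymbol m₁ ρ f) (hg : IsHormanderSymbol m₂ ρ g) :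
    IsWeylProduct ρ ε f g h ↔ h = sharp ε (fun _ => 1) f g := by
  have hcomp : ∀ {m : ℝ} {h : Phase d → ℂ}, IsHormanderSymbol m ρ h → ∀ {φ : Space d → ℂ},
      (RapidFamily fun _ : Unit => φ) →
      ((weylQuantization ε f (weylQuantization ε g φ) = weylQuantization ε h φ) ↔
        op ε (fun _ => 1) f (op ε (fun _ => 1) g φ) = op ε (fun _ => 1) h φ) := by
    intro m h hh φ hφ
    rw [weylQuantization_eq_op ε hφ (hg.bddFamily hρ), weylQuantization_eq_op ε hφ (hh.bddFamily hρ),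
      weylQuantization_eq_op ε (rapidFamily_op ε PolyFamily.one hφ (hg.bddFamily hρ))
        (hf.bddFamily hρ)]
  constructor
  · rintro ⟨⟨m, hh⟩, hq⟩
    refine eq_sharp_of_op hε hε1 hρ PolyFamily.one PolyFamily.one (by simp) (by simp)
      PolyFamily.one (by simp) hf hg hh fun φ hφ => ?_
    obtain ⟨ψ, rfl⟩ := hφ.exists_schwartzMap
    exact (hcomp hh hφ).1 (hq ψ)
  · rintro rfl
    have hs := isHormanderSymbol_sharp hε1 hρ PolyFamily.one hf hg
    refine ⟨⟨_, hs⟩, fun φ => (hcomp hs (SchwartzMap.rapidFamily φ)).2 ?_⟩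
    exact funext (op_comp hε hε1 PolyFamily.one (by simp) PolyFamily.one (by simp)
      (hf.bddFamily hρ) (hg.bddFamily hρ) (SchwartzMap.rapidFamily φ))

variable {B : Fin d → Fin d → Space d → ℝ}

/-- Uniqueness requires only one vector potential, while existence must hold for every one. It does,
because the weight `e^{-iλγ_ε}` is built from `B` alone. The inverse gauge factor is the one for
`-λ`. -/
theorem isMagneticWeylProduct_iff (hB : IsMagneticField B) {ε lam : ℝ} (hε : ε ≠ 0) (hε1 : |ε| ≤ 1)
    (hlam : |lam| ≤ 1) (hρ : 0 ≤ ρ) (hf : IsHormanderSymbol m₁ ρ f) (hg : IsHormanderSymbol m₂ ρ g) :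
    IsMagneticWeylProduct ρ B ε lam f g h ↔
      h = sharp ε (fun c => Complex.exp (-Complex.I * lam * fluxFun B ε c)) f g := by
  have hG := polyFamily_expFlux (ι := Unit) hB (ε := fun _ => ε) continuous_const (fun _ => hε1)
    (fun _ => hε) (κ := fun _ => lam) continuous_const (fun _ => hlam)
  have hcomp : ∀ {A : Fin d → Space d → ℝ}, IsVectorPotential B A → ∀ {m : ℝ} {h : Phase d → ℂ},
      IsHormanderSymbol m ρ h → ∀ {φ : Space d → ℂ}, (RapidFamily fun _ : Unit => φ) →
      ((magneticQuantization A ε lam f (magneticQuantization A ε lam g φ) =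
        magneticQuantization A ε lam h φ) ↔
        op ε (gauge A ε lam) f (op ε (gauge A ε lam) g φ) = op ε (gauge A ε lam) h φ) := by
    intro A hA m h hh φ hφ
    rw [magneticQuantization_eq_op hA.growth ε lam hφ (hg.bddFamily hρ),
      magneticQuantization_eq_op hA.growth ε lam hφ (hh.bddFamily hρ),
      magneticQuantization_eq_op hA.growth ε lam
        (rapidFamily_op ε (polyFamily_gauge hA.growth ε lam) hφ (hg.bddFamily hρ)) (hf.bddFamily hρ)]
  constructor
  · rintro ⟨⟨m, hh⟩, hq⟩
    obtain ⟨A, hA⟩ := hB.exact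
    refine eq_sharp_of_op hε hε1 hρ (polyFamily_gauge hA.growth ε lam)
      (polyFamily_gauge hA.growth ε (-lam)) (fun p => ?_) (fun p => (norm_gauge A ε lam p).le)
      hG (gauge_cocycle hA ε lam) hf hg hh fun φ hφ => ?_
    · rw [gauge, gauge, ← Complex.exp_add, ← Complex.exp_zero]
      congr 1
      push_cast
      ring
    · obtain ⟨ψ, rfl⟩ := hφ.exists_schwartzMap
      exact (hcomp hA hh hφ).1 (hq A hA ψ)
  · rintro rfl
    have hs := isHormanderSymbol_sharp hε1 hρ hG hf hg
    refine ⟨⟨_, hs⟩, fun A hA φ => (hcomp hA hs (SchwartzMap.rapidFamily φ)).2 ?_⟩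
    exact funext (op_comp hε hε1 (polyFamily_gauge hA.growth ε lam) (fun p => (norm_gauge A ε lam p).le)
      hG (gauge_cocycle hA ε lam) (hf.bddFamily hρ) (hg.bddFamily hρ) (SchwartzMap.rapidFamily φ))

/-- The weight of the remainder without its power of `λ`. -/
def tailWeight (B : Fin d → Fin d → Space d → ℝ) (ε lam : ℝ) (N : ℕ)
    (c : Space d × Space d × Space d) : ℂ :=
  (N.factorial : ℂ)⁻¹ * (-Complex.I) ^ (N + 1) * (fluxFun B ε c ^ (N + 1) *
    taylorTail N lam (scaledFlux B ε c.1 c.2.1 c.2.2))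

section Families

variable {ι : Type*} [TopologicalSpace ι] {ε lam : ι → ℝ}

theorem polyFamily_termWeight [FirstCountableTopology ι] (hB : IsMagneticField B) (hεc : Continuous ε) (hε : ∀ t, |ε t| ≤ 1)
    (hε0 : ∀ t, ε t ≠ 0) (k : ℕ) :
    PolyFamily cfgWt fun t c => termWeight B (ε t) k c.1 c.2.1 c.2.2 :=
  (((polyFamily_fluxFun hB hεc hε hε0).pow k).const_mul
    (c := fun _ => (-Complex.I) ^ k / (k.factorial : ℂ)) continuous_const ⟨_, fun _ => le_rfl⟩).congr
    fun t c => (termWeight_eq B (ε t) k c).symm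

theorem polyFamily_tailWeight [FirstCountableTopology ι] (hB : IsMagneticField B)
    (hεc : Continuous ε) (hε : ∀ t, |ε t| ≤ 1)
    (hε0 : ∀ t, ε t ≠ 0) (hlc : Continuous lam) (hl : ∀ t, |lam t| ≤ 1) (N : ℕ) :
    PolyFamily cfgWt fun t => tailWeight B (ε t) (lam t) N :=
  (((polyFamily_fluxFun hB hεc hε hε0).pow (N + 1)).mul
    (polyFamily_taylorTail hB hεc hε hε0 hlc hl N)).const_mul continuous_const ⟨_, fun _ => le_rfl⟩

theorem symFamily_sharp_termWeight [FirstCountableTopology ι] (hρ : 0 ≤ ρ) (hB : IsMagneticField B)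
    (hεc : Continuous ε) (hε : ∀ t, |ε t| ≤ 1) (hε0 : ∀ t, ε t ≠ 0)
    (hf : IsHormanderSymbol m₁ ρ f) (hg : IsHormanderSymbol m₂ ρ g) (k N : ℕ) :
    SymFamily ρ N (m₁ + m₂ - 2 * k * ρ) fun t =>
      sharp (ε t) (fun c => termWeight B (ε t) k c.1 c.2.1 c.2.2) f g := by
  have := symFamily_sharp_flux_pow hρ hB hεc hε hε0
    (G := fun _ _ => (-Complex.I) ^ k / (k.factorial : ℂ))
    (PolyFamily.of_bdd fun _ => BddFamily.const continuous_const ⟨_, fun _ => le_rfl⟩)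
    (f := fun _ => f) (g := fun _ => g) hf.symFamily hg.symFamily k N
  simpa only [termWeight_eq, mul_comm] using this

/-- The weight is `γ_ε^{M+1}` times a function of `γ_ε` with derivatives bounded uniformly in the
coupling. Thus the full gain `2(M + 1)ρ` is obtained with constants valid for all values of both
parameters. -/
theorem symFamily_sharp_tailWeight [FirstCountableTopology ι] (hρ : 0 ≤ ρ) (hB : IsMagneticField B)
    (hεc : Continuous ε) (hε : ∀ t, |ε t| ≤ 1) (hε0 : ∀ t, ε t ≠ 0) (hlc : Continuous lam)
    (hl : ∀ t, |lam t| ≤ 1) (hf : IsHormanderSymbol m₁ ρ f) (hg : IsHormanderSymbol m₂ ρ g)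
    (M N : ℕ) : SymFamily ρ N (m₁ + m₂ - 2 * (M + 1) * ρ) fun t =>
      sharp (ε t) (tailWeight B (ε t) (lam t) M) f g := by
  have h1 := symFamily_sharp_flux_pow hρ hB hεc hε hε0
    (G := fun t c => (M.factorial : ℂ)⁻¹ * (-Complex.I) ^ (M + 1) *
      taylorTail M (lam t) (scaledFlux B (ε t) c.1 c.2.1 c.2.2))
    ((polyFamily_taylorTail hB hεc hε hε0 hlc hl M).const_mul continuous_const ⟨_, fun _ => le_rfl⟩)
    (f := fun _ => f) (g := fun _ => g) hf.symFamily hg.symFamily (M + 1) N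
  have h2 : ∀ t, tailWeight B (ε t) (lam t) M = fun c => fluxFun B (ε t) c ^ (M + 1) *
      ((M.factorial : ℂ)⁻¹ * (-Complex.I) ^ (M + 1) *
        taylorTail M (lam t) (scaledFlux B (ε t) c.1 c.2.1 c.2.2)) := fun t => by
    ext c; rw [tailWeight]; ring
  simp only [h2]
  exact_mod_cast h1

end Families

/-- Taylor expansion of the product in the coupling constant. -/
theorem sharp_expFlux_sub (hB : IsMagneticField B) {ε lam : ℝ} (hε : ε ≠ 0) (hε1 : |ε| ≤ 1)
    (hlam : |lam| ≤ 1) (hρ : 0 ≤ ρ) (hf : IsHormanderSymbol m₁ ρ f) (hg : IsHormanderSymbol m₂ ρ g)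
    (N : ℕ) (X : Phase d) :
    sharp ε (fun c => Complex.exp (-Complex.I * lam * fluxFun B ε c)) f g X -
      ∑ k ∈ Finset.range (N + 1), (lam : ℂ) ^ k *
        sharp ε (fun c => termWeight B ε k c.1 c.2.1 c.2.2) f g X =
      (lam : ℂ) ^ (N + 1) * sharp ε (tailWeight B ε lam N) f g X := by
  have hf' := hf.bddFamily hρ
  have hg' := hg.bddFamily hρ
  have hc : Continuous fun _ : Unit => ε := continuous_const
  have hT := fun k => polyFamily_termWeight (ι := Unit) hB hc (fun _ => hε1) (fun _ => hε) k
  have hR := polyFamily_tailWeight (ι := Unit) hB hc (fun _ => hε1) (fun _ => hε)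
    (lam := fun _ => lam) continuous_const (fun _ => hlam) N
  have hT' := fun k => (hT k).const_mul (c := fun _ => (lam : ℂ) ^ k) continuous_const
    ⟨_, fun _ => le_rfl⟩
  have hR' := hR.const_mul (c := fun _ => (lam : ℂ) ^ (N + 1)) continuous_const ⟨_, fun _ => le_rfl⟩
  have hS := PolyFamily.sum one_le_cfgWt (Finset.range (N + 1)) fun k _ => hT' k
  have h1 := sharp_add_weight hc (fun _ => hε1) hS hR' hf' hg' () X
  have h2 := sharp_sum_weight (Finset.range (N + 1)) hc (fun _ => hε1) hT' hf' hg' () X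
  have h3 := fun k => sharp_const_mul_weight hc (fun _ => hε1) (hT k) hf' hg' ((lam : ℂ) ^ k) () X
  have h4 := sharp_const_mul_weight hc (fun _ => hε1) hR hf' hg' ((lam : ℂ) ^ (N + 1)) () X
  have hE : (fun c => Complex.exp (-Complex.I * lam * fluxFun B ε c)) = fun c =>
      (∑ k ∈ Finset.range (N + 1), (lam : ℂ) ^ k * termWeight B ε k c.1 c.2.1 c.2.2) +
        (lam : ℂ) ^ (N + 1) * tailWeight B ε lam N c := by
    ext c
    rw [expFlux_eq B ε lam N c, remainderWeight_eq, tailWeight]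
  rw [hE, h1, h2, h4]
  simp only [h3]
  ring

end Expansion

end MagneticWeyl

end

/-! ### The main theorem. -/

open MagneticWeyl

theorem mainTheorem3 {d : ℕ} (ρ : ℝ) (hρ : ρ ∈ Set.Icc (0 : ℝ) 1) (m₁ m₂ : ℝ)
    (B : Fin d → Fin d → MagneticWeyl.Space d → ℝ) (hB : MagneticWeyl.IsMagneticField B)
    (f g : MagneticWeyl.Phase d → ℂ)
    (hf : MagneticWeyl.IsHormanderSymbol m₁ ρ f) (hg : MagneticWeyl.IsHormanderSymbol m₂ ρ g) :
    ∃ (P : ℝ → ℝ → MagneticWeyl.Phase d → ℂ) (T : ℝ → ℕ → MagneticWeyl.Phase d → ℂ),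
      -- `P ε lam` is the magnetic Weyl product, which exists and is unique
      (∀ ε ∈ Set.Ioc (0 : ℝ) 1, ∀ lam ∈ Set.Icc (0 : ℝ) 1, ∀ h : MagneticWeyl.Phase d → ℂ,
        MagneticWeyl.IsMagneticWeylProduct ρ B ε lam f g h ↔ h = P ε lam) ∧
      -- the `k`-th term: oscillatory integral formula and symbol class
      (∀ ε ∈ Set.Ioc (0 : ℝ) 1, ∀ k : ℕ,
        MagneticWeyl.HasOscillatoryIntegral ε (MagneticWeyl.termWeight B ε k) f g (T ε k) ∧
        MagneticWeyl.IsHormanderSymbol (m₁ + m₂ - 2 * k * ρ) ρ (T ε k)) ∧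
      -- the zeroth term is the ordinary Weyl product
      (∀ ε ∈ Set.Ioc (0 : ℝ) 1, ∀ h : MagneticWeyl.Phase d → ℂ,
        MagneticWeyl.IsWeylProduct ρ ε f g h ↔ h = T ε 0) ∧
      -- the remainder: oscillatory integral formula and symbol class
      (∀ N : ℕ, ∀ ε ∈ Set.Ioc (0 : ℝ) 1, ∀ lam ∈ Set.Icc (0 : ℝ) 1,
        MagneticWeyl.HasOscillatoryIntegral ε (MagneticWeyl.remainderWeight B ε lam N) f g
          (fun X => P ε lam X - ∑ k ∈ Finset.range (N + 1), (lam : ℂ) ^ k * T ε k X) ∧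
        MagneticWeyl.IsHormanderSymbol (m₁ + m₂ - 2 * (N + 1) * ρ) ρ
          (fun X => P ε lam X - ∑ k ∈ Finset.range (N + 1), (lam : ℂ) ^ k * T ε k X)) ∧
      -- the remainder is of order `lam ^ (N + 1)` in every seminorm of its symbol class,
      -- uniformly in `ε`
      (∀ N j n : ℕ, ∀ (a : Fin j → Fin d) (α : Fin n → Fin d), ∃ C : ℝ,
        ∀ ε ∈ Set.Ioc (0 : ℝ) 1, ∀ lam ∈ Set.Icc (0 : ℝ) 1, ∀ x ξ : MagneticWeyl.Space d,
          ‖MagneticWeyl.mixedDeriv a α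
              (fun X => P ε lam X - ∑ k ∈ Finset.range (N + 1), (lam : ℂ) ^ k * T ε k X)
              (x, ξ)‖ ≤
            C * lam ^ (N + 1) *
              MagneticWeyl.bracket ξ ^ (m₁ + m₂ - 2 * (N + 1) * ρ - n * ρ)) := by
  have hρ0 := hρ.1
  have hf' := hf.bddFamily hρ0
  have hg' := hg.bddFamily hρ0
  have hε0 : ∀ {ε : ℝ}, ε ∈ Set.Ioc (0 : ℝ) 1 → ε ≠ 0 := fun h => h.1.ne'
  have hε1 : ∀ {ε : ℝ}, ε ∈ Set.Ioc (0 : ℝ) 1 → |ε| ≤ 1 := fun h => by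
    rw [abs_of_pos h.1]; exact h.2
  have hl1 : ∀ {lam : ℝ}, lam ∈ Set.Icc (0 : ℝ) 1 → |lam| ≤ 1 := fun h => by
    rw [abs_of_nonneg h.1]; exact h.2
  -- The remainder is an explicit power of the coupling times a product whose bounds do not depend
  -- on it; both remainder claims follow from this form.
  have hR : ∀ {ε : ℝ}, ε ∈ Set.Ioc (0 : ℝ) 1 → ∀ {lam : ℝ}, lam ∈ Set.Icc (0 : ℝ) 1 → ∀ N : ℕ,
      (fun X => sharp ε (fun c => Complex.exp (-Complex.I * lam * fluxFun B ε c)) f g X -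
        ∑ k ∈ Finset.range (N + 1), (lam : ℂ) ^ k *
          sharp ε (fun c => termWeight B ε k c.1 c.2.1 c.2.2) f g X) =
      fun X => (lam : ℂ) ^ (N + 1) * sharp ε (tailWeight B ε lam N) f g X :=
    fun hε lam hlam N => funext (sharp_expFlux_sub hB (hε0 hε) (hε1 hε) (hl1 hlam) hρ0 hf hg N)
  refine ⟨fun ε lam => sharp ε (fun c => Complex.exp (-Complex.I * lam * fluxFun B ε c)) f g,
    fun ε k => sharp ε (fun c => termWeight B ε k c.1 c.2.1 c.2.2) f g, ?_, ?_, ?_, ?_, ?_⟩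
  · exact fun ε hε lam hlam h =>
      isMagneticWeylProduct_iff hB (hε0 hε) (hε1 hε) (hl1 hlam) hρ0 hf hg
  · intro ε hε k
    exact ⟨hasOscillatoryIntegral_sharp (hε0 hε) (hε1 hε) (polyFamily_termWeight (ι := Unit) hB
        (ε := fun _ => ε) continuous_const (fun _ => hε1 hε) (fun _ => hε0 hε) k) hf' hg',
      SymFamily.isHormanderSymbol hρ0 (symFamily_sharp_termWeight (ι := Unit) hρ0 hB
        (ε := fun _ => ε) continuous_const (fun _ => hε1 hε) (fun _ => hε0 hε) hf hg k) ()⟩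
  · intro ε hε h
    have h1 : (fun c : Space d × Space d × Space d => termWeight B ε 0 c.1 c.2.1 c.2.2) =
        fun _ => 1 := by
      ext c; simp [termWeight]
    beta_reduce
    rw [h1]
    exact isWeylProduct_iff (hε0 hε) (hε1 hε) hρ0 hf hg
  · intro N ε hε lam hlam
    have hT := polyFamily_tailWeight (ι := Unit) hB (ε := fun _ => ε) continuous_const
      (fun _ => hε1 hε) (fun _ => hε0 hε) (lam := fun _ => lam) continuous_const
      (fun _ => hl1 hlam) N
    have hG := hT.const_mul (c := fun _ => (lam : ℂ) ^ (N + 1)) continuous_const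
      ⟨_, fun _ => le_rfl⟩
    have hosc := hasOscillatoryIntegral_sharp (hε0 hε) (hε1 hε) hG hf' hg'
    have h1 : (fun X => (lam : ℂ) ^ (N + 1) * sharp ε (tailWeight B ε lam N) f g X) =
        sharp ε (fun c => (lam : ℂ) ^ (N + 1) * tailWeight B ε lam N c) f g :=
      funext fun X => (sharp_const_mul_weight (ι := Unit) (ε := fun _ => ε) continuous_const
        (fun _ => hε1 hε) hT hf' hg' _ () X).symm
    have h2 : remainderWeight B ε lam N =
        fun x y z => (lam : ℂ) ^ (N + 1) * tailWeight B ε lam N (x, y, z) :=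
      funext fun x => funext fun y => funext fun z => remainderWeight_eq B ε lam N (x, y, z)
    simp only [hR hε hlam N]
    refine ⟨by rw [h1, h2]; exact hosc, IsHormanderSymbol.const_mul ?_ _⟩
    exact SymFamily.isHormanderSymbol hρ0 (symFamily_sharp_tailWeight (ι := Unit) hρ0 hB
      (ε := fun _ => ε) continuous_const (fun _ => hε1 hε) (fun _ => hε0 hε)
      (lam := fun _ => lam) continuous_const (fun _ => hl1 hlam) hf hg N) ()
  · intro N j n a α
    -- With both parameters in the index set, one constant serves all `ε` and `λ`. Compactness is
    -- not needed, since bounds of families are uniform by definition.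
    let ι := {p : ℝ × ℝ // p.1 ∈ Set.Ioc (0 : ℝ) 1 ∧ p.2 ∈ Set.Icc (0 : ℝ) 1}
    have hS := symFamily_sharp_tailWeight (ι := ι) hρ0 hB (ε := fun p => p.1.1) (by fun_prop)
      (fun p => hε1 p.2.1) (fun p => hε0 p.2.1) (lam := fun p => p.1.2) (by fun_prop)
      (fun p => hl1 p.2.2) hf hg N
    have hs := fun p : ι => (SymFamily.isHormanderSymbol hρ0 hS p).smooth
    obtain ⟨C, hC0, hC⟩ := SymFamily.mixedDeriv_bound hs hS a α
    refine ⟨C, fun ε hε lam hlam x ξ => ?_⟩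
    simp only [hR hε hlam N]
    rw [mixedDeriv_const_mul (hs ⟨(ε, lam), hε, hlam⟩), norm_mul, norm_pow, Complex.norm_real,
      Real.norm_of_nonneg hlam.1, mul_comm C, mul_assoc]
    exact mul_le_mul_of_nonneg_left (hC ⟨(ε, lam), hε, hlam⟩ x ξ) (pow_nonneg hlam.1 _)
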